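/- Let $n\ge 0$ and let $P\subseteq\mathbb R^n$ be a lattice polytope (the convex hull of a nonempty finite subset of $\mathbb Z^n$) with $\dim P\ge 2$. **Harmonic algebra.** For a finite set $Z\subseteq\mathbb C^n$ let $I(Z)\subseteq\mathbb C[x_1,\dots,x_n]$ be the ideal of polynomials vanishing on $Z$, let $\operatorname{gr}I(Z)$ be the ideal spanned by the top-degree homogeneous components of the elements of $I(Z)$, and let $V_Z=\{g\in\mathbb C[x_1,\dots,x_n] : f(\partial/\partial x_1,\dots,\partial/\partial x_n)\,g=0\text{ for all }f\in\operatorname{gr}I(Z)\}$. Put $(\mathcal H_P)_{m,d}=$ the homogeneous degree-$d$ part of $V_{(mP)\cap\mathbb Z^n}$ and $\mathcal H_P=\bigoplus_{m,d\ge0}(\mathcal H_P)_{m,d}$, with the multiplication of polynomials. **Section ring.** Let $A_P=\bigoplus_{m\ge0}\bigoplus_{u\in (mP)\cap\mathbb Z^n}\mathbb C\,x^uz^m$ be the semigroup algebra, graded by $m$, and let $X_P=\operatorname{Proj}A_P$ be the toric variety of $P$. Let $\mathcal O(H)=\mathcal O(1)$, where $H$ is the divisor of zeros of a nonzero section $g\in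 (A_P)_1$ of $\mathcal O(1)$. Let $e\in X_P$ be the identity point $x=(1,\dots,1)$ of the torus, let $\pi:\mathrm{Bl}_eX_P\to X_P$ be the blowup of $X_P$ at the reduced point $e$, with exceptional divisor $E$, and write $H$ also for the pullback of $H$. Let $$R_P=\bigoplus_{m,d\in\mathbb Z}H^0(\mathrm{Bl}_eX_P,\mathcal O(mH-dE)),$$ and let $s\in (R_P)_{0,-1}=H^0(\mathrm{Bl}_eX_P,\mathcal O(E))$ be the canonical section of $\mathcal O(E)$, whose zero locus is $E$. **Theorem.** $\mathrm{Bl}_eX_P$ is integral, $\mathcal H_P$ is closed under multiplication and is a bigraded $\mathbb C$-algebra, and there is an isomorphism of bigraded $\mathbb C$-algebras $\mathcal H_P\simeq R_P/(s)$, carrying $(\mathcal H_P)_{m,d}$ onto the image of $(R_P)_{m,d}$ for all $m,d\ge0$. (Hence the bigraded pieces of $R_P/(s)$ with $m<0$ or $d<0$ are zero.) -/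

import Mathlib

open AlgebraicGeometry CategoryTheory
open scoped Pointwise DirectSum

noncomputable section

/-! ### Lattice polytopes -/

/-- A lattice polytope in `ℝⁿ`: the convex hull of a nonempty finite set of points of `ℤⁿ`. -/
structure LatticePolytope (n : ℕ) where
  carrier : Set (Fin n → ℝ)
  isLattice : ∃ S : Finset (Fin n → ℤ), S.Nonempty ∧
    carrier = convexHull ℝ ((fun (v : Fin n → ℤ) (i : Fin n) => (v i : ℝ)) '' (S : Set (Fin n → ℤ)))

namespace LatticePolytope

variable {n : ℕ} (P : LatticePolytope n)

/-- The dimension of a polytope: the dimension of its affine hull. -/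
def dim : ℕ := Module.finrank ℝ (vectorSpan ℝ P.carrier)

/-- The set `(mP) ∩ ℤⁿ` of lattice points of the `m`-th dilation of `P`. -/
def latticePoints (m : ℕ) : Set (Fin n → ℤ) :=
  {u | (fun i => (u i : ℝ)) ∈ (m : ℝ) • P.carrier}

lemma convex_carrier : Convex ℝ P.carrier := by
  obtain ⟨S, -, h⟩ := P.isLattice
  rw [h]
  exact convex_convexHull ℝ _

lemma exists_mem_latticePoints_one : ∃ v, v ∈ P.latticePoints 1 := by
  obtain ⟨S, ⟨v, hv⟩, h⟩ := P.isLattice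
  refine ⟨v, ?_⟩
  simp only [latticePoints, Set.mem_ofPred_eq, Nat.cast_one, one_smul, h]
  exact subset_convexHull ℝ _ ⟨v, hv, rfl⟩

lemma zero_mem_latticePoints_zero : (0 : Fin n → ℤ) ∈ P.latticePoints 0 := by
  obtain ⟨v, hv⟩ := P.exists_mem_latticePoints_one
  obtain ⟨w, hw, -⟩ := Set.mem_smul_set.mp hv
  refine Set.mem_smul_set.mpr ⟨w, hw, ?_⟩
  ext i
  simp

lemma add_mem_latticePoints {m m' : ℕ} {u u' : Fin n → ℤ} (hu : u ∈ P.latticePoints m)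
    (hu' : u' ∈ P.latticePoints m') : u + u' ∈ P.latticePoints (m + m') := by
  have h := Set.add_mem_add (show _ ∈ (m : ℝ) • P.carrier from hu)
    (show _ ∈ (m' : ℝ) • P.carrier from hu')
  rw [← P.convex_carrier.add_smul (Nat.cast_nonneg m) (Nat.cast_nonneg m')] at h
  simp only [latticePoints, Set.mem_ofPred_eq, Nat.cast_add]
  convert h using 1
  ext i
  simp

end LatticePolytope

/-! ### Harmonic spaces and the bigraded pieces of the harmonic algebra -/

/-- The ideal `gr I(Z)` spanned by the top-degree homogeneous components of the polynomials
vanishing on `Z`. -/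
def grVanishingIdeal {n : ℕ} (Z : Set (Fin n → ℂ)) : Ideal (MvPolynomial (Fin n) ℂ) :=
  Ideal.span {h | ∃ f ∈ MvPolynomial.vanishingIdeal ℂ Z,
    h = MvPolynomial.homogeneousComponent f.totalDegree f}

/-- The differential operator `f(∂/∂x₁, …, ∂/∂xₙ)` on `ℂ[x₁, …, xₙ]`. -/
def diffOp {n : ℕ} (f : MvPolynomial (Fin n) ℂ) : Module.End ℂ (MvPolynomial (Fin n) ℂ) :=
  ∑ a ∈ f.support, f.coeff a •
    (List.ofFn fun i : Fin n =>
      ((MvPolynomial.pderiv i).toLinearMap : Module.End ℂ (MvPolynomial (Fin n) ℂ)) ^ a i).prod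

/-- The harmonic space `V_Z`: polynomials killed by `f(∂)` for all `f ∈ gr I(Z)`. -/
def harmonicSpace {n : ℕ} (Z : Set (Fin n → ℂ)) : Submodule ℂ (MvPolynomial (Fin n) ℂ) :=
  ⨅ f ∈ grVanishingIdeal Z, LinearMap.ker (diffOp f)

namespace LatticePolytope

variable {n : ℕ} (P : LatticePolytope n)

/-- The bigraded piece `(H_P)_{m,d}` of the harmonic algebra: the degree-`d` part of the harmonic
space of `(mP) ∩ ℤⁿ`. -/
def harmonicPiece (md : ℕ × ℕ) : Submodule ℂ (MvPolynomial (Fin n) ℂ) :=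
  harmonicSpace ((fun (u : Fin n → ℤ) (i : Fin n) => (u i : ℂ)) '' P.latticePoints md.1) ⊓
    MvPolynomial.homogeneousSubmodule (Fin n) ℂ md.2

/-! ### The semigroup algebra and the toric variety -/

/-- The semigroup of pairs `(u, m)` with `u ∈ (mP) ∩ ℤⁿ`. -/
def semigroup : AddSubmonoid ((Fin n → ℤ) × ℕ) where
  carrier := {p | p.1 ∈ P.latticePoints p.2}
  zero_mem' := P.zero_mem_latticePoints_zero
  add_mem' := fun h h' => P.add_mem_latticePoints h h'

/-- The semigroup algebra `A_P`; the basis element at `(u, m)` is `x^u z^m`. -/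
abbrev SemigroupAlgebra : Type := AddMonoidAlgebra ℂ P.semigroup

/-- The degree `(u, m) ↦ m`. -/
def degree : P.semigroup →+ ℕ := (AddMonoidHom.snd (Fin n → ℤ) ℕ).comp P.semigroup.subtype

/-- The grading of `A_P` by the exponent of `z`. -/
abbrev grading : ℕ → Submodule ℂ P.SemigroupAlgebra := AddMonoidAlgebra.gradeBy ℂ P.degree

/-- The toric variety `X_P = Proj A_P`. -/
def toricVariety : Scheme.{0} := Proj P.grading

/-- Evaluation at `x = (1, …, 1)`, as a map `A_P → ℂ[z]`, `x^u z^m ↦ z^m`. -/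
def evalOne : P.SemigroupAlgebra →ₐ[ℂ] AddMonoidAlgebra ℂ ℕ :=
  AddMonoidAlgebra.mapDomainAlgHom ℂ ℂ P.degree

lemma evalOne_single (p : P.semigroup) (c : ℂ) :
    P.evalOne (AddMonoidAlgebra.single p c) = AddMonoidAlgebra.single (P.degree p) c := by
  simp [evalOne]

lemma evalOne_decompose (a : P.SemigroupAlgebra) (i : ℕ) :
    P.evalOne (DirectSum.decompose P.grading a i) =
      AddMonoidAlgebra.single i ((P.evalOne a).coeff i) := by
  induction a using AddMonoidAlgebra.induction_linear with
  | zero => simp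
  | add f g hf hg =>
    simp only [DirectSum.decompose_add, DirectSum.add_apply, Submodule.coe_add, map_add, hf, hg,
      AddMonoidAlgebra.coeff_add, Finsupp.add_apply, AddMonoidAlgebra.single_add]
  | single p c =>
    have hmem : AddMonoidAlgebra.single p c ∈ P.grading (P.degree p) :=
      AddMonoidAlgebra.single_mem_gradeBy _ _ _
    by_cases h : P.degree p = i
    · subst h
      rw [DirectSum.decompose_of_mem_same _ hmem, evalOne_single]
      simp
    · rw [DirectSum.decompose_of_mem_ne _ hmem h, evalOne_single]
      simp [h]

/-- The homogeneous prime ideal of `A_P` of all elements vanishing at `x = (1, …, 1)`. -/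
def identityIdeal : HomogeneousIdeal P.grading where
  toSubmodule := RingHom.ker P.evalOne
  is_homogeneous' := by
    intro i a ha
    have ha' : P.evalOne a = 0 := ha
    change P.evalOne _ = 0
    rw [evalOne_decompose, ha']
    simp

lemma identityIdeal_isPrime : P.identityIdeal.toIdeal.IsPrime :=
  RingHom.ker_isPrime P.evalOne

lemma not_irrelevant_le_identityIdeal :
    ¬ HomogeneousIdeal.irrelevant P.grading ≤ P.identityIdeal := by
  intro hle
  obtain ⟨v, hv⟩ := P.exists_mem_latticePoints_one
  let p : P.semigroup := ⟨(v, 1), hv⟩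
  have hmem : (AddMonoidAlgebra.single p 1 : P.SemigroupAlgebra) ∈ P.grading 1 :=
    AddMonoidAlgebra.single_mem_gradeBy P.degree p 1
  have h : (AddMonoidAlgebra.single p 1 : P.SemigroupAlgebra) ∈ P.identityIdeal := by
    apply hle
    rw [HomogeneousIdeal.mem_irrelevant_iff, GradedRing.proj_apply,
      DirectSum.decompose_of_mem_ne _ hmem one_ne_zero]
  have h' : P.evalOne (AddMonoidAlgebra.single p 1) = 0 := h
  rw [evalOne_single] at h'
  simp at h'

/-- The identity point `e = (1, …, 1)` of the torus, as a point of `X_P`. -/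
def identityPoint : P.toricVariety :=
  (⟨P.identityIdeal, P.identityIdeal_isPrime, P.not_irrelevant_le_identityIdeal⟩ :
    ProjectiveSpectrum P.grading)

/-- The ideal sheaf of the closed point `e` (with its reduced structure) in `X_P`. -/
def identityIdealSheaf : P.toricVariety.IdealSheafData :=
  Scheme.IdealSheafData.vanishingIdeal ⟨closure {P.identityPoint}, isClosed_closure⟩

end LatticePolytope

/-! ### Blowups -/

/-- An ideal sheaf is the ideal sheaf of an effective Cartier divisor if it is locally generated by
one nonzerodivisor. -/
def AlgebraicGeometry.Scheme.IdealSheafData.IsEffectiveCartier {Y : Scheme.{0}}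
    (J : Y.IdealSheafData) : Prop :=
  ∀ y : Y, ∃ U : Y.affineOpens, y ∈ U.1 ∧ ∃ t ∈ nonZeroDivisors Γ(Y, U.1), J.ideal U = Ideal.span {t}

/-- `π : B ⟶ X` is the blowup of `X` along the closed subscheme with ideal sheaf `I`: the inverse
image ideal sheaf of `I` on `B` defines an effective Cartier divisor (the exceptional divisor), and
`π` is universal with this property. -/
structure IsBlowup {B X : Scheme.{0}} (π : B ⟶ X) (I : X.IdealSheafData) : Prop where
  isEffectiveCartier : (I.comap π).IsEffectiveCartier
  existsUnique_lift : ∀ {Y : Scheme.{0}} (f : Y ⟶ X), (I.comap f).IsEffectiveCartier →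
    ∃! g : Y ⟶ B, g ≫ π = f

/-- The stalk at `y`, as an ideal of the local ring, of an ideal sheaf. -/
def AlgebraicGeometry.Scheme.IdealSheafData.stalkIdeal {Y : Scheme.{0}} (J : Y.IdealSheafData)
    (y : Y) : Ideal (Y.presheaf.stalk y) :=
  Ideal.span {x | ∃ (U : Y.affineOpens) (hy : y ∈ U.1), ∃ a ∈ J.ideal U,
    x = Y.presheaf.germ U.1 y hy a}

/-! ### Line bundles and the section ring -/

namespace LatticePolytope

variable {n : ℕ} {P : LatticePolytope n} {B : Scheme.{0}} (π : B ⟶ P.toricVariety)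

/-- The field of rational functions of an integral scheme `B` over `X_P`. -/
def RatFun [IsIntegral B] (_ : B ⟶ P.toricVariety) : Type := B.functionField

instance [IsIntegral B] : Field (RatFun π) := inferInstanceAs (Field B.functionField)

/-- The inclusion of the local ring at `b` into the field of rational functions. -/
def ofStalk [IsIntegral B] (b : B) : B.presheaf.stalk b →+* RatFun π :=
  algebraMap (B.presheaf.stalk b) B.functionField

/-- Complex constants as global functions on `B`, through the structure map
`B ⟶ X_P ⟶ Spec (A_P)₀`. -/
def constSection : ℂ →+* Γ(B, ⊤) :=
  ((Scheme.ΓSpecIso (.of (P.grading 0))).inv ≫ (Proj.toSpecZero P.grading).appTop ≫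
    π.appTop).hom.comp (algebraMap ℂ (P.grading 0))

instance [IsIntegral B] : Algebra ℂ (RatFun π) :=
  ((ofStalk π (genericPoint B)).comp
    ((B.presheaf.germ ⊤ (genericPoint B) trivial).hom.comp (constSection π))).toAlgebra

lemma algebraMap_mem_range_ofStalk [IsIntegral B] (b : B) (c : ℂ) :
    algebraMap ℂ (RatFun π) c ∈ (ofStalk π b).range := by
  refine ⟨B.presheaf.germ ⊤ b trivial (constSection π c), ?_⟩
  have : Nonempty (⊤ : B.Opens) := ⟨⟨b, trivial⟩⟩
  exact (Scheme.algebraMap_germ_eq_germToFunctionField B (U := ⊤) trivial _).trans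
    (Scheme.algebraMap_germ_eq_germToFunctionField B (U := ⊤) trivial _).symm

/-- For `g, h ∈ (A_P)₁`, the regular function `g / h` on `D₊(h) ⊆ X_P`. -/
def quotSection (g h : P.SemigroupAlgebra) (hg : g ∈ P.grading 1) (hh : h ∈ P.grading 1) :
    Γ(Proj P.grading, Proj.basicOpen P.grading h) :=
  Proj.awayToSection P.grading h
    (HomogeneousLocalization.Away.mk P.grading hh 1 g (by simpa using hg))

/-- `t` is a local equation at `b` of the exceptional divisor `E` of `π`: a generator of the stalk
of the inverse image of the ideal sheaf of `e`. -/
def IsLocalEquationE [IsIntegral B] (b : B) (t : (RatFun π)ˣ) : Prop :=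
  ∃ τ : B.presheaf.stalk b, ofStalk π b τ = t ∧
    (P.identityIdealSheaf.comap π).stalkIdeal b = Ideal.span {τ}

/-- `a` is a local equation at `b` of the pullback to `B` of the divisor `H` of zeros of the section
`g ∈ (A_P)₁` of the twisting sheaf `𝒪(1)` on `X_P = Proj A_P`: it is the pullback of `g / h` for
some `h ∈ (A_P)₁` that does not vanish at `π b`, so that `h` trivializes `𝒪(1)` near `π b`. -/
def IsLocalEquationH [IsIntegral B] (g : P.grading 1) (b : B) (a : (RatFun π)ˣ) : Prop :=
  ∃ (h : P.grading 1) (hb : b ∈ π ⁻¹ᵁ (Proj.basicOpen P.grading (h : P.SemigroupAlgebra))),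
    ofStalk π b (B.presheaf.germ _ b hb
      (π.app (Proj.basicOpen P.grading (h : P.SemigroupAlgebra))
        (quotSection (g : P.SemigroupAlgebra) h g.2 h.2))) = a

/-- The space `H⁰(B, 𝒪(mH - dE))` of global sections of the line bundle of the Cartier divisor
`mH - dE`: rational functions `f` on `B` such that, at every point, the product of `f` and a local
equation of `mH - dE` is regular. (Local equations at a point differ by units of the local ring, so
it does not matter which ones are used.) -/
def sections [IsIntegral B] (g : P.grading 1) (md : ℤ × ℤ) : Submodule ℂ (RatFun π) where
  carrier := {f | ∀ (b : B) (a t : (RatFun π)ˣ), IsLocalEquationH π g b a →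
    IsLocalEquationE π b t →
      f * ((a ^ md.1 * t ^ (-md.2) : (RatFun π)ˣ) : RatFun π) ∈ (ofStalk π b).range}
  zero_mem' := fun b a t _ _ => by simp
  add_mem' := fun hf hf' b a t ha ht => by
    rw [add_mul]
    exact add_mem (hf b a t ha ht) (hf' b a t ha ht)
  smul_mem' := fun c f hf b a t ha ht => by
    rw [smul_mul_assoc, Algebra.smul_def]
    exact mul_mem (algebraMap_mem_range_ofStalk π b c) (hf b a t ha ht)

instance [IsIntegral B] (g : P.grading 1) : SetLike.GradedMonoid (sections π g) where
  one_mem := fun b a t _ _ => by simp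
  mul_mem := by
    intro i j f f' hf hf' b a t ha ht
    have h := mul_mem (hf b a t ha ht) (hf' b a t ha ht)
    convert h using 1
    rw [mul_mul_mul_comm, ← Units.val_mul]
    congr 2
    rw [mul_mul_mul_comm, ← zpow_add, ← zpow_add, Prod.fst_add, Prod.snd_add, neg_add]

/-- The bigraded section ring `R_P = ⨁_{m,d ∈ ℤ} H⁰(B, 𝒪(mH - dE))`. -/
def SectionRing [IsIntegral B] (g : P.grading 1) : Type := ⨁ md : ℤ × ℤ, sections π g md

instance [IsIntegral B] (g : P.grading 1) : CommRing (SectionRing π g) :=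
  inferInstanceAs (CommRing (⨁ md : ℤ × ℤ, sections π g md))

instance [IsIntegral B] (g : P.grading 1) : Algebra ℂ (SectionRing π g) :=
  inferInstanceAs (Algebra ℂ (⨁ md : ℤ × ℤ, sections π g md))

/-- The inclusion of the graded piece `H⁰(B, 𝒪(mH - dE))` into `R_P`. -/
def SectionRing.of [IsIntegral B] (g : P.grading 1) (md : ℤ × ℤ) :
    sections π g md →ₗ[ℂ] SectionRing π g :=
  DirectSum.lof ℂ (ℤ × ℤ) (fun md => sections π g md) md

lemma one_mem_sections [IsIntegral B] (g : P.grading 1) :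
    (1 : RatFun π) ∈ sections π g (0, -1) := by
  rintro b a t - ⟨τ, hτ, -⟩
  exact ⟨τ, by simp [hτ]⟩

/-- The canonical section `s` of `𝒪(E)`: the rational function `1`, in bidegree `(0, -1)`. -/
def canonicalSection [IsIntegral B] (g : P.grading 1) : SectionRing π g :=
  SectionRing.of π g (0, -1) ⟨1, one_mem_sections π g⟩

end LatticePolytope
end

noncomputable section

/-! ### Exponential sums -/

section PowerSeriesOrder

variable {R : Type*} [CommRing R]

/-! Substitute x_i = exp(s t_i) and z = 1. An element f = Σ c_u x^u z^m of (A_P)_m becomes Σ c_u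
exp(s⟨u,t⟩), a power series in s whose coefficient of s^k is a form of degree k in t. Both algebras
are described through this series.

Harmonic side. If p is homogeneous of degree j, then p(∂) lowers the s-degree by j and multiplies
c_u by p(u) (`diffOp_coeff_expHom`). So if the series is divisible by s^d, its coefficient of s^d is
killed by the top form of every polynomial vanishing on the frequencies. Duality between polynomials
of degree at most d and functions on the finite set of lattice points gives the converse
(`exists_coeff_expHom_eq`). Hence (H_P)_{m,d} consists of the s^d-coefficients of those f in (A_P)_m
whose series is divisible by s^d (`mem_harmonicPiece_iff`). Such coefficients multiply, so H_P is
closed under multiplication.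

Geometric side. To a section φ of O(mH - dE) attach its numerator f = φ g^m. For m ≥ 0 the
numerators are exactly the f in (A_P)_m whose series is divisible by s^d, and for m < 0 only 0
occurs. Three arguments give this. (1) Hartogs: off E the blowup is X_P minus the closure of e, and
each binomial x^v z - x^w z vanishes at e, so a power of it times f lies in A_P. Two binomials with
independent exponents, available since dim P ≥ 2, are coprime, so f is a Laurent polynomial;
bounding its exponents by supporting functionals of P puts it in (A_P)_m (`exists_toField_eq`). (2)
The exponential defines an arc Spec K⟦s⟧ → X_P through e, which lifts to the blowup by the universal
property; a local equation of E pulls back to a multiple of s, so sections of O(mH - dE) have series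
divisible by s^d (`X_pow_dvd_expHom_of_mem_sections`). (3) Conversely, divisibility by s^d means
membership in the d-th power of the ideal of the identity (`mem_augIdeal_pow_iff`), which pulls back
into the d-th power of the ideal of E (`mem_sections_of_toLaurentField_eq`).

Conclusion. Sending a section to the s^d-coefficient of its numerator is a surjective ring map R_P →
H_P. A section of bidegree (m,d) is killed exactly when it is also a section of bidegree (m,d+1).
Since s is the rational function 1 in bidegree (0,-1), this says that the section is a multiple of
s, so the kernel is (s). -/

lemma PowerSeries.coeff_add_mul_of_X_pow_dvd {a b : PowerSeries R} {d e : ℕ}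
    (ha : PowerSeries.X ^ d ∣ a) (hb : PowerSeries.X ^ e ∣ b) :
    PowerSeries.coeff (d + e) (a * b) = PowerSeries.coeff d a * PowerSeries.coeff e b := by
  obtain ⟨a, rfl⟩ := ha
  obtain ⟨b, rfl⟩ := hb
  have h : PowerSeries.X ^ d * a * (PowerSeries.X ^ e * b) =
      PowerSeries.X ^ (d + e) * (a * b) := by ring
  rw [h]
  simp [PowerSeries.coeff_X_pow_mul']

lemma PowerSeries.X_pow_succ_dvd_iff {a : PowerSeries R} {d : ℕ} :
    PowerSeries.X ^ (d + 1) ∣ a ↔ PowerSeries.X ^ d ∣ a ∧ PowerSeries.coeff d a = 0 := by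
  simp only [PowerSeries.X_pow_dvd_iff, Nat.lt_succ_iff]
  constructor
  · exact fun h => ⟨fun m hm => h m hm.le, h d le_rfl⟩
  · rintro ⟨h, h'⟩ m hm
    rcases hm.lt_or_eq with hm | rfl
    exacts [h m hm, h']

end PowerSeriesOrder

namespace ExpSum

variable {n : ℕ}

/-- The Laurent polynomial ring `ℂ[x₁^±, …, xₙ^±]` as the group algebra of `ℤⁿ`. -/
abbrev TorusRing (n : ℕ) : Type := AddMonoidAlgebra ℂ (Fin n → ℤ)

/-- The linear form `⟨u, t⟩ = u₁ t₁ + ⋯ + uₙ tₙ`. -/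
def linForm : (Fin n → ℤ) →+ MvPolynomial (Fin n) ℂ where
  toFun u := ∑ i, MvPolynomial.C (u i : ℂ) * MvPolynomial.X i
  map_zero' := by simp
  map_add' u v := by simp [add_mul, Finset.sum_add_distrib]

lemma linForm_apply (u : Fin n → ℤ) :
    linForm u = ∑ i, MvPolynomial.C (u i : ℂ) * MvPolynomial.X i := rfl

lemma linForm_isHomogeneous (u : Fin n → ℤ) : (linForm u).IsHomogeneous 1 := by
  refine MvPolynomial.IsHomogeneous.sum _ _ _ fun i _ => ?_
  simpa using (MvPolynomial.isHomogeneous_C (Fin n) (u i : ℂ)).mul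
    (MvPolynomial.isHomogeneous_X ℂ i)

lemma linForm_injective : Function.Injective (linForm (n := n)) := by
  intro u v h
  funext i
  have := congrArg (MvPolynomial.coeff (Finsupp.single i 1)) h
  simp only [linForm_apply, MvPolynomial.coeff_sum, MvPolynomial.coeff_C_mul,
    MvPolynomial.coeff_X, Finsupp.single_left_inj one_ne_zero] at this
  simpa using this

/-- The substitution `x = exp(s t)`: the ring homomorphism `x^u ↦ exp(s ⟨u, t⟩)`. -/
def expHom : TorusRing n →ₐ[ℂ] PowerSeries (MvPolynomial (Fin n) ℂ) :=
  AddMonoidAlgebra.lift ℂ _ _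
    { toFun u := PowerSeries.rescale (linForm u.toAdd) (PowerSeries.exp _)
      map_one' := by
        ext k
        cases k <;> simp
      map_mul' u v := by
        rw [toAdd_mul, map_add, PowerSeries.exp_mul_exp_eq_exp_add] }

lemma expHom_single (u : Fin n → ℤ) (c : ℂ) :
    expHom (AddMonoidAlgebra.single u c) =
      c • PowerSeries.rescale (linForm u) (PowerSeries.exp _) := by
  rw [expHom, AddMonoidAlgebra.lift_single]
  rfl

lemma coeff_expHom_single (k : ℕ) (u : Fin n → ℤ) (c : ℂ) :
    PowerSeries.coeff k (expHom (AddMonoidAlgebra.single u c)) =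
      MvPolynomial.C (c / (k.factorial : ℂ)) * linForm u ^ k := by
  rw [expHom_single, PowerSeries.coeff_smul, PowerSeries.coeff_rescale, PowerSeries.coeff_exp,
    mul_comm (linForm u ^ k), MvPolynomial.smul_eq_C_mul, ← mul_assoc]
  congr 1
  rw [IsScalarTower.algebraMap_apply ℚ ℂ (MvPolynomial (Fin n) ℂ), MvPolynomial.algebraMap_eq,
    ← map_mul]
  simp [div_eq_mul_inv]

lemma coeff_expHom_isHomogeneous (k : ℕ) (f : TorusRing n) :
    (PowerSeries.coeff k (expHom f)).IsHomogeneous k := by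
  induction f using AddMonoidAlgebra.induction_linear with
  | zero => simpa using MvPolynomial.isHomogeneous_zero _ _ _
  | add f g hf hg => simpa using hf.add hg
  | single u c =>
    rw [coeff_expHom_single]
    simpa using (MvPolynomial.isHomogeneous_C (Fin n) _).mul ((linForm_isHomogeneous u).pow k)

/-- Evaluation at the identity `(1, …, 1)` of the torus. -/
def augmentation : TorusRing n →ₐ[ℂ] ℂ := AddMonoidAlgebra.lift ℂ _ _ 1

lemma augmentation_single (u : Fin n → ℤ) (c : ℂ) :
    augmentation (AddMonoidAlgebra.single u c) = c := by
  simp [augmentation]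

lemma coeff_zero_expHom (f : TorusRing n) :
    PowerSeries.coeff 0 (expHom f) = MvPolynomial.C (augmentation f) := by
  induction f using AddMonoidAlgebra.induction_linear with
  | zero => simp
  | add f g hf hg => rw [map_add, map_add, hf, hg, map_add, map_add]
  | single u c => rw [coeff_expHom_single]; simp [augmentation_single]

/-- The ideal of the identity of the torus. -/
def augIdeal (n : ℕ) : Ideal (TorusRing n) := RingHom.ker (augmentation (n := n))

lemma mem_augIdeal {f : TorusRing n} : f ∈ augIdeal n ↔ augmentation f = 0 := Iff.rfl

/-- Substitution of `xᵢ - 1` for the `i`-th variable. -/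
def shiftHom : MvPolynomial (Fin n) ℂ →ₐ[ℂ] TorusRing n :=
  MvPolynomial.aeval fun i => AddMonoidAlgebra.single (Pi.single i 1) 1 - 1

lemma single_sub_one_mem (u : Fin n → ℤ) :
    (AddMonoidAlgebra.single u 1 - 1 : TorusRing n) ∈ augIdeal n := by
  simp [mem_augIdeal, augmentation_single]

lemma shiftHom_mem (p : MvPolynomial (Fin n) ℂ) (d : ℕ) (hp : p.IsHomogeneous d) :
    shiftHom p ∈ augIdeal n ^ d := by
  rw [p.as_sum, map_sum]
  refine sum_mem fun a ha => ?_
  have hd : a.degree = d := by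
    rw [Finsupp.degree_eq_weight_one]
    exact hp (MvPolynomial.mem_support_iff.mp ha)
  rw [shiftHom, MvPolynomial.aeval_monomial, ← hd, Finsupp.degree_apply, ← Finset.prod_pow_eq_pow_sum]
  exact Ideal.mul_mem_left _ _ (Ideal.prod_mem_prod fun i _ =>
    Ideal.pow_mem_pow (single_sub_one_mem _) _)

/-- `u ↦ x^u - 1` modulo the square of the ideal of the identity. -/
def logClass : (Fin n → ℤ) →+ TorusRing n ⧸ augIdeal n ^ 2 where
  toFun u := Ideal.Quotient.mk _ (AddMonoidAlgebra.single u 1 - 1)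
  map_zero' := by simp [← AddMonoidAlgebra.one_def]
  map_add' u v := by
    rw [← map_add, Ideal.Quotient.eq]
    have h : (AddMonoidAlgebra.single (u + v) 1 : TorusRing n) =
        AddMonoidAlgebra.single u 1 * AddMonoidAlgebra.single v 1 := by
      simp [AddMonoidAlgebra.single_mul_single]
    rw [h]
    convert pow_two (augIdeal n) ▸
      Ideal.mul_mem_mul (single_sub_one_mem u) (single_sub_one_mem v) using 1
    ring

/-- Since xy - 1 = (x - 1) + (y - 1) + (x - 1)(y - 1), the class of x^u - 1 modulo the square of the
augmentation ideal is additive in u, so it is determined by the basis vectors. -/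
lemma shiftHom_linForm (u : Fin n → ℤ) :
    (AddMonoidAlgebra.single u 1 - 1 : TorusRing n) - shiftHom (linForm u) ∈ augIdeal n ^ 2 := by
  rw [← Ideal.Quotient.eq]
  change logClass u = _
  have hu : u = ∑ i, u i • (Pi.single i 1 : Fin n → ℤ) := by
    simpa using (pi_eq_sum_univ' u)
  conv_lhs => rw [hu]
  rw [map_sum, linForm_apply, map_sum, map_sum]
  refine Finset.sum_congr rfl fun i _ => ?_
  rw [map_zsmul, map_mul, shiftHom, MvPolynomial.aeval_X, MvPolynomial.aeval_C, map_intCast,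
    ← zsmul_eq_mul, map_zsmul]
  rfl

lemma sub_shiftHom_mem (f : TorusRing n) :
    f - algebraMap ℂ _ (augmentation f) - shiftHom (PowerSeries.coeff 1 (expHom f)) ∈
      augIdeal n ^ 2 := by
  induction f using AddMonoidAlgebra.induction_linear with
  | zero => simp
  | add f g hf hg =>
    convert add_mem hf hg using 1
    simp only [map_add]
    ring
  | single u c =>
    convert Ideal.mul_mem_left _ (algebraMap ℂ _ c) (shiftHom_linForm u) using 1
    rw [coeff_expHom_single, augmentation_single, map_mul, pow_one, mul_sub, mul_sub, mul_one,
      ← Algebra.smul_def, AddMonoidAlgebra.smul_single]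
    simp [shiftHom]

/-- To leading order log x_i and x_i - 1 agree, so substituting x_i - 1 into the lowest form of the
series recovers f modulo the next power. This lets a vanishing lowest form force membership one
power higher. -/
lemma exists_shiftHom_of_mem_pow (d : ℕ) {f : TorusRing n} (hf : f ∈ augIdeal n ^ d) :
    PowerSeries.X ^ d ∣ expHom f ∧
      f - shiftHom (PowerSeries.coeff d (expHom f)) ∈ augIdeal n ^ (d + 1) := by
  induction d generalizing f with
  | zero =>
    refine ⟨by simp, ?_⟩
    rw [coeff_zero_expHom, zero_add, pow_one, mem_augIdeal, shiftHom, MvPolynomial.aeval_C, map_sub,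
      AlgHom.commutes]
    simp
  | succ d ih =>
    rw [pow_succ] at hf
    refine Submodule.mul_induction_on hf ?_ ?_
    swap
    · intro x y hx hy
      refine ⟨by rw [map_add]; exact dvd_add hx.1 hy.1, ?_⟩
      convert add_mem hx.2 hy.2 using 1
      simp only [map_add]
      ring
    · intro a ha b hb
      obtain ⟨ha1, ha2⟩ := ih ha
      have hb1 : PowerSeries.X ^ 1 ∣ expHom b := by
        rw [PowerSeries.X_pow_dvd_iff]
        intro m hm
        obtain rfl : m = 0 := by omega
        rw [coeff_zero_expHom, mem_augIdeal.mp hb, map_zero]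
      have hb2 := sub_shiftHom_mem b
      rw [mem_augIdeal.mp hb, map_zero, sub_zero] at hb2
      refine ⟨?_, ?_⟩
      · rw [map_mul, pow_add]
        exact mul_dvd_mul ha1 hb1
      · rw [map_mul, PowerSeries.coeff_add_mul_of_X_pow_dvd ha1 hb1, map_mul]
        have h1 := Ideal.mul_mem_mul ha2 hb
        have h2 := Ideal.mul_mem_mul
          (shiftHom_mem _ d (coeff_expHom_isHomogeneous d a)) hb2
        rw [← pow_succ] at h1
        rw [← pow_add] at h2
        -- With σ the substitution of x_i - 1 into the leading form: ab - σ(a)σ(b) = (a - σ(a))b +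
        -- σ(a)(b - σ(b)).
        convert add_mem h1 h2 using 1
        ring

/-- A Laurent polynomial vanishing to order `d` at the identity, in logarithmic coordinates, lies in
the `d`-th power of the ideal of the identity. -/
theorem mem_augIdeal_pow_iff (d : ℕ) {f : TorusRing n} :
    f ∈ augIdeal n ^ d ↔ PowerSeries.X ^ d ∣ expHom f := by
  refine ⟨fun h => (exists_shiftHom_of_mem_pow d h).1, fun h => ?_⟩
  induction d with
  | zero => simp
  | succ d ih =>
    rw [PowerSeries.X_pow_succ_dvd_iff] at h
    have := (exists_shiftHom_of_mem_pow d (ih h.1)).2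
    rwa [h.2, map_zero, sub_zero] at this

end ExpSum
end

noncomputable section

/-! ### Constant coefficient differential operators -/

namespace DiffOp

variable {n : ℕ}

lemma pderiv_comm (i j : Fin n) (p : MvPolynomial (Fin n) ℂ) :
    MvPolynomial.pderiv i (MvPolynomial.pderiv j p) =
      MvPolynomial.pderiv j (MvPolynomial.pderiv i p) := by
  ext m
  rcases eq_or_ne i j with rfl | h
  · rfl
  · simp only [MvPolynomial.coeff_pderiv, Finsupp.add_apply, Finsupp.single_eq_of_ne h,
      Finsupp.single_eq_of_ne h.symm, add_zero]
    rw [add_right_comm]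
    ring

/-- The partial derivatives as linear endomorphisms. -/
abbrev partials (i : Fin n) : Module.End ℂ (MvPolynomial (Fin n) ℂ) :=
  (MvPolynomial.pderiv i).toLinearMap

/-- The commutative algebra generated by the partial derivatives. -/
abbrev partialsAlgebra (n : ℕ) : Subalgebra ℂ (Module.End ℂ (MvPolynomial (Fin n) ℂ)) :=
  Algebra.adjoin ℂ (Set.range partials)

lemma isMulCommutative_partialsAlgebra : IsMulCommutative (partialsAlgebra n) :=
  Algebra.isMulCommutative_adjoin ℂ (by
    rintro _ ⟨i, rfl⟩ _ ⟨j, rfl⟩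
    exact LinearMap.ext fun p => pderiv_comm i j p)

instance : CommRing (partialsAlgebra n) :=
  { (inferInstance : Ring (partialsAlgebra n)) with
    mul_comm := isMulCommutative_partialsAlgebra.is_comm.comm }

/-- `f ↦ f(∂/∂x₁, …, ∂/∂xₙ)` as an algebra homomorphism. -/
def diffHom (n : ℕ) : MvPolynomial (Fin n) ℂ →ₐ[ℂ] partialsAlgebra n :=
  MvPolynomial.aeval fun i => ⟨partials i, Algebra.subset_adjoin ⟨i, rfl⟩⟩

/-- Partial derivatives commute, so f ↦ f(∂) is evaluation in a commutative algebra; additivity and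
multiplicativity of `diffOp` follow from this. -/
lemma diffOp_eq (f : MvPolynomial (Fin n) ℂ) : diffOp f = (diffHom n f).1 := by
  rw [diffHom, MvPolynomial.aeval_def, MvPolynomial.eval₂_eq', ← Subalgebra.coe_val, map_sum,
    diffOp]
  refine Finset.sum_congr rfl fun a _ => ?_
  rw [← Algebra.smul_def, map_smul]
  congr 1
  rw [← List.prod_ofFn, map_list_prod, List.map_ofFn]
  rfl

lemma diffOp_mul (f g : MvPolynomial (Fin n) ℂ) : diffOp (f * g) = diffOp f * diffOp g := by
  simp [diffOp_eq]

lemma diffOp_add (f g : MvPolynomial (Fin n) ℂ) : diffOp (f + g) = diffOp f + diffOp g := by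
  simp [diffOp_eq]

lemma diffOp_smul (c : ℂ) (f : MvPolynomial (Fin n) ℂ) : diffOp (c • f) = c • diffOp f := by
  simp [diffOp_eq]

lemma diffOp_zero : diffOp (0 : MvPolynomial (Fin n) ℂ) = 0 := by
  simp [diffOp_eq]

lemma diffOp_one : diffOp (1 : MvPolynomial (Fin n) ℂ) = 1 := by
  simp [diffOp_eq]

lemma diffOp_X (i : Fin n) : diffOp (MvPolynomial.X i) = partials i := by
  simp [diffOp_eq, diffHom]

/-- The polynomials `f` with `f(∂) h = 0`. -/
def annihilator (h : MvPolynomial (Fin n) ℂ) : Ideal (MvPolynomial (Fin n) ℂ) where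
  carrier := {f | diffOp f h = 0}
  zero_mem' := by simp [diffOp_zero]
  add_mem' {f g} hf hg := by
    simp only [Set.mem_ofPred_eq] at hf hg ⊢
    simp [diffOp_add, hf, hg]
  smul_mem' c f hf := by
    simp only [Set.mem_ofPred_eq] at hf ⊢
    simp [diffOp_mul, hf]

/-- The operators killing h form an ideal, so testing the generators of gr I(Z) suffices. -/
lemma mem_harmonicSpace {Z : Set (Fin n → ℂ)} {h : MvPolynomial (Fin n) ℂ} :
    h ∈ harmonicSpace Z ↔ ∀ f ∈ MvPolynomial.vanishingIdeal ℂ Z,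
      diffOp (MvPolynomial.homogeneousComponent f.totalDegree f) h = 0 := by
  have : h ∈ harmonicSpace Z ↔ grVanishingIdeal Z ≤ annihilator h := by
    simp only [harmonicSpace, Submodule.mem_iInf, LinearMap.mem_ker]
    rfl
  rw [this, grVanishingIdeal, Ideal.span_le]
  constructor
  · exact fun H f hf => H ⟨f, hf, rfl⟩
  · rintro H _ ⟨f, hf, rfl⟩
    exact H f hf

lemma isHomogeneous_iff {k : ℕ} {h : MvPolynomial (Fin n) ℂ} :
    h.IsHomogeneous k ↔ ∀ a, h.coeff a ≠ 0 → a.degree = k := by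
  rw [Finsupp.degree_eq_weight_one]
  exact ⟨fun H a ha => H ha, fun H a ha => H a ha⟩

lemma pderiv_isHomogeneous {k : ℕ} {h : MvPolynomial (Fin n) ℂ} (hh : h.IsHomogeneous (k + 1))
    (i : Fin n) : (MvPolynomial.pderiv i h).IsHomogeneous k := by
  rw [isHomogeneous_iff] at hh ⊢
  intro m hm
  rw [MvPolynomial.coeff_pderiv] at hm
  have := hh _ (left_ne_zero_of_mul hm)
  simp only [map_add, Finsupp.degree_single] at this
  omega

lemma exists_eq_add_single {a : Fin n →₀ ℕ} (ha : a ≠ 0) :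
    ∃ b i, a = b + Finsupp.single i 1 := by
  obtain ⟨i, hi⟩ : ∃ i, a i ≠ 0 := by
    by_contra! h0
    exact ha (Finsupp.ext h0)
  refine ⟨a - Finsupp.single i 1, i, ?_⟩
  ext j
  rcases eq_or_ne i j with rfl | hij
  · simp; omega
  · simp [Finsupp.single_eq_of_ne hij.symm]

/-- Induction principle for homogeneous polynomials. -/
lemma homogeneous_induction {M : ℕ → MvPolynomial (Fin n) ℂ → Prop}
    (C : ∀ c, M 0 (MvPolynomial.C c)) (zero : ∀ j, M j 0)
    (mul_X : ∀ j f i, M j f → M (j + 1) (f * MvPolynomial.X i))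
    (add : ∀ j f g, M j f → M j g → M j (f + g))
    {j : ℕ} {f : MvPolynomial (Fin n) ℂ} (hf : f.IsHomogeneous j) : M j f := by
  have hmon : ∀ (j : ℕ) (a : Fin n →₀ ℕ) (c : ℂ), a.degree = j →
      M j (MvPolynomial.monomial a c) := by
    intro j
    induction j with
    | zero =>
      intro a c ha
      obtain rfl : a = 0 := by simpa [Finsupp.degree_eq_zero_iff] using ha
      exact C c
    | succ j ih =>
      intro a c ha
      obtain ⟨b, i, rfl⟩ := exists_eq_add_single (a := a) (by rintro rfl; simp at ha)
      rw [map_add, Finsupp.degree_single] at ha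
      have := mul_X j _ i (ih b c (by omega))
      rwa [MvPolynomial.X, MvPolynomial.monomial_mul, mul_one] at this
  rw [f.as_sum]
  exact Finset.sum_induction _ (M j) (add j) (zero j) fun a ha =>
    hmon j a _ (isHomogeneous_iff.mp hf a (MvPolynomial.mem_support_iff.mp ha))

lemma diffOp_C (c : ℂ) : diffOp (MvPolynomial.C c : MvPolynomial (Fin n) ℂ) = c • 1 := by
  rw [MvPolynomial.C_eq_smul_one, diffOp_smul, diffOp_one]

lemma diffOp_mul_X (f h : MvPolynomial (Fin n) ℂ) (i : Fin n) :
    diffOp (f * MvPolynomial.X i) h = diffOp f (MvPolynomial.pderiv i h) := by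
  rw [diffOp_mul, diffOp_X]
  rfl

lemma diffOp_isHomogeneous {j : ℕ} {f : MvPolynomial (Fin n) ℂ} (hf : f.IsHomogeneous j) :
    ∀ (k : ℕ) {h : MvPolynomial (Fin n) ℂ}, h.IsHomogeneous (k + j) →
      (diffOp f h).IsHomogeneous k := by
  refine homogeneous_induction (M := fun j f => ∀ (k : ℕ) {h : MvPolynomial (Fin n) ℂ},
    h.IsHomogeneous (k + j) → (diffOp f h).IsHomogeneous k) ?_ ?_ ?_ ?_ hf
  · intro c k h hh
    rw [diffOp_C, LinearMap.smul_apply, MvPolynomial.smul_eq_C_mul]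
    simpa using (MvPolynomial.isHomogeneous_C (Fin n) c).mul hh
  · intro j k h _
    simpa [diffOp_zero] using MvPolynomial.isHomogeneous_zero _ _ _
  · intro j f i ih k h hh
    rw [diffOp_mul_X]
    exact ih k (pderiv_isHomogeneous hh i)
  · intro j f g hf hg k h hh
    rw [diffOp_add]
    exact (hf k hh).add (hg k hh)

lemma diffOp_eq_zero_of_lt {j : ℕ} {f : MvPolynomial (Fin n) ℂ} (hf : f.IsHomogeneous j) :
    ∀ {k : ℕ} {h : MvPolynomial (Fin n) ℂ}, k < j → h.IsHomogeneous k → diffOp f h = 0 := by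
  refine homogeneous_induction (M := fun j f => ∀ {k : ℕ} {h : MvPolynomial (Fin n) ℂ},
    k < j → h.IsHomogeneous k → diffOp f h = 0) ?_ ?_ ?_ ?_ hf
  · intro c k h hk
    omega
  · intro j k h _ _
    simp [diffOp_zero]
  · intro j f i ih k h hk hh
    rw [diffOp_mul_X]
    rcases k with _ | k
    · rw [MvPolynomial.totalDegree_eq_zero_iff_eq_C.mp (Nat.le_zero.mp hh.totalDegree_le),
        MvPolynomial.pderiv_C, map_zero]
    · exact ih (by omega) (pderiv_isHomogeneous hh i)
  · intro j f g hf hg k h hk hh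
    rw [diffOp_add, LinearMap.add_apply, hf hk hh, hg hk hh, add_zero]

/-- Apolarity is nondegenerate. -/
lemma eq_zero_of_diffOp_eq_zero : ∀ {k : ℕ} {h : MvPolynomial (Fin n) ℂ}, h.IsHomogeneous k →
    (∀ f : MvPolynomial (Fin n) ℂ, f.IsHomogeneous k → diffOp f h = 0) → h = 0 := by
  intro k
  induction k with
  | zero =>
    intro h _ H
    simpa [diffOp_one] using H 1 (MvPolynomial.isHomogeneous_one _ _)
  | succ k ih =>
    intro h hh H
    -- All partial derivatives vanish by induction. In characteristic zero this kills every
    -- coefficient of positive degree, as seen on any variable dividing the monomial.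
    have hp : ∀ i, MvPolynomial.pderiv i h = 0 := fun i =>
      ih (pderiv_isHomogeneous hh i) fun f hf => by
        have := H (f * MvPolynomial.X i) (hf.mul (MvPolynomial.isHomogeneous_X ℂ i))
        rwa [diffOp_mul, diffOp_X] at this
    ext a
    by_contra ha
    have hd : a.degree = k + 1 := isHomogeneous_iff.mp hh a ha
    obtain ⟨b, i, rfl⟩ := exists_eq_add_single (a := a) (by rintro rfl; simp at hd)
    have h1 := MvPolynomial.coeff_pderiv (i := i) h b
    rw [hp, MvPolynomial.coeff_zero, eq_comm, mul_eq_zero] at h1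
    exact h1.elim ha fun h3 => Nat.cast_add_one_ne_zero _ h3

end DiffOp
end

noncomputable section

/-! ### Harmonic spaces and exponential sums -/

namespace ExpSum

open DiffOp

variable {n : ℕ}

/-- A lattice point as a complex point. -/
abbrev toComplex (u : Fin n → ℤ) (i : Fin n) : ℂ := (u i : ℂ)

/-- Multiplication of the coefficient of `x^u` by the value of a polynomial at `u`. -/
def twist (f : MvPolynomial (Fin n) ℂ) (G : TorusRing n) : TorusRing n :=
  .ofCoeff ((fun u => MvPolynomial.eval (toComplex u) f) • G.coeff)

lemma coeff_twist (f : MvPolynomial (Fin n) ℂ) (G : TorusRing n) (u : Fin n → ℤ) :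
    (twist f G).coeff u = MvPolynomial.eval (toComplex u) f * G.coeff u := rfl

lemma twist_single (f : MvPolynomial (Fin n) ℂ) (u : Fin n → ℤ) (c : ℂ) :
    twist f (.single u c) = .single u (MvPolynomial.eval (toComplex u) f * c) := by
  ext v
  rw [coeff_twist]
  rcases eq_or_ne u v with rfl | h
  · simp
  · simp [h]

lemma twist_zero (f : MvPolynomial (Fin n) ℂ) : twist f 0 = 0 := by
  ext v
  simp [coeff_twist]

lemma twist_add (f : MvPolynomial (Fin n) ℂ) (G H : TorusRing n) :
    twist f (G + H) = twist f G + twist f H := by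
  ext v
  simp [coeff_twist, mul_add]

lemma sum_twist {ι : Type*} (s : Finset ι) (f : ι → MvPolynomial (Fin n) ℂ) (G : TorusRing n) :
    twist (∑ i ∈ s, f i) G = ∑ i ∈ s, twist (f i) G := by
  ext v
  simp [coeff_twist, AddMonoidAlgebra.coeff_sum, Finset.sum_mul]

lemma pderiv_linForm (i : Fin n) (u : Fin n → ℤ) :
    MvPolynomial.pderiv i (linForm u) = MvPolynomial.C (u i : ℂ) := by
  rw [linForm_apply, map_sum, Finset.sum_eq_single i]
  · simp
  · intro j _ hj
    simp [MvPolynomial.pderiv_X_of_ne hj]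
  · simp

/-- ∂_i exp(s⟨u,t⟩) = s u_i exp(s⟨u,t⟩): differentiation costs one power of s and multiplies each
coefficient by the i-th coordinate of its frequency. -/
lemma pderiv_coeff_expHom (i : Fin n) (l : ℕ) (G : TorusRing n) :
    MvPolynomial.pderiv i (PowerSeries.coeff (l + 1) (expHom G)) =
      PowerSeries.coeff l (expHom (twist (MvPolynomial.X i) G)) := by
  induction G using AddMonoidAlgebra.induction_linear with
  | zero => simp [twist_zero]
  | add G H hG hH => simp only [map_add, hG, hH, twist_add]
  | single u c =>
    rw [twist_single, coeff_expHom_single, coeff_expHom_single, MvPolynomial.pderiv_C_mul,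
      MvPolynomial.pderiv_pow, pderiv_linForm, MvPolynomial.eval_X, Nat.add_sub_cancel,
      show ((l + 1 : ℕ) : MvPolynomial (Fin n) ℂ) = MvPolynomial.C ((l + 1 : ℕ) : ℂ) by simp,
      mul_right_comm, ← map_mul, ← mul_assoc, ← map_mul, Nat.factorial_succ]
    congr 2
    have h1 : ((l : ℂ) + 1) ≠ 0 := Nat.cast_add_one_ne_zero l
    have h2 : (l.factorial : ℂ) ≠ 0 := by exact_mod_cast l.factorial_ne_zero
    push_cast
    field_simp

lemma diffOp_coeff_expHom {j : ℕ} {f : MvPolynomial (Fin n) ℂ} (hf : f.IsHomogeneous j) :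
    ∀ (l : ℕ) (G : TorusRing n), diffOp f (PowerSeries.coeff (l + j) (expHom G)) =
      PowerSeries.coeff l (expHom (twist f G)) := by
  refine homogeneous_induction (M := fun j f => ∀ (l : ℕ) (G : TorusRing n),
    diffOp f (PowerSeries.coeff (l + j) (expHom G)) =
      PowerSeries.coeff l (expHom (twist f G))) ?_ ?_ ?_ ?_ hf
  · intro c l G
    have : twist (MvPolynomial.C c) G = c • G := by
      ext v
      simp [coeff_twist]
    rw [this, diffOp_C, map_smul, PowerSeries.coeff_smul]
    rfl
  · intro j l G
    have : twist 0 G = 0 := by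
      ext v
      simp [coeff_twist]
    simp [this, diffOp_zero]
  · intro j f i ih l G
    have : twist (f * MvPolynomial.X i) G = twist f (twist (MvPolynomial.X i) G) := by
      ext v
      simp only [coeff_twist, map_mul, mul_assoc]
    rw [diffOp_mul_X, ← add_assoc, pderiv_coeff_expHom, ih, this]
  · intro j f g hf hg l G
    have : twist (f + g) G = twist f G + twist g G := by
      ext v
      simp [coeff_twist, add_mul]
    rw [diffOp_add, LinearMap.add_apply, hf, hg, this, map_add, map_add]

/-- The lowest degree form of an exponential sum with frequencies in `Z` is harmonic for `Z`. -/
lemma coeff_expHom_mem_harmonicSpace {Z : Set (Fin n → ℤ)} {G : TorusRing n}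
    (hG : (G.coeff.support : Set (Fin n → ℤ)) ⊆ Z) {d : ℕ} (hd : PowerSeries.X ^ d ∣ expHom G) :
    PowerSeries.coeff d (expHom G) ∈ harmonicSpace (toComplex '' Z) := by
  rw [mem_harmonicSpace]
  intro f hf
  rw [MvPolynomial.mem_vanishingIdeal_iff] at hf
  set k := f.totalDegree with hk
  rcases lt_or_ge d k with hdk | hkd
  · exact diffOp_eq_zero_of_lt (MvPolynomial.homogeneousComponent_isHomogeneous k f) hdk
      (coeff_expHom_isHomogeneous d G)
  obtain ⟨l, rfl⟩ := Nat.exists_eq_add_of_le' hkd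
  have h0 : twist f G = 0 := by
    ext u
    rw [coeff_twist]
    by_cases hu : G.coeff u = 0
    · simp [hu]
    · have := hf _ ⟨u, hG (by simpa using hu), rfl⟩
      rw [MvPolynomial.aeval_eq_eval] at this
      simp [this]
  -- Expand twist f G = 0 over the homogeneous components of f. The component of degree j
  -- contributes f_j(∂) applied to the coefficient of s^(l+j), which is zero for j < k because l + j
  -- < d. Only the top form survives.
  have h1 : ∑ j ∈ Finset.range (k + 1), PowerSeries.coeff l
      (expHom (twist (MvPolynomial.homogeneousComponent j f) G)) = 0 := by
    rw [← map_sum, ← map_sum, ← sum_twist, MvPolynomial.sum_homogeneousComponent, h0, map_zero,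
      map_zero]
  rw [Finset.sum_range_succ, Finset.sum_eq_zero, zero_add] at h1
  · rw [diffOp_coeff_expHom (MvPolynomial.homogeneousComponent_isHomogeneous k f), h1]
  · intro j hj
    rw [Finset.mem_range] at hj
    rw [← diffOp_coeff_expHom (MvPolynomial.homogeneousComponent_isHomogeneous j f),
      PowerSeries.X_pow_dvd_iff.mp hd _ (by omega), map_zero]

/-- Every homogeneous harmonic polynomial for `Z` is the lowest degree form of an exponential sum
with frequencies in `Z`. -/
lemma exists_coeff_expHom_eq {Z : Finset (Fin n → ℤ)} {d : ℕ} {h : MvPolynomial (Fin n) ℂ}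
    (hh : h.IsHomogeneous d) (hZ : h ∈ harmonicSpace (toComplex '' (Z : Set (Fin n → ℤ)))) :
    ∃ G : TorusRing n, (G.coeff.support : Set (Fin n → ℤ)) ⊆ Z ∧
      PowerSeries.X ^ d ∣ expHom G ∧ PowerSeries.coeff d (expHom G) = h := by
  classical
  let W := MvPolynomial.restrictTotalDegree (Fin n) ℂ d
  -- The functional f ↦ f_d(∂)h on polynomials of degree at most d. Harmonicity of h says that it
  -- kills the polynomials vanishing on Z, hence that it factors through evaluation on Z; the
  -- weights of that factorization will be the coefficients of the exponential sum.
  let lam : W →ₗ[ℂ] ℂ :=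
    { toFun f := MvPolynomial.constantCoeff
        (diffOp (MvPolynomial.homogeneousComponent d f.1) h)
      map_add' f g := by simp [diffOp_add]
      map_smul' c f := by simp [diffOp_smul] }
  let ev : W →ₗ[ℂ] (Z → ℂ) :=
    { toFun f u := MvPolynomial.eval (toComplex u.1) f.1
      map_add' f g := by ext; simp
      map_smul' c f := by ext; simp }
  have hlam : lam ∈ LinearMap.range ev.dualMap := by
    rw [LinearMap.range_dualMap_eq_dualAnnihilator_ker, Submodule.mem_dualAnnihilator]
    rintro ⟨f, hf⟩ hf0
    rw [MvPolynomial.mem_restrictTotalDegree] at hf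
    change MvPolynomial.constantCoeff _ = 0
    rcases hf.lt_or_eq with hlt | rfl
    · simp [MvPolynomial.homogeneousComponent_eq_zero _ _ hlt, diffOp_zero]
    · rw [mem_harmonicSpace] at hZ
      rw [hZ f, map_zero]
      rw [MvPolynomial.mem_vanishingIdeal_iff]
      rintro _ ⟨u, hu, rfl⟩
      exact congrFun (LinearMap.mem_ker.mp hf0) ⟨u, hu⟩
  obtain ⟨μ, hμ⟩ := hlam
  let G : TorusRing n := ∑ u : Z, .single u.1 (μ (Pi.single u 1))
  have hsupp : ∀ u, u ∉ Z → G.coeff u = 0 := by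
    intro u hu
    simp only [G, AddMonoidAlgebra.coeff_sum, Finsupp.finsetSum_apply,
      AddMonoidAlgebra.coeff_single]
    refine Finset.sum_eq_zero fun v _ => Finsupp.single_eq_of_ne ?_
    rintro rfl
    exact hu v.2
  have haug : ∀ f : W, augmentation (twist f.1 G) = lam f := by
    intro f
    have h1 : twist f.1 G = ∑ u : Z,
        .single u.1 (MvPolynomial.eval (toComplex u.1) f.1 * μ (Pi.single u 1)) := by
      have : ∀ s : Finset Z, twist f.1 (∑ u ∈ s, .single u.1 (μ (Pi.single u 1))) = ∑ u ∈ s,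
          .single u.1 (MvPolynomial.eval (toComplex u.1) f.1 * μ (Pi.single u 1)) := by
        intro s
        induction s using Finset.induction_on with
        | empty => simp [twist_zero]
        | insert u s hu ih => rw [Finset.sum_insert hu, Finset.sum_insert hu, twist_add, ih,
            twist_single]
      exact this _
    rw [h1, map_sum, ← hμ, LinearMap.dualMap_apply, pi_eq_sum_univ' (ev f), map_sum]
    refine Finset.sum_congr rfl fun u _ => ?_
    rw [augmentation_single, map_smul, smul_eq_mul]
    rfl
  have hconst : ∀ {k : ℕ} {f : MvPolynomial (Fin n) ℂ} (hf : f.IsHomogeneous k) (hk : k ≤ d),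
      diffOp f (PowerSeries.coeff k (expHom G)) =
        MvPolynomial.C (lam ⟨f, (MvPolynomial.mem_restrictTotalDegree _ _ _).mpr
          (hf.totalDegree_le.trans hk)⟩) := by
    intro k f hf hk
    have := diffOp_coeff_expHom hf 0 G
    rw [zero_add] at this
    rw [this, coeff_zero_expHom, ← haug]
  refine ⟨G, fun u hu => ?_, PowerSeries.X_pow_dvd_iff.mpr fun k hk => ?_, ?_⟩
  · by_contra hu'
    exact (Finsupp.mem_support_iff.mp hu) (hsupp u hu')
  -- Apolarity against forms of degree k < d: `lam` only sees the degree d component, so it vanishes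
  -- on them.
  · refine eq_zero_of_diffOp_eq_zero (coeff_expHom_isHomogeneous k G) fun f hf => ?_
    rw [hconst hf hk.le]
    simp [lam, MvPolynomial.homogeneousComponent_of_mem hf, hk.ne', diffOp_zero]
  · rw [← sub_eq_zero]
    refine eq_zero_of_diffOp_eq_zero ((coeff_expHom_isHomogeneous d G).sub hh) fun f hf => ?_
    have h2 := diffOp_isHomogeneous hf 0 (h := h) (by simpa using hh)
    rw [map_sub, hconst hf le_rfl, sub_eq_zero]
    simp only [lam, LinearMap.coe_mk, AddHom.coe_mk, MvPolynomial.homogeneousComponent_of_mem hf,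
      if_true]
    exact (MvPolynomial.totalDegree_eq_zero_iff_eq_C.mp
      (Nat.le_zero.mp h2.totalDegree_le)).symm

end ExpSum
end

noncomputable section

/-! ### Divisibility by binomials in group algebras -/

namespace GroupAlgebra

variable {M : Type*} [AddCommGroup M]

lemma coeff_single_mul' (u v : M) (f : AddMonoidAlgebra ℂ M) :
    (AddMonoidAlgebra.single u 1 * f).coeff v = f.coeff (v - u) := by
  rw [AddMonoidAlgebra.coeff_single_mul_apply, one_mul, neg_add_eq_sub]

/-- The support is finite, while a nonzero coefficient repeated along v, v + u, v + 2u, … would make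
it infinite. -/
lemma eq_zero_of_forall_coeff_add {f : AddMonoidAlgebra ℂ M} {u v : M}
    (hu : ∀ k : ℕ, k ≠ 0 → k • u ≠ 0)
    (h : ∀ k : ℕ, f.coeff (v + k • u) = f.coeff v) : f.coeff v = 0 := by
  by_contra hv
  have hinj : Function.Injective fun k : ℕ => v + k • u := by
    intro k l hkl
    have hkl' : k • u = l • u := add_left_cancel hkl
    by_contra hne
    rcases lt_or_gt_of_ne hne with h | h
    · refine hu (l - k) (by omega) ?_
      rw [sub_nsmul _ h.le, hkl', add_neg_cancel]
    · refine hu (k - l) (by omega) ?_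
      rw [sub_nsmul _ h.le, hkl', add_neg_cancel]
  refine Set.infinite_range_of_injective hinj (f.coeff.support.finite_toSet.subset ?_)
  rintro _ ⟨k, rfl⟩
  simpa [h k] using hv

lemma eq_zero_of_single_mul_eq {f : AddMonoidAlgebra ℂ M} {u : M}
    (hu : ∀ k : ℕ, k ≠ 0 → k • u ≠ 0) (h : AddMonoidAlgebra.single u 1 * f = f) : f = 0 := by
  ext v
  refine eq_zero_of_forall_coeff_add hu fun k => ?_
  induction k with
  | zero => simp
  | succ k ih =>
    rw [← ih]
    conv_lhs => rw [← h, coeff_single_mul']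
    congr 1
    rw [succ_nsmul]
    abel

lemma single_sub_one_dvd_zsmul (u : M) (k : ℤ) :
    (AddMonoidAlgebra.single u 1 - 1 : AddMonoidAlgebra ℂ M) ∣
      AddMonoidAlgebra.single (k • u) 1 - 1 := by
  have hnat : ∀ k : ℕ, (AddMonoidAlgebra.single u 1 - 1 : AddMonoidAlgebra ℂ M) ∣
      AddMonoidAlgebra.single (k • u) 1 - 1 := by
    intro k
    have := sub_one_dvd_pow_sub_one (AddMonoidAlgebra.single u 1 : AddMonoidAlgebra ℂ M) k
    simpa [AddMonoidAlgebra.single_pow] using this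
  obtain ⟨k, rfl | rfl⟩ := k.eq_nat_or_neg
  · simpa using hnat k
  · have : (AddMonoidAlgebra.single (-(k : ℤ) • u) 1 - 1 : AddMonoidAlgebra ℂ M) =
        -AddMonoidAlgebra.single (-(k : ℤ) • u) 1 * (AddMonoidAlgebra.single (k • u) 1 - 1) := by
      rw [mul_sub, neg_mul, AddMonoidAlgebra.single_mul_single]
      rw [neg_smul, natCast_zsmul, neg_add_cancel, mul_one, ← AddMonoidAlgebra.one_def]
      ring
    rw [this]
    exact Dvd.dvd.mul_left (hnat k) _

/-- The quotient map `ℂ[M] → ℂ[M / ⟨u⟩]`. -/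
abbrev modHom (u : M) :
    AddMonoidAlgebra ℂ M →ₐ[ℂ] AddMonoidAlgebra ℂ (M ⧸ AddSubgroup.zmultiples u) :=
  AddMonoidAlgebra.mapDomainAlgHom ℂ ℂ (QuotientAddGroup.mk' (AddSubgroup.zmultiples u))

/-- Choose a representative in each class of M / ⟨u⟩. Every monomial differs from the monomial of
its representative by a multiple of some x^(ku) - 1, hence of x^u - 1. -/
lemma dvd_of_modHom_eq_zero {u : M} {f : AddMonoidAlgebra ℂ M} (hf : modHom u f = 0) :
    (AddMonoidAlgebra.single u 1 - 1) ∣ f := by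
  let s : AddMonoidAlgebra ℂ (M ⧸ AddSubgroup.zmultiples u) → AddMonoidAlgebra ℂ M :=
    AddMonoidAlgebra.mapDomain Quotient.out
  have key : ∀ f : AddMonoidAlgebra ℂ M,
      (AddMonoidAlgebra.single u 1 - 1) ∣ f - s (modHom u f) := by
    intro f
    induction f using AddMonoidAlgebra.induction_linear with
    | zero => simp [s]
    | add f g hf hg =>
      have : s (modHom u (f + g)) = s (modHom u f) + s (modHom u g) := by
        simp [s, AddMonoidAlgebra.mapDomain_add]
      rw [this, add_sub_add_comm]
      exact dvd_add hf hg
    | single v c =>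
      obtain ⟨k, hk⟩ : v - Quotient.out (QuotientAddGroup.mk v : M ⧸ AddSubgroup.zmultiples u) ∈
          AddSubgroup.zmultiples u := by
        rw [← neg_add_eq_sub]
        exact QuotientAddGroup.eq.mp (Quotient.out_eq _)
      have h1 : s (modHom u (AddMonoidAlgebra.single v c)) = AddMonoidAlgebra.single
          (Quotient.out (QuotientAddGroup.mk v : M ⧸ AddSubgroup.zmultiples u)) c := by
        simp [s, modHom, AddMonoidAlgebra.mapDomain_single]
      set w := Quotient.out (QuotientAddGroup.mk v : M ⧸ AddSubgroup.zmultiples u)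
      have h2 : (AddMonoidAlgebra.single v c - AddMonoidAlgebra.single w c :
          AddMonoidAlgebra ℂ M) =
          AddMonoidAlgebra.single w c * (AddMonoidAlgebra.single (k • u) 1 - 1) := by
        rw [mul_sub, AddMonoidAlgebra.single_mul_single, mul_one, mul_one]
        change k • u = v - w at hk
        rw [hk, add_sub_cancel]
      rw [h1, h2]
      exact Dvd.dvd.mul_left (single_sub_one_dvd_zsmul u k) _
  have := key f
  rw [hf] at this
  simpa [s] using this

lemma modHom_single_sub_one (u : M) :
    modHom u (AddMonoidAlgebra.single u 1 - 1) = 0 := by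
  have : (QuotientAddGroup.mk u : M ⧸ AddSubgroup.zmultiples u) = 0 := by simp
  rw [map_sub, map_one, sub_eq_zero, modHom, AddMonoidAlgebra.mapDomainAlgHom_apply,
    AddMonoidAlgebra.mapDomain_single, AddMonoidAlgebra.one_def]
  exact congrArg (AddMonoidAlgebra.single · 1) this

/-- Binomials with independent exponents form a regular sequence. -/
lemma dvd_of_dvd_single_sub_one_mul {u v : M}
    (h : ∀ k : ℕ, k ≠ 0 → k • v ∉ AddSubgroup.zmultiples u) {a : AddMonoidAlgebra ℂ M}
    (ha : (AddMonoidAlgebra.single u 1 - 1) ∣ (AddMonoidAlgebra.single v 1 - 1) * a) :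
    (AddMonoidAlgebra.single u 1 - 1) ∣ a := by
  apply dvd_of_modHom_eq_zero
  obtain ⟨b, hb⟩ := ha
  have h1 := congrArg (modHom u) hb
  rw [map_mul, map_mul, modHom_single_sub_one, zero_mul, map_sub, map_one, sub_mul, one_mul,
    sub_eq_zero] at h1
  refine eq_zero_of_single_mul_eq (u := QuotientAddGroup.mk v) (fun k hk hk' => h k hk ?_) ?_
  · rwa [← QuotientAddGroup.mk_nsmul, QuotientAddGroup.eq_zero_iff] at hk'
  · conv_rhs => rw [← h1]
    simp [modHom, AddMonoidAlgebra.mapDomain_single]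

/-- The factors x^u - 1 are split off one at a time, each time cancelling powers of x^v - 1 by
regularity and then x^u - 1 itself in the domain. -/
lemma pow_dvd_of_pow_dvd_mul [IsDomain (AddMonoidAlgebra ℂ M)] {u v : M} (hu : u ≠ 0)
    (h : ∀ k : ℕ, k ≠ 0 → k • v ∉ AddSubgroup.zmultiples u) (N : ℕ) :
    ∀ (K : ℕ) {a : AddMonoidAlgebra ℂ M},
      (AddMonoidAlgebra.single u 1 - 1) ^ K ∣ (AddMonoidAlgebra.single v 1 - 1) ^ N * a →
        (AddMonoidAlgebra.single u 1 - 1) ^ K ∣ a := by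
  have hq : (AddMonoidAlgebra.single u 1 - 1 : AddMonoidAlgebra ℂ M) ≠ 0 := by
    rw [sub_ne_zero, AddMonoidAlgebra.one_def]
    exact fun h => hu ((AddMonoidAlgebra.single_left_inj one_ne_zero).mp h)
  have h1 : ∀ (N : ℕ) {a : AddMonoidAlgebra ℂ M},
      (AddMonoidAlgebra.single u 1 - 1) ∣ (AddMonoidAlgebra.single v 1 - 1) ^ N * a →
        (AddMonoidAlgebra.single u 1 - 1) ∣ a := by
    intro N
    induction N with
    | zero => intro a ha; simpa using ha
    | succ N ih =>
      intro a ha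
      rw [pow_succ', mul_assoc] at ha
      exact ih (dvd_of_dvd_single_sub_one_mul h ha)
  intro K
  induction K with
  | zero => intro a _; simp
  | succ K ih =>
    intro a ha
    obtain ⟨b, rfl⟩ := h1 N ((dvd_pow_self _ K.succ_ne_zero).trans ha)
    rw [pow_succ', mul_left_comm] at ha
    rw [pow_succ']
    exact mul_dvd_mul_left _ (ih ((mul_dvd_mul_iff_left hq).mp ha))

/-- A linear functional that is at most `c` on the exponents of a binomial multiple of `G` is
bounded accordingly on the exponents of `G`. -/
lemma le_of_mem_support [IsAddTorsionFree M] (l : M →+ ℝ) {a b : M} (hab : a ≠ b)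
    (hl : l b ≤ l a) {G : AddMonoidAlgebra ℂ M} {c : ℝ}
    (h : ∀ u, ((AddMonoidAlgebra.single a 1 - AddMonoidAlgebra.single b 1) * G).coeff u ≠ 0 →
      l u ≤ c) {u : M} (hu : G.coeff u ≠ 0) : l u ≤ c - l a := by
  by_contra! hlt
  refine hu (eq_zero_of_forall_coeff_add (u := a - b)
    -- If l u > c - l a, the product has no terms at u + k(a - b) + a, because l(a - b) ≥ 0. Reading
    -- its coefficient there shows that G is constant along u + k(a - b).
    (fun k hk h0 => sub_ne_zero.mpr hab ((nsmul_eq_zero_iff_right hk).mp h0)) fun k => ?_)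
  induction k with
  | zero => simp
  | succ k ih =>
    rw [← ih]
    have h1 := mt (h (u + k • (a - b) + a)) (by
      have hk : 0 ≤ (k : ℝ) * (l a - l b) := mul_nonneg k.cast_nonneg (sub_nonneg.mpr hl)
      simp only [map_add, map_nsmul, map_sub, nsmul_eq_mul]
      linarith)
    rw [not_not, sub_mul, AddMonoidAlgebra.coeff_sub, Finsupp.sub_apply, coeff_single_mul',
      coeff_single_mul', add_sub_cancel_right, sub_eq_zero] at h1
    rw [h1]
    congr 1
    rw [succ_nsmul]
    abel

lemma le_of_mem_support_pow [IsAddTorsionFree M] (l : M →+ ℝ) {a b : M} (hab : a ≠ b)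
    (hl : l b ≤ l a) : ∀ (N : ℕ) {G : AddMonoidAlgebra ℂ M} {c : ℝ}
    (_ : ∀ u, ((AddMonoidAlgebra.single a 1 - AddMonoidAlgebra.single b 1) ^ N * G).coeff u ≠ 0 →
      l u ≤ c) {u : M} (_ : G.coeff u ≠ 0), l u ≤ c - N * l a := by
  intro N
  induction N with
  | zero => intro G c h u hu; simpa using h u (by simpa using hu)
  | succ N ih =>
    intro G c h u hu
    rw [pow_succ'] at h
    simp only [mul_assoc] at h
    have := ih (fun u hu => le_of_mem_support l hab hl h hu) hu
    push_cast
    linarith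

end GroupAlgebra
end

noncomputable section

/-! ### Lattice points of polytopes -/

namespace LatticePolytope

variable {n : ℕ} (P : LatticePolytope n)

/-- A lattice point as a real point. -/
abbrev toReal (u : Fin n → ℤ) (i : Fin n) : ℝ := (u i : ℝ)

lemma toReal_add (u v : Fin n → ℤ) : toReal (u + v) = toReal u + toReal v := by
  ext i; simp [toReal]

lemma toReal_sub (u v : Fin n → ℤ) : toReal (u - v) = toReal u - toReal v := by
  ext i; simp [toReal]

lemma mem_latticePoints_one {u : Fin n → ℤ} : u ∈ P.latticePoints 1 ↔ toReal u ∈ P.carrier := by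
  simp [latticePoints]

lemma nonempty_carrier : P.carrier.Nonempty := by
  obtain ⟨v, hv⟩ := P.exists_mem_latticePoints_one
  exact ⟨_, P.mem_latticePoints_one.mp hv⟩

lemma isCompact_carrier : IsCompact P.carrier := by
  obtain ⟨S, -, h⟩ := P.isLattice
  rw [h]
  exact (S.finite_toSet.image _).isCompact_convexHull ℝ

lemma finite_latticePoints (m : ℕ) : (P.latticePoints m).Finite := by
  obtain ⟨R, hR⟩ := ((P.isCompact_carrier.smul (m : ℝ)).isBounded).exists_norm_le
  refine (Set.finite_Icc (fun _ : Fin n => -⌈R⌉) (fun _ => ⌈R⌉)).subset fun u hu => ?_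
  have h := fun i => (norm_le_pi_norm _ i).trans (hR _ hu)
  simp only [Real.norm_eq_abs, abs_le] at h
  constructor
  · intro i
    have := (neg_le_neg (Int.le_ceil R)).trans (h i).1
    exact_mod_cast this
  · intro i
    have := (h i).2.trans (Int.le_ceil R)
    exact_mod_cast this

/-- A linear functional attains its maximum on a lattice polytope at a lattice point. -/
lemma exists_forall_le (l : (Fin n → ℝ) →ₗ[ℝ] ℝ) :
    ∃ v ∈ P.latticePoints 1, ∀ x ∈ P.carrier, l x ≤ l (toReal v) := by
  obtain ⟨S, hS, h⟩ := P.isLattice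
  obtain ⟨v, hv, hmax⟩ := S.exists_max_image (fun v => l (toReal v)) hS
  refine ⟨v, P.mem_latticePoints_one.mpr (h ▸ subset_convexHull ℝ _ ⟨v, hv, rfl⟩), ?_⟩
  rw [h]
  have : convexHull ℝ ((fun (v : Fin n → ℤ) (i : Fin n) => (v i : ℝ)) '' (S : Set (Fin n → ℤ))) ⊆
      {x | l x ≤ l (toReal v)} := by
    refine convexHull_min ?_ (convex_halfSpace_le l.isLinear _)
    rintro _ ⟨w, hw, rfl⟩
    exact hmax w hw
  exact fun x hx => this hx

lemma vectorSpan_carrier_le {W : Submodule ℝ (Fin n → ℝ)} {v : Fin n → ℤ}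
    (h : ∀ w ∈ P.latticePoints 1, toReal (w - v) ∈ W) : vectorSpan ℝ P.carrier ≤ W := by
  obtain ⟨S, -, hS⟩ := P.isLattice
  rw [hS, ← direction_affineSpan, affineSpan_convexHull, direction_affineSpan, vectorSpan_def,
    Submodule.span_le]
  rintro _ ⟨_, ⟨a, ha, rfl⟩, _, ⟨b, hb, rfl⟩, rfl⟩
  have hmem : ∀ a ∈ S, a ∈ P.latticePoints 1 := fun a ha =>
    P.mem_latticePoints_one.mpr (hS ▸ subset_convexHull ℝ _ ⟨a, ha, rfl⟩)
  convert W.sub_mem (h a (hmem a ha)) (h b (hmem b hb)) using 1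
  simp only [toReal_sub, sub_sub_sub_cancel_right]
  rfl

/-- Otherwise all differences of lattice points would lie on one line, and with them the direction
space of P. Every use of dim P ≥ 2 goes through this statement. -/
lemma exists_independent (hP : 2 ≤ P.dim) : ∃ v ∈ P.latticePoints 1, ∃ w ∈ P.latticePoints 1,
    ∃ w' ∈ P.latticePoints 1, w ≠ v ∧ toReal (w' - v) ∉ Submodule.span ℝ {toReal (w - v)} := by
  obtain ⟨v, hv⟩ := P.exists_mem_latticePoints_one
  by_contra! H
  have hle : ∃ x : Fin n → ℝ, vectorSpan ℝ P.carrier ≤ Submodule.span ℝ {x} := by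
    by_cases hw : ∃ w ∈ P.latticePoints 1, w ≠ v
    · obtain ⟨w, hw, hwv⟩ := hw
      exact ⟨toReal (w - v), P.vectorSpan_carrier_le fun w' hw' => H v hv w hw w' hw' hwv⟩
    · push Not at hw
      refine ⟨0, P.vectorSpan_carrier_le (v := v) fun w' hw' => ?_⟩
      rw [hw w' hw', sub_self]
      convert Submodule.zero_mem _
      ext i
      simp [toReal]
  obtain ⟨x, hx⟩ := hle
  have h1 := Submodule.finrank_mono hx
  have h2 := finrank_span_le_card (R := ℝ) ({x} : Set (Fin n → ℝ))
  simp only [Set.toFinset_singleton, Finset.card_singleton] at h2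
  have h3 : 2 ≤ Module.finrank ℝ (vectorSpan ℝ P.carrier) := hP
  omega

/-- A point outside the compact convex set mP is separated from it by a linear functional, whose
maximum on P is attained at a lattice point. -/
lemma mem_latticePoints_of_forall_le {m : ℕ} {u : Fin n → ℤ}
    (h : ∀ (l : (Fin n → ℝ) →ₗ[ℝ] ℝ) (v : Fin n → ℤ), v ∈ P.latticePoints 1 →
      (∀ x ∈ P.carrier, l x ≤ l (toReal v)) → l (toReal u) ≤ m * l (toReal v)) :
    u ∈ P.latticePoints m := by
  by_contra hu
  obtain ⟨f, c, h1, h2⟩ := geometric_hahn_banach_closed_point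
    (P.convex_carrier.smul (m : ℝ)) (P.isCompact_carrier.smul (m : ℝ)).isClosed hu
  obtain ⟨v, hv, hmax⟩ := P.exists_forall_le (f : (Fin n → ℝ) →ₗ[ℝ] ℝ)
  have h3 := h f v hv hmax
  have h4 := h1 _ (Set.smul_mem_smul_set (P.mem_latticePoints_one.mp hv))
  rw [map_smul, smul_eq_mul] at h4
  exact absurd (h3.trans_lt h4) (not_lt.mpr h2.le)

lemma le_of_mem_latticePoints {m : ℕ} {u : Fin n → ℤ} (hu : u ∈ P.latticePoints m)
    {l : (Fin n → ℝ) →ₗ[ℝ] ℝ} {c : ℝ} (hc : ∀ x ∈ P.carrier, l x ≤ c) :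
    l (toReal u) ≤ m * c := by
  obtain ⟨x, hx, hxu⟩ := Set.mem_smul_set.mp hu
  change _ = toReal u at hxu
  rw [← hxu, map_smul, smul_eq_mul]
  exact mul_le_mul_of_nonneg_left (hc x hx) m.cast_nonneg

/-! ### The semigroup algebra inside the Laurent polynomial ring -/

/-- The Laurent polynomial ring `ℂ[x₁^±, …, xₙ^±, z^±]`. -/
abbrev LaurentRing (n : ℕ) : Type := AddMonoidAlgebra ℂ ((Fin n → ℤ) × ℤ)

/-- The inclusion of the semigroup in `ℤⁿ × ℤ`. -/
def semigroupHom : P.semigroup →+ (Fin n → ℤ) × ℤ :=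
  ((AddMonoidHom.id (Fin n → ℤ)).prodMap (Nat.castAddMonoidHom ℤ)).comp P.semigroup.subtype

lemma semigroupHom_apply (p : P.semigroup) : P.semigroupHom p = (p.1.1, (p.1.2 : ℤ)) := rfl

lemma semigroupHom_injective : Function.Injective P.semigroupHom := by
  rintro ⟨⟨u, k⟩, hu⟩ ⟨⟨v, l⟩, hv⟩ h
  simp only [semigroupHom_apply, Prod.mk.injEq, Nat.cast_inj] at h
  obtain ⟨rfl, rfl⟩ := h
  rfl

/-- The inclusion of the semigroup algebra in the Laurent polynomial ring. -/
def toLaurent : P.SemigroupAlgebra →ₐ[ℂ] LaurentRing n :=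
  AddMonoidAlgebra.mapDomainAlgHom ℂ ℂ P.semigroupHom

lemma toLaurent_single (p : P.semigroup) (c : ℂ) :
    P.toLaurent (.single p c) = .single (p.1.1, (p.1.2 : ℤ)) c := by
  rw [toLaurent, AddMonoidAlgebra.mapDomainAlgHom_apply, AddMonoidAlgebra.mapDomain_single]
  rfl

lemma toLaurent_injective : Function.Injective P.toLaurent :=
  AddMonoidAlgebra.mapDomain_injective P.semigroupHom_injective

instance : IsDomain P.SemigroupAlgebra :=
  P.toLaurent_injective.isDomain P.toLaurent.toRingHom

lemma mem_grading_iff {k : ℕ} {f : P.SemigroupAlgebra} :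
    f ∈ P.grading k ↔ ∀ p, f.coeff p ≠ 0 → p.1.2 = k := by
  rw [AddMonoidAlgebra.mem_gradeBy_iff]
  constructor
  · exact fun h p hp => h (Finsupp.mem_support_iff.mpr hp)
  · exact fun h p hp => h p (Finsupp.mem_support_iff.mp hp)

/-- The monomial `x^u z^m`. -/
def monomial {m : ℕ} {u : Fin n → ℤ} (hu : u ∈ P.latticePoints m) : P.SemigroupAlgebra :=
  .single ⟨(u, m), hu⟩ 1

lemma monomial_mem {m : ℕ} {u : Fin n → ℤ} (hu : u ∈ P.latticePoints m) :
    P.monomial hu ∈ P.grading m :=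
  AddMonoidAlgebra.single_mem_gradeBy P.degree _ 1

lemma toLaurent_monomial {m : ℕ} {u : Fin n → ℤ} (hu : u ∈ P.latticePoints m) :
    P.toLaurent (P.monomial hu) = .single (u, (m : ℤ)) 1 :=
  P.toLaurent_single _ _

lemma mem_of_coeff_toLaurent_ne_zero {k : ℕ} {f : P.SemigroupAlgebra} (hf : f ∈ P.grading k)
    {u : Fin n → ℤ} {z : ℤ} (h : (P.toLaurent f).coeff (u, z) ≠ 0) :
    z = k ∧ u ∈ P.latticePoints k := by
  classical
  rw [mem_grading_iff] at hf
  obtain ⟨⟨⟨v, l⟩, hv⟩, hp, hpu⟩ := Finset.mem_image.mp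
    (Finsupp.mapDomain_support (Finsupp.mem_support_iff.mpr h))
  rw [semigroupHom_apply, Prod.mk.injEq] at hpu
  obtain ⟨rfl, rfl⟩ := hpu
  obtain rfl := hf _ (Finsupp.mem_support_iff.mp hp)
  exact ⟨rfl, hv⟩

lemma exists_toLaurent_eq {k : ℕ} {F : LaurentRing n}
    (h : ∀ u z, F.coeff (u, z) ≠ 0 → z = k ∧ u ∈ P.latticePoints k) :
    ∃ f ∈ P.grading k, P.toLaurent f = F := by
  refine ⟨.ofCoeff (F.coeff.comapDomain P.semigroupHom P.semigroupHom_injective.injOn), ?_, ?_⟩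
  · rw [mem_grading_iff]
    intro p hp
    have : (p.1.2 : ℤ) = k := (h _ _ hp).1
    exact_mod_cast this
  · apply AddMonoidAlgebra.ext
    refine Finsupp.mapDomain_comapDomain _ P.semigroupHom_injective _ ?_
    rintro ⟨u, z⟩ huz
    obtain ⟨rfl, hu⟩ := h u z (Finsupp.mem_support_iff.mp huz)
    exact ⟨⟨(u, k), hu⟩, rfl⟩

end LatticePolytope
end

noncomputable section

/-! ### Homogeneous fractions -/

namespace LatticePolytope

variable {n : ℕ} (P : LatticePolytope n)

/-- The field of fractions of the Laurent polynomial ring. -/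
abbrev LaurentField (n : ℕ) : Type := FractionRing (LaurentRing n)

/-- The inclusion of the semigroup algebra in the field of fractions of the Laurent polynomial
ring. -/
def toField : P.SemigroupAlgebra →ₐ[ℂ] LaurentField n :=
  (IsScalarTower.toAlgHom ℂ (LaurentRing n) (LaurentField n)).comp P.toLaurent

lemma toField_apply (f : P.SemigroupAlgebra) :
    P.toField f = algebraMap (LaurentRing n) (LaurentField n) (P.toLaurent f) := rfl

lemma toField_injective : Function.Injective P.toField :=
  (IsFractionRing.injective (LaurentRing n) (LaurentField n)).comp P.toLaurent_injective

lemma toField_ne_zero {f : P.SemigroupAlgebra} (hf : f ≠ 0) : P.toField f ≠ 0 :=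
  (map_ne_zero_iff _ P.toField_injective).mpr hf

lemma monomial_ne_zero {m : ℕ} {u : Fin n → ℤ} (hu : u ∈ P.latticePoints m) :
    P.monomial hu ≠ 0 :=
  AddMonoidAlgebra.single_ne_zero.mpr one_ne_zero

/-- Compare homogeneous components of c * s: the extra components of c are killed by s, hence vanish
in a domain. -/
lemma mem_grading_of_mul_mem {c s : P.SemigroupAlgebra} {i k : ℕ} (hs : s ∈ P.grading i)
    (hs0 : s ≠ 0) (h : c * s ∈ P.grading (k + i)) : c ∈ P.grading k := by
  have key : ∀ l, l ≠ k → (DirectSum.decompose P.grading c l : P.SemigroupAlgebra) = 0 := by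
    intro l hl
    have h1 := DirectSum.coe_decompose_mul_add_of_right_mem P.grading (a := c) (i := l) hs
    rw [DirectSum.decompose_of_mem_ne _ h (by omega)] at h1
    exact (mul_eq_zero.mp h1.symm).resolve_right hs0
  rw [← DirectSum.sum_support_decompose P.grading c]
  refine sum_mem fun l _ => ?_
  rcases eq_or_ne l k with rfl | hl
  · exact SetLike.coe_mem _
  · rw [key l hl]
    exact zero_mem _

/-- The generic point of the toric variety. -/
def zeroPoint : ProjectiveSpectrum P.grading where
  asHomogeneousIdeal := ⊥
  isPrime := by
    rw [HomogeneousIdeal.toIdeal_bot]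
    exact Ideal.isPrime_bot
  not_irrelevant_le := by
    intro hle
    obtain ⟨v, hv⟩ := P.exists_mem_latticePoints_one
    have hmem : P.monomial hv ∈ HomogeneousIdeal.irrelevant P.grading := by
      rw [HomogeneousIdeal.mem_irrelevant_iff, GradedRing.proj_apply,
        DirectSum.decompose_of_mem_ne _ (P.monomial_mem hv) one_ne_zero]
    exact P.monomial_ne_zero hv (hle hmem)

lemma notMem_zeroPoint {f : P.SemigroupAlgebra} (hf : f ≠ 0) :
    f ∉ P.zeroPoint.asHomogeneousIdeal := hf

/-- A rational function which is locally on `D₊(h)` a quotient of homogeneous elements of the same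
degree is a global such quotient with denominator a power of `h`. -/
lemma exists_pow_mul_eq {k : ℕ} (hk : 0 < k) {h : P.SemigroupAlgebra} (hh : h ∈ P.grading k)
    {φ : LaurentField n}
    (H : ∀ x : ProjectiveSpectrum P.grading, h ∉ x.asHomogeneousIdeal →
      ∃ i, ∃ s ∈ P.grading i, s ∉ x.asHomogeneousIdeal ∧
        ∃ a ∈ P.grading i, P.toField s * φ = P.toField a) :
    ∃ N, ∃ c ∈ P.grading (N * k), P.toField h ^ N * φ = P.toField c := by
  rcases eq_or_ne h 0 with rfl | h0
  · exact ⟨1, 0, zero_mem _, by simp⟩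
  let D : Set P.SemigroupAlgebra :=
    {s | ∃ i, s ∈ P.grading i ∧ ∃ a ∈ P.grading i, P.toField s * φ = P.toField a}
  have hD : (Ideal.span D).IsHomogeneous P.grading :=
    Ideal.homogeneous_span _ _ fun s ⟨i, hs, _⟩ => ⟨i, hs⟩
  -- D consists of the homogeneous denominators of φ. By hypothesis no homogeneous prime containing
  -- D avoids h; a prime avoiding h is automatically a point of Proj, since h has positive degree.
  have hrad : h ∈ (Ideal.span D).radical := by
    rw [hD.radical_eq, Ideal.mem_sInf]
    rintro J ⟨hJ, hle, hJp⟩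
    by_contra hhJ
    let x : ProjectiveSpectrum P.grading := ⟨⟨J, hJ⟩, hJp, fun hirr => hhJ (hirr (by
      rw [HomogeneousIdeal.mem_irrelevant_iff, GradedRing.proj_apply,
        DirectSum.decompose_of_mem_ne _ hh hk.ne']))⟩
    obtain ⟨i, s, hs, hsx, a, ha, hsa⟩ := H x hhJ
    exact hsx (hle (Ideal.subset_span ⟨i, hs, a, ha, hsa⟩))
  obtain ⟨N, hN⟩ := hrad
  have hden : ∀ s ∈ Ideal.span D, ∃ c, P.toField s * φ = P.toField c := by
    intro s hs
    induction hs using Submodule.span_induction with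
    | mem s hs => obtain ⟨i, _, a, _, h⟩ := hs; exact ⟨a, h⟩
    | zero => exact ⟨0, by simp⟩
    | add s t _ _ hs ht =>
      obtain ⟨a, ha⟩ := hs
      obtain ⟨b, hb⟩ := ht
      exact ⟨a + b, by rw [map_add, map_add, add_mul, ha, hb]⟩
    | smul r s _ hs =>
      obtain ⟨a, ha⟩ := hs
      exact ⟨r * a, by rw [smul_eq_mul, map_mul, map_mul, mul_assoc, ha]⟩
  obtain ⟨c, hc⟩ := hden _ hN
  rw [map_pow] at hc
  -- A homogeneous fraction a / s for φ at the generic point; comparing it with c / h^N shows that c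
  -- is homogeneous.
  obtain ⟨i, s, hs, hsx, a, ha, hsa⟩ := H P.zeroPoint (P.notMem_zeroPoint h0)
  refine ⟨N, c, P.mem_grading_of_mul_mem hs (fun h0 => hsx (h0 ▸ zero_mem _)) ?_, hc⟩
  have : c * s = h ^ N * a := by
    apply P.toField_injective
    rw [map_mul, map_mul, map_pow, ← hc, ← hsa]
    ring
  rw [this]
  exact SetLike.mul_mem_graded (SetLike.pow_mem_graded N hh) ha

/-! ### Extension over the identity point -/

instance : IsAddTorsionFree ((Fin n → ℤ) × ℤ) where
  nsmul_right_injective k hk u v h := by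
    simp only [Prod.ext_iff, funext_iff] at h ⊢
    simpa [hk] using h

/-- x^v z - x^w z = -x^v z (x^(w-v) - 1), and x^v z is a unit among Laurent polynomials. -/
lemma toField_sub_monomial_pow_mul {v w : Fin n → ℤ} (hv : v ∈ P.latticePoints 1)
    (hw : w ∈ P.latticePoints 1) (F : LaurentField n) (N : ℕ) {f : P.SemigroupAlgebra}
    (h : (P.toField (P.monomial hv) - P.toField (P.monomial hw)) ^ N * F = P.toField f) :
    ∃ G : LaurentRing n, algebraMap _ (LaurentField n)
      (AddMonoidAlgebra.single (w - v, 0) 1 - 1 : LaurentRing n) ^ N * F =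
        algebraMap _ _ G := by
  refine ⟨(-AddMonoidAlgebra.single (-v, -1) 1) ^ N * P.toLaurent f, ?_⟩
  rw [map_mul, ← P.toField_apply, ← h, map_pow, ← mul_assoc, ← mul_pow]
  congr 2
  rw [P.toField_apply, P.toField_apply, P.toLaurent_monomial, P.toLaurent_monomial, ← map_sub,
    ← map_mul, mul_sub, neg_mul, neg_mul, AddMonoidAlgebra.single_mul_single,
    AddMonoidAlgebra.single_mul_single]
  congr 1
  simp only [AddMonoidAlgebra.one_def, Prod.mk_add_mk, Nat.cast_one, neg_add_cancel, mul_one,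
    Prod.mk_zero_zero, neg_add_eq_sub]
  ring

/-- A rational function whose products with powers of the binomials `x^v z - x^w z` belong to the
semigroup algebra belongs to the Laurent polynomial ring. -/
lemma exists_algebraMap_eq (hP : 2 ≤ P.dim) {F : LaurentField n}
    (h : ∀ (v w : Fin n → ℤ) (hv : v ∈ P.latticePoints 1) (hw : w ∈ P.latticePoints 1), v ≠ w →
      ∃ N f, (P.toField (P.monomial hv) - P.toField (P.monomial hw)) ^ N * F = P.toField f) :
    ∃ G : LaurentRing n, algebraMap _ _ G = F := by
  obtain ⟨v, hv, w, hw, w', hw', hne, hind⟩ := P.exists_independent hP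
  have hne' : w' ≠ v := by
    rintro rfl
    refine hind ?_
    rw [sub_self]
    convert Submodule.zero_mem _
    ext i
    simp [toReal]
  obtain ⟨K, f, hf⟩ := h v w hv hw hne.symm
  obtain ⟨N, f', hf'⟩ := h v w' hv hw' hne'.symm
  obtain ⟨a, ha⟩ := P.toField_sub_monomial_pow_mul hv hw F K hf
  obtain ⟨b, hb⟩ := P.toField_sub_monomial_pow_mul hv hw' F N hf'
  have hinj := IsFractionRing.injective (LaurentRing n) (LaurentField n)
  -- F has one denominator that is a power of x^(w-v) - 1 and another that is a power of x^(w'-v) -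
  -- 1. By regularity of this pair the first divides its own numerator.
  have hdvd : (AddMonoidAlgebra.single (w - v, 0) 1 - 1 : LaurentRing n) ^ K ∣
      (AddMonoidAlgebra.single (w' - v, 0) 1 - 1) ^ N * a := by
    refine ⟨b, hinj ?_⟩
    rw [map_mul, map_mul, map_pow, map_pow, ← ha, ← hb]
    ring
  have hu : ((w - v, 0) : (Fin n → ℤ) × ℤ) ≠ 0 := by
    simpa [Prod.ext_iff, sub_eq_zero] using hne
  have hind' : ∀ k : ℕ, k ≠ 0 →
      k • ((w' - v, 0) : (Fin n → ℤ) × ℤ) ∉ AddSubgroup.zmultiples (w - v, 0) := by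
    rintro k hk ⟨l, hl⟩
    simp only [Prod.smul_mk, Prod.mk.injEq] at hl
    refine hind (Submodule.mem_span_singleton.mpr ⟨(l : ℝ) / k, ?_⟩)
    ext i
    have := congrFun hl.1 i
    simp only [Pi.smul_apply, smul_eq_mul, nsmul_eq_mul] at this
    have h2 : (l : ℝ) * ((w - v) i : ℤ) = k * ((w' - v) i : ℤ) := by exact_mod_cast this
    have hk' : (k : ℝ) ≠ 0 := by exact_mod_cast hk
    simp only [toReal, Pi.smul_apply, smul_eq_mul]
    field_simp
    linarith
  obtain ⟨G, rfl⟩ := GroupAlgebra.pow_dvd_of_pow_dvd_mul hu hind' N K hdvd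
  refine ⟨G, ?_⟩
  rw [map_mul, map_pow] at ha
  refine (mul_left_cancel₀ (pow_ne_zero _ ?_) ha).symm
  rw [map_ne_zero_iff _ hinj, sub_ne_zero, AddMonoidAlgebra.one_def]
  exact fun h => hu ((AddMonoidAlgebra.single_left_inj one_ne_zero).mp h)

/-- The functional on `ℤⁿ × ℤ` induced by a functional on the first factor. -/
def fstFunctional (l : (Fin n → ℝ) →ₗ[ℝ] ℝ) : (Fin n → ℤ) × ℤ →+ ℝ where
  toFun p := l (toReal p.1)
  map_zero' := by
    convert map_zero l
    ext i
    simp [toReal]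
  map_add' p q := by rw [Prod.fst_add, toReal_add, map_add]

/-- The functional `(u, z) ↦ c z` on `ℤⁿ × ℤ`. -/
def sndFunctional (n : ℕ) (c : ℝ) : (Fin n → ℤ) × ℤ →+ ℝ where
  toFun p := c * p.2
  map_zero' := by simp
  map_add' p q := by simp [mul_add]

/-- The Hartogs phenomenon at the identity point for homogeneous rational functions. -/
theorem exists_toField_eq (hP : 2 ≤ P.dim) (m : ℤ) {F : LaurentField n}
    (h : ∀ (v w : Fin n → ℤ) (hv : v ∈ P.latticePoints 1) (hw : w ∈ P.latticePoints 1), v ≠ w →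
      ∃ N k : ℕ, (k : ℤ) = m + N ∧ ∃ f ∈ P.grading k,
        (P.toField (P.monomial hv) - P.toField (P.monomial hw)) ^ N * F = P.toField f) :
    F = 0 ∨ ∃ k : ℕ, (k : ℤ) = m ∧ ∃ f ∈ P.grading k, P.toField f = F := by
  obtain ⟨G, rfl⟩ := P.exists_algebraMap_eq hP fun v w hv hw hvw => by
    obtain ⟨N, _, _, f, _, hf⟩ := h v w hv hw hvw
    exact ⟨N, f, hf⟩
  have hinj := IsFractionRing.injective (LaurentRing n) (LaurentField n)
  have key : ∀ (v w : Fin n → ℤ), v ∈ P.latticePoints 1 → w ∈ P.latticePoints 1 → v ≠ w →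
      ∃ N k : ℕ, (k : ℤ) = m + N ∧ ∀ (u : Fin n → ℤ) (z : ℤ), ((AddMonoidAlgebra.single (v, 1) 1 -
        AddMonoidAlgebra.single (w, 1) 1) ^ N * G).coeff (u, z) ≠ 0 →
          z = k ∧ u ∈ P.latticePoints k := by
    intro v w hv hw hvw
    obtain ⟨N, k, hk, f, hf, hfG⟩ := h v w hv hw hvw
    refine ⟨N, k, hk, fun u z huz => ?_⟩
    rw [P.toField_apply, P.toField_apply, P.toField_apply, ← map_sub, ← map_pow, ← map_mul,
      P.toLaurent_monomial, P.toLaurent_monomial] at hfG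
    rw [Nat.cast_one] at hfG
    rw [hinj hfG] at huz
    exact P.mem_of_coeff_toLaurent_ne_zero hf huz
  obtain ⟨v₀, hv₀, w₀, hw₀, -, -, hne₀, -⟩ := P.exists_independent hP
  have hpair : ∀ v w : Fin n → ℤ, v ≠ w →
      ((v, 1) : (Fin n → ℤ) × ℤ) ≠ (w, 1) := fun v w h h' => h (Prod.ext_iff.mp h').1
  -- The support bound is applied to both functionals z and -z, on which the two terms of the
  -- binomial agree.
  have hsnd : ∀ u z, G.coeff (u, z) ≠ 0 → z = m := by
    intro u z huz
    obtain ⟨N, k, hk, hN⟩ := key v₀ w₀ hv₀ hw₀ hne₀.symm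
    have hk' : (k : ℝ) = m + N := by exact_mod_cast hk
    have h1 : ∀ c : ℝ, c * z ≤ c * m := by
      intro c
      have := GroupAlgebra.le_of_mem_support_pow (sndFunctional n c) (hpair _ _ hne₀.symm)
        (le_of_eq rfl) N (c := c * k) (fun p hp => by
          have := (hN p.1 p.2 hp).1
          simp [sndFunctional, this]) huz
      simp only [sndFunctional, AddMonoidHom.coe_mk, ZeroHom.coe_mk, hk'] at this
      push_cast at this
      linarith
    have h2 := h1 1
    have h3 := h1 (-1)
    have : (z : ℝ) = m := by linarith
    exact_mod_cast this
  have hfst : ∀ u z, G.coeff (u, z) ≠ 0 → ∀ (l : (Fin n → ℝ) →ₗ[ℝ] ℝ) (v : Fin n → ℤ),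
      v ∈ P.latticePoints 1 → (∀ x ∈ P.carrier, l x ≤ l (toReal v)) →
        l (toReal u) ≤ m * l (toReal v) := by
    intro u z huz l v hv hmax
    obtain ⟨w, hw, hvw⟩ : ∃ w ∈ P.latticePoints 1, v ≠ w := by
      by_cases h : v = v₀
      · exact ⟨w₀, hw₀, h ▸ hne₀.symm⟩
      · exact ⟨v₀, hv₀, h⟩
    -- The binomial must contain the maximizer v: its N-th power raises the bound m l(v) to (m + N)
    -- l(v) = k l(v), which is the bound known on kP.
    obtain ⟨N, k, hk, hN⟩ := key v w hv hw hvw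
    have hk' : (k : ℝ) = m + N := by exact_mod_cast hk
    have := GroupAlgebra.le_of_mem_support_pow (fstFunctional l) (hpair _ _ hvw)
      (hmax _ (P.mem_latticePoints_one.mp hw)) N (c := k * l (toReal v))
      (fun p hp => P.le_of_mem_latticePoints (hN p.1 p.2 hp).2 hmax) huz
    simp only [fstFunctional, AddMonoidHom.coe_mk, ZeroHom.coe_mk, hk'] at this
    linarith
  rcases lt_or_ge m 0 with hm | hm
  · left
    rw [map_eq_zero_iff _ hinj]
    ext ⟨u, z⟩
    by_contra huz
    -- Pick a coordinate that is not constant on P. The bounds by its maximum a_i and minimum b_i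
    -- give m b_i ≤ u_i ≤ m a_i; as m < 0 this forces a_i ≤ b_i, a contradiction.
    obtain ⟨i, hi⟩ : ∃ i, v₀ i ≠ w₀ i := by
      by_contra! hvw
      exact hne₀ (funext fun i => (hvw i).symm)
    obtain ⟨a, ha, hamax⟩ := P.exists_forall_le (LinearMap.proj i)
    obtain ⟨b, hb, hbmax⟩ := P.exists_forall_le (-LinearMap.proj i)
    have h1 := hfst u z huz _ a ha hamax
    have h2 := hfst u z huz _ b hb hbmax
    have h3 := hamax _ (P.mem_latticePoints_one.mp hv₀)
    have h4 := hamax _ (P.mem_latticePoints_one.mp hw₀)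
    have h5 := hbmax _ (P.mem_latticePoints_one.mp hv₀)
    have h6 := hbmax _ (P.mem_latticePoints_one.mp hw₀)
    simp only [LinearMap.neg_apply, LinearMap.proj_apply] at h1 h2 h3 h4 h5 h6
    have hm' : (m : ℝ) < 0 := by exact_mod_cast hm
    have h7 : toReal a i ≤ toReal b i := by
      by_contra! hlt
      nlinarith
    have h8 : toReal v₀ i = toReal w₀ i := by linarith
    exact hi (by exact_mod_cast h8)
  · right
    obtain ⟨k, rfl⟩ := Int.eq_ofNat_of_zero_le hm
    refine ⟨k, rfl, ?_⟩
    obtain ⟨f, hf, hfG⟩ := P.exists_toLaurent_eq (k := k) (F := G) fun u z huz =>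
      ⟨hsnd u z huz, P.mem_latticePoints_of_forall_le fun l v hv hmax => by
        exact_mod_cast hfst u z huz l v hv hmax⟩
    exact ⟨f, hf, by rw [P.toField_apply, hfG]⟩

end LatticePolytope
end

noncomputable section

namespace LatticePolytope

variable {n : ℕ} (P : LatticePolytope n)

/-! ### The lattice of differences -/

/-- For a multiple k s of a defining lattice point s, adding (⌈k⌉ - k) s reaches a lattice point.
The property, quantified over all k, passes to convex combinations. It turns real differences of
points of dilates into integral ones. -/
lemma exists_add_eq_toReal {k : ℝ} (hk : 0 ≤ k) {q : Fin n → ℝ} (hq : q ∈ k • P.carrier) :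
    ∃ k' : ℝ, 0 ≤ k' ∧ ∃ q' ∈ k' • P.carrier, ∃ (N : ℕ) (z : Fin n → ℤ),
      k + k' = N ∧ q + q' = toReal z := by
  obtain ⟨x, hx, rfl⟩ := Set.mem_smul_set.mp hq
  obtain ⟨S, -, hS⟩ := P.isLattice
  have key : P.carrier ⊆ {x | ∀ k : ℝ, 0 ≤ k → ∃ k' : ℝ, 0 ≤ k' ∧ ∃ q' ∈ k' • P.carrier,
      ∃ (N : ℕ) (z : Fin n → ℤ), k + k' = N ∧ k • x + q' = toReal z} := by
    conv_lhs => rw [hS]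
    refine convexHull_min ?_ ?_
    · rintro _ ⟨s, hs, rfl⟩ k hk
      have hsP : toReal s ∈ P.carrier := by
        rw [hS]
        exact subset_convexHull ℝ _ ⟨s, hs, rfl⟩
      refine ⟨⌈k⌉₊ - k, sub_nonneg.mpr (Nat.le_ceil k), _, Set.smul_mem_smul_set hsP, ⌈k⌉₊, ⌈k⌉₊ • s, by ring, ?_⟩
      ext i
      simp [toReal]
      ring
    · intro x hx y hy a b ha hb hab k hk
      obtain ⟨k₁, hk₁, q₁, hq₁, N₁, z₁, hN₁, hz₁⟩ := hx (k * a) (mul_nonneg hk ha)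
      obtain ⟨k₂, hk₂, q₂, hq₂, N₂, z₂, hN₂, hz₂⟩ := hy (k * b) (mul_nonneg hk hb)
      refine ⟨k₁ + k₂, add_nonneg hk₁ hk₂, q₁ + q₂, ?_, N₁ + N₂, z₁ + z₂, ?_, ?_⟩
      · rw [P.convex_carrier.add_smul hk₁ hk₂]
        exact Set.add_mem_add hq₁ hq₂
      · push_cast
        rw [← hN₁, ← hN₂]
        linear_combination (-k) * hab
      · rw [toReal_add, ← hz₁, ← hz₂, smul_add, smul_smul, smul_smul]
        abel
  exact key hx k hk

/-- By convexity kP + k'P = (k + k')P, so differences of points in a common dilate are closed under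
addition; a negative scalar exchanges the two points. -/
lemma exists_sub_eq_of_mem_vectorSpan {x : Fin n → ℝ} (hx : x ∈ vectorSpan ℝ P.carrier) :
    ∃ k : ℝ, 0 ≤ k ∧ ∃ p ∈ k • P.carrier, ∃ q ∈ k • P.carrier, p - q = x := by
  rw [vectorSpan_def] at hx
  induction hx using Submodule.span_induction with
  | mem x hx =>
    obtain ⟨p, hp, q, hq, rfl⟩ := hx
    exact ⟨1, zero_le_one, p, by rwa [one_smul], q, by rwa [one_smul], rfl⟩
  | zero =>
    obtain ⟨p, hp⟩ := P.nonempty_carrier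
    exact ⟨1, zero_le_one, p, by rwa [one_smul], p, by rwa [one_smul], sub_self _⟩
  | add x y _ _ hx hy =>
    obtain ⟨k, hk, p, hp, q, hq, rfl⟩ := hx
    obtain ⟨k', hk', p', hp', q', hq', rfl⟩ := hy
    refine ⟨k + k', add_nonneg hk hk', p + p', ?_, q + q', ?_, by abel⟩
    · rw [P.convex_carrier.add_smul hk hk']
      exact Set.add_mem_add hp hp'
    · rw [P.convex_carrier.add_smul hk hk']
      exact Set.add_mem_add hq hq'
  | smul c x _ hx =>
    obtain ⟨k, hk, p, hp, q, hq, rfl⟩ := hx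
    rcases le_total 0 c with hc | hc
    · refine ⟨c * k, mul_nonneg hc hk, c • p, ?_, c • q, ?_, (smul_sub _ _ _).symm⟩
      · rw [mul_smul]; exact Set.smul_mem_smul_set hp
      · rw [mul_smul]; exact Set.smul_mem_smul_set hq
    · refine ⟨-c * k, mul_nonneg (neg_nonneg.mpr hc) hk, -c • q, ?_, -c • p, ?_, ?_⟩
      · rw [mul_smul]; exact Set.smul_mem_smul_set hq
      · rw [mul_smul]; exact Set.smul_mem_smul_set hp
      · simp only [neg_smul, smul_sub]
        abel

/-- The lattice `ℤⁿ ∩ vectorSpan P`. -/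
def spanLattice : Submodule ℤ (Fin n → ℤ) where
  carrier := {u | toReal u ∈ vectorSpan ℝ P.carrier}
  zero_mem' := by
    simp only [Set.mem_ofPred_eq]
    convert Submodule.zero_mem _
    ext i
    simp [toReal]
  add_mem' {u v} hu hv := by
    simp only [Set.mem_ofPred_eq] at hu hv ⊢
    rw [toReal_add]
    exact add_mem hu hv
  smul_mem' c u hu := by
    simp only [Set.mem_ofPred_eq] at hu ⊢
    convert Submodule.smul_mem _ (c : ℝ) hu using 1
    ext i
    simp [toReal]

lemma mem_spanLattice {u : Fin n → ℤ} :
    u ∈ P.spanLattice ↔ toReal u ∈ vectorSpan ℝ P.carrier := Iff.rfl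

/-- Every lattice vector parallel to `P` is a difference of lattice points of a dilation. -/
lemma exists_sub_eq_of_mem_spanLattice {u : Fin n → ℤ} (hu : u ∈ P.spanLattice) :
    ∃ k, ∃ w ∈ P.latticePoints k, ∃ w' ∈ P.latticePoints k, w - w' = u := by
  obtain ⟨k, hk, p, hp, q, hq, hpq⟩ := P.exists_sub_eq_of_mem_vectorSpan hu
  obtain ⟨k', hk', q', hq', N, z, hN, hz⟩ := P.exists_add_eq_toReal hk hq
  -- The same q' is added to both p and q: q + q' = z is integral, so p + q' = z + u is too.
  refine ⟨N, z + u, ?_, z, ?_, add_sub_cancel_left z u⟩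
  · change toReal (z + u) ∈ (N : ℝ) • P.carrier
    rw [toReal_add, ← hz, ← hpq, ← hN, P.convex_carrier.add_smul hk hk']
    convert Set.add_mem_add hp hq' using 1
    abel
  · change toReal z ∈ (N : ℝ) • P.carrier
    rw [← hz, ← hN, P.convex_carrier.add_smul hk hk']
    exact Set.add_mem_add hq hq'

lemma sub_mem_spanLattice {m : ℕ} {u v : Fin n → ℤ} (hu : u ∈ P.latticePoints m)
    (hv : v ∈ P.latticePoints 1) : u - m • v ∈ P.spanLattice := by
  obtain ⟨x, hx, hxu⟩ := Set.mem_smul_set.mp hu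
  rw [mem_spanLattice]
  have : toReal (u - m • v) = (m : ℝ) • (x - toReal v) := by
    rw [smul_sub, hxu]
    ext i
    simp [toReal]
  rw [this]
  exact Submodule.smul_mem _ _ (vsub_mem_vectorSpan ℝ hx (P.mem_latticePoints_one.mp hv))

/-- `spanLattice` is saturated, hence a direct summand of `ℤⁿ`. -/
lemma exists_retraction : ∃ r : (Fin n → ℤ) →ₗ[ℤ] (Fin n → ℤ),
    (∀ u, r u ∈ P.spanLattice) ∧ ∀ u ∈ P.spanLattice, r u = u := by
  have htf : Module.IsTorsionFree ℤ ((Fin n → ℤ) ⧸ P.spanLattice) := by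
    refine Module.isTorsionFree_iff_smul_eq_zero.mpr fun c x hcx => ?_
    obtain ⟨u, rfl⟩ := Submodule.Quotient.mk_surjective _ x
    rw [← Submodule.Quotient.mk_smul, Submodule.Quotient.mk_eq_zero, mem_spanLattice] at hcx
    by_cases hc : c = 0
    · exact Or.inl hc
    refine Or.inr ((Submodule.Quotient.mk_eq_zero _).mpr ?_)
    rw [mem_spanLattice]
    have hc' : (c : ℝ) ≠ 0 := by exact_mod_cast hc
    convert Submodule.smul_mem _ (c : ℝ)⁻¹ hcx using 1
    ext i
    simp [toReal, hc']
  have hfree : Module.Free ℤ ((Fin n → ℤ) ⧸ P.spanLattice) := Module.free_of_finite_type_torsion_free'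
  obtain ⟨s, hs⟩ := Module.projective_lifting_property P.spanLattice.mkQ LinearMap.id
    P.spanLattice.mkQ_surjective
  have hs' : ∀ x, P.spanLattice.mkQ (s x) = x := fun x => LinearMap.congr_fun hs x
  refine ⟨LinearMap.id - s.comp P.spanLattice.mkQ, fun u => ?_, fun u hu => ?_⟩
  · rw [← Submodule.Quotient.mk_eq_zero, ← Submodule.mkQ_apply]
    simp [hs', -Submodule.mkQ_apply]
  · have : P.spanLattice.mkQ u = 0 := by simpa using hu
    simp [this, -Submodule.mkQ_apply]

/-! ### The order of vanishing at the identity point -/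

/-- The substitution `x = exp(s t)`, `z = 1` on the semigroup algebra. -/
def expHom : P.SemigroupAlgebra →ₐ[ℂ] PowerSeries (MvPolynomial (Fin n) ℂ) :=
  ExpSum.expHom.comp (AddMonoidAlgebra.mapDomainAlgHom ℂ ℂ
    ((AddMonoidHom.fst (Fin n → ℤ) ℕ).comp P.semigroup.subtype))

lemma expHom_single (p : P.semigroup) (c : ℂ) :
    P.expHom (.single p c) = ExpSum.expHom (.single p.1.1 c) := by
  rw [expHom, AlgHom.comp_apply, AddMonoidAlgebra.mapDomainAlgHom_apply,
    AddMonoidAlgebra.mapDomain_single]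
  rfl

/-- Setting `z = 1` and translating exponents by `-m v`. -/
def dehomogenize (m : ℕ) (v : Fin n → ℤ) : P.SemigroupAlgebra →ₗ[ℂ] ExpSum.TorusRing n :=
  (LinearMap.mulLeft ℂ (.single (-(m • v)) 1)).comp (AddMonoidAlgebra.mapDomainAlgHom ℂ ℂ
    ((AddMonoidHom.fst (Fin n → ℤ) ℕ).comp P.semigroup.subtype)).toLinearMap

lemma dehomogenize_apply (m : ℕ) (v : Fin n → ℤ) (f : P.SemigroupAlgebra) :
    P.dehomogenize m v f = .single (-(m • v)) 1 * AddMonoidAlgebra.mapDomainAlgHom ℂ ℂ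
      ((AddMonoidHom.fst (Fin n → ℤ) ℕ).comp P.semigroup.subtype) f := rfl

lemma dehomogenize_single (m : ℕ) (v : Fin n → ℤ) (p : P.semigroup) (c : ℂ) :
    P.dehomogenize m v (.single p c) = .single (p.1.1 - m • v) c := by
  rw [dehomogenize_apply, AddMonoidAlgebra.mapDomainAlgHom_apply,
    AddMonoidAlgebra.mapDomain_single, AddMonoidAlgebra.single_mul_single, one_mul,
    neg_add_eq_sub]
  rfl

lemma grading_induction {m : ℕ} {M : P.SemigroupAlgebra → Prop} (zero : M 0)
    (add : ∀ f g, M f → M g → M (f + g))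
    (single : ∀ u (hu : u ∈ P.latticePoints m) c, M (.single ⟨(u, m), hu⟩ c))
    {f : P.SemigroupAlgebra} (hf : f ∈ P.grading m) : M f := by
  rw [mem_grading_iff] at hf
  rw [← AddMonoidAlgebra.sum_coeff_single f]
  refine Finset.sum_induction _ M add zero ?_
  rintro ⟨⟨u, k⟩, hu⟩ hp
  obtain rfl : k = m := hf _ (Finsupp.mem_support_iff.mp hp)
  exact single u hu _

lemma X_pow_dvd_expHom_dehomogenize {m d : ℕ} {v : Fin n → ℤ} {f : P.SemigroupAlgebra}
    (hf : PowerSeries.X ^ d ∣ P.expHom f) :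
    PowerSeries.X ^ d ∣ ExpSum.expHom (P.dehomogenize m v f) := by
  rw [dehomogenize_apply, map_mul]
  exact Dvd.dvd.mul_left hf _

/-- An element of the semigroup algebra vanishing to order `d` at the identity point has, after
dividing by a monomial, a representative in the `d`-th power of any ideal `J` containing `χ - 1` for
all quotients `χ` of monomials of the same degree. -/
theorem exists_mem_pow_of_X_pow_dvd {S : Type*} [CommRing S] [Algebra ℂ S]
    (ι : S →ₐ[ℂ] LaurentField n) (hι : Function.Injective ι) (J : Ideal S)
    (hJ : ∀ (k : ℕ) (w w' : Fin n → ℤ) (hw : w ∈ P.latticePoints k) (hw' : w' ∈ P.latticePoints k),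
      ∃ s : S, s - 1 ∈ J ∧ ι s * P.toField (P.monomial hw') = P.toField (P.monomial hw))
    {m d : ℕ} {f : P.SemigroupAlgebra} (hf : f ∈ P.grading m)
    (hd : PowerSeries.X ^ d ∣ P.expHom f) {v : Fin n → ℤ} (hv : v ∈ P.latticePoints 1) :
    ∃ s ∈ J ^ d, ι s * P.toField (P.monomial hv) ^ m = P.toField f := by
  -- The hypothesis on J provides the characters x^u only for u parallel to P. Composing with a
  -- retraction r of ℤⁿ onto that lattice defines ψ on all Laurent polynomials, where powers of the
  -- augmentation ideal are understood, and r fixes the exponents of the dehomogenized f.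
  obtain ⟨r, hr, hr'⟩ := P.exists_retraction
  let χ : (Fin n → ℤ) → LaurentField n := fun u =>
    algebraMap (LaurentRing n) (LaurentField n) (.single (u, 0) 1)
  have hχ : ∀ u, ∃ s : S, s - 1 ∈ J ∧ ι s = χ (r u) := by
    intro u
    obtain ⟨k, w, hw, w', hw', hww⟩ := P.exists_sub_eq_of_mem_spanLattice (hr u)
    obtain ⟨s, hs, hsw⟩ := hJ k w w' hw hw'
    refine ⟨s, hs, mul_right_cancel₀ (P.toField_ne_zero (P.monomial_ne_zero hw')) ?_⟩
    rw [hsw, P.toField_apply, P.toField_apply, P.toLaurent_monomial, P.toLaurent_monomial,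
      ← map_mul, AddMonoidAlgebra.single_mul_single, ← hww]
    simp
  choose σ hσ hσχ using hχ
  have hχadd : ∀ u u', χ (u + u') = χ u * χ u' := by
    intro u u'
    simp only [χ]
    rw [← map_mul, AddMonoidAlgebra.single_mul_single]
    simp
  let ψ : ExpSum.TorusRing n →ₐ[ℂ] S := AddMonoidAlgebra.lift ℂ S (Fin n → ℤ)
    { toFun u := σ u.toAdd
      map_one' := hι (by
        rw [hσχ, map_one ι, toAdd_one, map_zero]
        simp only [χ]
        rw [Prod.mk_zero_zero, ← AddMonoidAlgebra.one_def, map_one])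
      map_mul' u u' := hι (by
        rw [map_mul ι, hσχ, hσχ, hσχ, toAdd_mul, map_add, hχadd]) }
  have hψ : ∀ u c, ψ (.single u c) = c • σ u := fun u c => AddMonoidAlgebra.lift_single _ u c
  have hψJ : ExpSum.augIdeal n ≤ J.comap ψ := by
    have h1 : ∀ b, ψ b - algebraMap ℂ S (ExpSum.augmentation b) ∈ J := by
      intro b
      induction b using AddMonoidAlgebra.induction_linear with
      | zero => simp
      | add a b ha hb =>
        rw [map_add, map_add, map_add, add_sub_add_comm]
        exact add_mem ha hb
      | single u c =>
        rw [hψ, ExpSum.augmentation_single, Algebra.smul_def, ← mul_sub_one]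
        exact J.mul_mem_left _ (hσ u)
    intro b hb
    have := h1 b
    rwa [ExpSum.mem_augIdeal.mp hb, map_zero, sub_zero] at this
  refine ⟨ψ (P.dehomogenize m v f), ?_, ?_⟩
  · have := (ExpSum.mem_augIdeal_pow_iff d).mpr
      (P.X_pow_dvd_expHom_dehomogenize (m := m) (v := v) hd)
    exact Ideal.mem_comap.mp (Ideal.le_comap_pow ψ.toRingHom d (Ideal.pow_right_mono hψJ d this))
  · have key : ∀ f : P.SemigroupAlgebra, f ∈ P.grading m →
        ι (ψ (P.dehomogenize m v f)) * P.toField (P.monomial hv) ^ m = P.toField f := by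
      intro f hf
      refine P.grading_induction (M := fun f => ι (ψ (P.dehomogenize m v f)) *
        P.toField (P.monomial hv) ^ m = P.toField f) (by simp) (fun f g hf hg => ?_)
        (fun u hu c => ?_) hf
      · simp only [map_add, add_mul, hf, hg]
      · rw [dehomogenize_single, hψ, map_smul, hσχ, hr' _ (P.sub_mem_spanLattice hu hv),
          P.toField_apply, P.toLaurent_monomial, P.toField_apply, P.toLaurent_single,
          smul_mul_assoc, ← map_pow, ← map_mul, AddMonoidAlgebra.single_pow,
          AddMonoidAlgebra.single_mul_single]
        simp only [Prod.smul_mk, Nat.cast_one, nsmul_eq_mul, mul_one, one_pow,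
          Prod.mk_add_mk, sub_add_cancel, zero_add]
        refine (map_smul (IsScalarTower.toAlgHom ℂ (LaurentRing n) (LaurentField n)) c _).symm.trans
          ?_
        rw [AddMonoidAlgebra.smul_single, smul_eq_mul, mul_one]
        rfl
    exact key f hf

end LatticePolytope
end

noncomputable section

/-! ### Local rings of the toric variety inside the field of Laurent fractions -/

namespace LatticePolytope

variable {n : ℕ} (P : LatticePolytope n)

lemma toField_isUnit_of_notMem (x : ProjectiveSpectrum P.grading)
    (y : x.asHomogeneousIdeal.toIdeal.primeCompl) :
    IsUnit ((P.toField : P.SemigroupAlgebra →+* LaurentField n) y) := by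
  refine (P.toField_ne_zero ?_).isUnit
  rintro h
  exact y.2 (by rw [h]; exact zero_mem _)

/-- The homogeneous localization at a point of `Proj` as a subring of the field of Laurent
fractions. -/
def localizationToField (x : ProjectiveSpectrum P.grading) :
    HomogeneousLocalization.AtPrime P.grading x.asHomogeneousIdeal.toIdeal →+* LaurentField n :=
  (IsLocalization.lift (M := x.asHomogeneousIdeal.toIdeal.primeCompl)
      (S := Localization x.asHomogeneousIdeal.toIdeal.primeCompl)
      (P.toField_isUnit_of_notMem x)).comp (algebraMap _ _)

lemma toField_den_mul_localizationToField (x : ProjectiveSpectrum P.grading)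
    (c : HomogeneousLocalization.NumDenSameDeg P.grading
      x.asHomogeneousIdeal.toIdeal.primeCompl) :
    P.toField c.den * P.localizationToField x (HomogeneousLocalization.mk c) =
      P.toField c.num := by
  simp only [localizationToField, RingHom.comp_apply, HomogeneousLocalization.algebraMap_apply,
    HomogeneousLocalization.val_mk, Localization.mk_eq_mk']
  exact ((IsLocalization.lift_mk'_spec (M := x.asHomogeneousIdeal.toIdeal.primeCompl)
    (P.toField_isUnit_of_notMem x) _ _ ⟨c.den, c.den_mem⟩).mp rfl).symm

lemma localizationToField_injective (x : ProjectiveSpectrum P.grading) :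
    Function.Injective (P.localizationToField x) := by
  rw [injective_iff_map_eq_zero]
  intro z hz
  obtain ⟨c, rfl⟩ := HomogeneousLocalization.mk_surjective z
  have h := P.toField_den_mul_localizationToField x c
  rw [hz, mul_zero] at h
  have h0 : (c.num : P.SemigroupAlgebra) = 0 := P.toField_injective (by rw [← h, map_zero])
  apply HomogeneousLocalization.val_injective
  rw [HomogeneousLocalization.val_mk, h0, Localization.mk_zero, HomogeneousLocalization.val_zero]

/-- The local ring of the toric variety at a point as a subring of the field of Laurent
fractions. -/
def stalkToField (x : P.toricVariety) : P.toricVariety.presheaf.stalk x →+* LaurentField n :=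
  (P.localizationToField x).comp (Proj.stalkIso' P.grading x).toRingHom

lemma stalkToField_injective (x : P.toricVariety) : Function.Injective (P.stalkToField x) :=
  (P.localizationToField_injective x).comp (Proj.stalkIso' P.grading x).injective

/-- The point of the projective spectrum underlying a point of the toric variety. -/
abbrev specPoint (x : P.toricVariety) : ProjectiveSpectrum P.grading := x

/-- Sections of the structure sheaf of Proj are locally homogeneous fractions. The point is
uniformity: one fraction a / b computes the germs at all points of V. -/
lemma exists_stalkToField_germ (U : P.toricVariety.Opens) (s : Γ(P.toricVariety, U))
    (x : P.toricVariety) (hx : x ∈ U) :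
    ∃ (V : P.toricVariety.Opens) (_ : x ∈ V) (_ : V ≤ U) (i : ℕ),
      ∃ a ∈ P.grading i, ∃ b ∈ P.grading i, ∀ (y : P.toricVariety) (hy : y ∈ U), y ∈ V →
        b ∉ (P.specPoint y).asHomogeneousIdeal ∧
          P.toField b * P.stalkToField y (P.toricVariety.presheaf.germ U y hy s) =
            P.toField a := by
  obtain ⟨V, hxV, i, k, a, b, h, e⟩ := s.2 ⟨x, hx⟩
  refine ⟨V, hxV, fun y hy => i.le hy, k, a, a.2, b, b.2, fun y hy hyV => ⟨h ⟨y, hyV⟩, ?_⟩⟩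
  have h1 := e ⟨y, hyV⟩
  have h2 : Proj.stalkIso' P.grading y (P.toricVariety.presheaf.germ U y hy s) = s.1 ⟨y, hy⟩ :=
    Proj.stalkIso'_germ P.grading U y hy s
  have h3 : P.stalkToField y (P.toricVariety.presheaf.germ U y hy s) =
      P.localizationToField y (s.1 ⟨y, hy⟩) := congrArg (P.localizationToField y) h2
  rw [h3]
  have h4 := P.toField_den_mul_localizationToField y ⟨k, a, b, h ⟨y, hyV⟩⟩
  rw [← h4]
  exact congrArg (fun z => _ * P.localizationToField y z) h1

/-- The local ring at a point consists of the quotients of homogeneous elements of the same degree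
with nonvanishing denominator. -/
lemma mem_range_stalkToField (x : P.toricVariety) {i : ℕ} {a b : P.SemigroupAlgebra}
    (ha : a ∈ P.grading i) (hb : b ∈ P.grading i)
    (hbx : b ∉ (P.specPoint x).asHomogeneousIdeal) :
    ∃ z, P.toField b * P.stalkToField x z = P.toField a := by
  refine ⟨(Proj.stalkIso' P.grading x).symm (HomogeneousLocalization.mk ⟨i, ⟨a, ha⟩, ⟨b, hb⟩, hbx⟩),
    ?_⟩
  have h : P.stalkToField x ((Proj.stalkIso' P.grading x).symm
      (HomogeneousLocalization.mk ⟨i, ⟨a, ha⟩, ⟨b, hb⟩, hbx⟩)) =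
      P.localizationToField x (HomogeneousLocalization.mk ⟨i, ⟨a, ha⟩, ⟨b, hb⟩, hbx⟩) :=
    congrArg (P.localizationToField x) ((Proj.stalkIso' P.grading x).apply_symm_apply _)
  rw [h]
  exact P.toField_den_mul_localizationToField x ⟨i, ⟨a, ha⟩, ⟨b, hb⟩, hbx⟩

lemma exists_eq_stalkToField (x : P.toricVariety) (z : P.toricVariety.presheaf.stalk x) :
    ∃ i, ∃ b ∈ P.grading i, b ∉ (P.specPoint x).asHomogeneousIdeal ∧
      ∃ a ∈ P.grading i, P.toField b * P.stalkToField x z = P.toField a := by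
  obtain ⟨U, hx, s, rfl⟩ := P.toricVariety.presheaf.exists_germ_eq z
  obtain ⟨V, hxV, -, i, a, ha, b, hb, H⟩ := P.exists_stalkToField_germ U s x hx
  exact ⟨i, b, hb, (H x hx hxV).1, a, ha, (H x hx hxV).2⟩

/-- The same local fraction represents both germs. All local rings are thereby compared inside one
field. -/
lemma stalkToField_stalkSpecializes {x y : P.toricVariety} (h : y ⤳ x)
    (z : P.toricVariety.presheaf.stalk x) :
    P.stalkToField y (P.toricVariety.presheaf.stalkSpecializes h z) = P.stalkToField x z := by
  obtain ⟨U, hx, s, rfl⟩ := P.toricVariety.presheaf.exists_germ_eq z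
  obtain ⟨V, hxV, -, i, a, ha, b, hb, H⟩ := P.exists_stalkToField_germ U s x hx
  have hy : y ∈ U := h.mem_open U.2 hx
  have hyV : y ∈ V := h.mem_open V.2 hxV
  rw [TopCat.Presheaf.germ_stalkSpecializes_apply]
  have hb0 : P.toField b ≠ 0 := P.toField_ne_zero fun h0 => (H x hx hxV).1 (by
    rw [h0]; exact zero_mem _)
  exact mul_left_cancel₀ hb0 ((H y hy hyV).2.trans (H x hx hxV).2.symm)

lemma stalkToField_awayToSection {k : ℕ} {h : P.SemigroupAlgebra} (hh : h ∈ P.grading k) (i : ℕ)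
    {a : P.SemigroupAlgebra} (ha : a ∈ P.grading (i • k)) (x : P.toricVariety)
    (hx : x ∈ Proj.basicOpen P.grading h) :
    P.toField h ^ i * P.stalkToField x (P.toricVariety.presheaf.germ (Proj.basicOpen P.grading h)
      x hx (Proj.awayToSection P.grading h (HomogeneousLocalization.Away.mk P.grading hh i a ha))) =
    P.toField a := by
  have h1 : P.stalkToField x (P.toricVariety.presheaf.germ (Proj.basicOpen P.grading h)
      x hx (Proj.awayToSection P.grading h (HomogeneousLocalization.Away.mk P.grading hh i a ha))) =
      P.localizationToField x (HomogeneousLocalization.mapId P.grading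
        (Submonoid.powers_le.mpr hx) (HomogeneousLocalization.Away.mk P.grading hh i a ha)) :=
    congrArg (P.localizationToField x) (Proj.stalkIso'_germ P.grading _ x hx _)
  rw [h1, ← map_pow]
  exact P.toField_den_mul_localizationToField x
    ⟨i • k, ⟨a, ha⟩, ⟨h ^ i, SetLike.pow_mem_graded i hh⟩, _⟩

lemma stalkToField_quotSection {g h : P.SemigroupAlgebra} (hg : g ∈ P.grading 1)
    (hh : h ∈ P.grading 1) (x : P.toricVariety) (hx : x ∈ Proj.basicOpen P.grading h) :
    P.toField h * P.stalkToField x (P.toricVariety.presheaf.germ (Proj.basicOpen P.grading h)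
      x hx (quotSection g h hg hh)) = P.toField g := by
  have h1 := P.stalkToField_awayToSection hh 1 (a := g) (by simpa using hg) x hx
  rwa [pow_one] at h1

end LatticePolytope

end

noncomputable section

/-! ### Stalks of ideal sheaves -/

namespace AlgebraicGeometry.Scheme.IdealSheafData

variable {X Y : Scheme.{0}}

lemma stalkIdeal_eq_top_of_notMem_support {J : Y.IdealSheafData} {y : Y} (hy : y ∉ J.support) :
    J.stalkIdeal y = ⊤ := by
  obtain ⟨U, hU, hyU, -⟩ := exists_isAffineOpen_mem_and_subset (X := Y) (x := y) (U := ⊤) trivial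
  rw [mem_support_iff_of_mem (U := ⟨U, hU⟩) hyU, Scheme.mem_zeroLocus_iff] at hy
  push Not at hy
  obtain ⟨f, hf, hfy⟩ := hy
  exact Ideal.eq_top_of_isUnit_mem _ (Ideal.subset_span ⟨⟨U, hU⟩, hyU, f, hf, rfl⟩)
    ((Y.mem_basicOpen f y hyU).mp hfy)

lemma stalkIdeal_le_maximalIdeal {J : Y.IdealSheafData} {y : Y} (hy : y ∈ J.support) :
    J.stalkIdeal y ≤ IsLocalRing.maximalIdeal (Y.presheaf.stalk y) := by
  refine Ideal.span_le.mpr ?_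
  rintro _ ⟨U, hyU, f, hf, rfl⟩
  rw [mem_support_iff_of_mem hyU, Scheme.mem_zeroLocus_iff] at hy
  intro h
  exact hy f hf ((Y.mem_basicOpen f y hyU).mpr h)

lemma stalkIdeal_eq_span_germ {J : Y.IdealSheafData} {U : Y.affineOpens} {t : Γ(Y, U.1)}
    (ht : J.ideal U = Ideal.span {t}) {y : Y} (hy : y ∈ U.1) :
    J.stalkIdeal y = Ideal.span {Y.presheaf.germ U.1 y hy t} := by
  apply le_antisymm
  · refine Ideal.span_le.mpr ?_
    rintro _ ⟨V, hyV, a, ha, rfl⟩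
    obtain ⟨W, hW, hyW, hWUV⟩ := exists_isAffineOpen_mem_and_subset (X := Y) (x := y) (U := U.1 ⊓ V.1)
      ⟨hy, hyV⟩
    have hWU : (⟨W, hW⟩ : Y.affineOpens) ≤ U := fun z hz => (hWUV hz).1
    have hWV : (⟨W, hW⟩ : Y.affineOpens) ≤ V := fun z hz => (hWUV hz).2
    have h1 := J.ideal_le_comap_ideal hWV ha
    rw [Ideal.mem_comap, ← J.map_ideal hWU, ht, Ideal.map_span, Set.image_singleton,
      Ideal.mem_span_singleton] at h1
    obtain ⟨c, hc⟩ := h1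
    rw [SetLike.mem_coe, Ideal.mem_span_singleton]
    refine ⟨Y.presheaf.germ W y hyW c, ?_⟩
    have h2 := congrArg (Y.presheaf.germ W y hyW) hc
    rw [map_mul] at h2
    have h3 : Y.presheaf.germ W y hyW (Y.presheaf.map (homOfLE hWV).op a) =
        Y.presheaf.germ V.1 y hyV a := TopCat.Presheaf.germ_res_apply _ _ _ _ _
    have h4 : Y.presheaf.germ W y hyW (Y.presheaf.map (homOfLE hWU).op t) =
        Y.presheaf.germ U.1 y hy t := TopCat.Presheaf.germ_res_apply _ _ _ _ _
    rw [← h3, ← h4]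
    exact h2
  · rw [Ideal.span_singleton_le_iff_mem]
    exact Ideal.subset_span ⟨U, hy, t, by rw [ht]; exact Ideal.mem_span_singleton_self t, rfl⟩

/-- The pullback of s vanishes on the closed subscheme cut out by the inverse image ideal, by the
adjunction between direct and inverse image of ideal sheaves. -/
lemma stalkMap_mem_stalkIdeal_comap {I : X.IdealSheafData} {π : Y ⟶ X} {U : X.affineOpens}
    {s : Γ(X, U.1)} (hs : s ∈ I.ideal U) {y : Y} (hy : π y ∈ U.1) :
    π.stalkMap y (X.presheaf.germ U.1 (π y) hy s) ∈ (I.comap π).stalkIdeal y := by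
  obtain ⟨W, hW, hyW, hWU⟩ := exists_isAffineOpen_mem_and_subset (X := Y) (x := y) (U := π ⁻¹ᵁ U.1) hy
  have h1 : s ∈ ((I.comap π).map π).ideal U := (le_map_comap I π) U hs
  have h2 : (((I.comap π).subschemeι ≫ π).app U.1) s = 0 := Scheme.Hom.ideal_ker_le _ _ h1
  have hmem : Y.presheaf.map (homOfLE hWU).op (π.app U.1 s) ∈ (I.comap π).ideal ⟨W, hW⟩ := by
    rw [← ker_subschemeι_app, RingHom.mem_ker]
    have h3 : (I.comap π).subschemeι.app (π ⁻¹ᵁ U.1) (π.app U.1 s) = 0 := by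
      rw [Scheme.Hom.comp_app] at h2
      exact h2
    have h4 := CategoryTheory.ConcreteCategory.congr_hom
      ((I.comap π).subschemeι.naturality (homOfLE hWU).op) (π.app U.1 s)
    simp only [CommRingCat.comp_apply] at h4
    refine h4.trans ?_
    rw [h3, map_zero]
  refine Ideal.subset_span ⟨⟨W, hW⟩, hyW, _, hmem, ?_⟩
  rw [Scheme.Hom.germ_stalkMap_apply]
  exact (TopCat.Presheaf.germ_res_apply _ _ _ _ _).symm

lemma isEffectiveCartier_top : (⊤ : Y.IdealSheafData).IsEffectiveCartier := by
  intro y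
  obtain ⟨U, hU, hyU, -⟩ := exists_isAffineOpen_mem_and_subset (X := Y) (x := y) (U := ⊤) trivial
  exact ⟨⟨U, hU⟩, hyU, 1, one_mem _, by rw [Ideal.span_singleton_one]; rfl⟩

end AlgebraicGeometry.Scheme.IdealSheafData

namespace IsBlowup

open AlgebraicGeometry.Scheme.IdealSheafData

variable {B X : Scheme.{0}} {π : B ⟶ X} {I : X.IdealSheafData}

/-- The open complement of the centre of a blowup. -/
abbrev _root_.AlgebraicGeometry.Scheme.IdealSheafData.compl (I : X.IdealSheafData) : X.Opens :=
  ⟨(I.support : Set X)ᶜ, I.support.isClosed.isOpen_compl⟩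

lemma comap_compl_ι : I.comap I.compl.ι = ⊤ := by
  rw [← support_eq_bot_iff, support_comap]
  ext x
  exact iff_of_false (fun h => x.2 h) id

/-- Over the complement the inverse image ideal is the unit ideal, which is Cartier. Existence of
lifts gives an inverse there, and uniqueness shows that it is two-sided. -/
lemma isIso_morphismRestrict (hπ : IsBlowup π I) : IsIso (π ∣_ I.compl) := by
  have hV : (I.comap I.compl.ι).IsEffectiveCartier := by
    rw [comap_compl_ι]
    exact isEffectiveCartier_top
  obtain ⟨s, hs, -⟩ := hπ.existsUnique_lift I.compl.ι hV
  have hrange : Set.range s ⊆ Set.range (π ⁻¹ᵁ I.compl).ι := by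
    rintro _ ⟨x, rfl⟩
    rw [Scheme.Opens.range_ι]
    change π (s x) ∈ I.compl
    rw [← Scheme.Hom.comp_apply, hs]
    exact x.2
  let s' := IsOpenImmersion.lift (π ⁻¹ᵁ I.compl).ι s hrange
  have hs' : s' ≫ (π ⁻¹ᵁ I.compl).ι = s := IsOpenImmersion.lift_fac _ _ _
  refine ⟨s', ?_, ?_⟩
  · rw [← cancel_mono (π ⁻¹ᵁ I.compl).ι, Category.assoc, hs', Category.id_comp]
    have hC : (I.comap ((π ⁻¹ᵁ I.compl).ι ≫ π)).IsEffectiveCartier := by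
      rw [← morphismRestrict_ι, comap_comp, comap_compl_ι, comap_top]
      exact isEffectiveCartier_top
    refine (hπ.existsUnique_lift _ hC).unique ?_ rfl
    rw [Category.assoc, hs, morphismRestrict_ι]
  · rw [← cancel_mono I.compl.ι, Category.assoc, morphismRestrict_ι, reassoc_of% hs', hs,
      Category.id_comp]

lemma isIso_stalkMap (hπ : IsBlowup π I) {b : B} (hb : π b ∈ I.compl) : IsIso (π.stalkMap b) := by
  have := hπ.isIso_morphismRestrict
  have h1 : IsOpenImmersion ((π ⁻¹ᵁ I.compl).ι ≫ π) := by
    rw [← morphismRestrict_ι]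
    infer_instance
  let y : (π ⁻¹ᵁ I.compl).toScheme := ⟨b, hb⟩
  have h2 : IsIso (((π ⁻¹ᵁ I.compl).ι ≫ π).stalkMap y) := inferInstance
  rw [Scheme.Hom.stalkMap_comp] at h2
  have h3 : IsIso ((π ⁻¹ᵁ I.compl).ι.stalkMap y) :=
    inferInstanceAs (IsIso (Scheme.Hom.stalkMap (X := (π ⁻¹ᵁ I.compl).toScheme) _ _))
  exact @IsIso.of_isIso_comp_right _ _ _ _ _ (π.stalkMap ((π ⁻¹ᵁ I.compl).ι y)) _ h3 h2

lemma exists_map_eq (hπ : IsBlowup π I) {x : X} (hx : x ∈ I.compl) : ∃ b, π b = x := by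
  have := hπ.isIso_morphismRestrict
  let z : I.compl.toScheme := ⟨x, hx⟩
  refine ⟨(π ⁻¹ᵁ I.compl).ι (inv (π ∣_ I.compl) z), ?_⟩
  have h2 : inv (π ∣_ I.compl) ≫ (π ⁻¹ᵁ I.compl).ι ≫ π = I.compl.ι := by
    rw [← morphismRestrict_ι, IsIso.inv_hom_id_assoc]
  have h3 := congrArg (fun f => f z) h2
  simp only [Scheme.Hom.comp_apply] at h3
  exact h3

lemma support_comap_disjoint {U : B.affineOpens} {t : Γ(B, U.1)}
    (ht : (I.comap π).ideal U = Ideal.span {t}) : B.basicOpen t ≤ π ⁻¹ᵁ I.compl := by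
  intro y hy
  by_contra h
  have hyU : y ∈ U.1 := B.basicOpen_le t hy
  have hs : y ∈ (I.comap π).support := by
    rw [support_comap]
    exact not_not.mp h
  have h1 := stalkIdeal_le_maximalIdeal hs
  rw [stalkIdeal_eq_span_germ ht hyU, Ideal.span_singleton_le_iff_mem] at h1
  exact h1 ((B.mem_basicOpen t y hyU).mp hy)

lemma isReduced_of_le [IsReduced X] (hπ : IsBlowup π I) {W : B.Opens}
    (hW : W ≤ π ⁻¹ᵁ I.compl) : _root_.IsReduced Γ(B, W) := by
  have := hπ.isIso_morphismRestrict
  have h1 : IsReduced (π ⁻¹ᵁ I.compl).toScheme :=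
    have : IsReduced I.compl.toScheme := isReduced_of_isOpenImmersion I.compl.ι
    isReduced_of_isOpenImmersion (π ∣_ I.compl)
  have h2 : IsReduced W.toScheme := isReduced_of_isOpenImmersion (B.homOfLE hW)
  exact isReduced_of_injective W.topIso.inv.hom
    W.topIso.commRingCatIsoToRingEquiv.symm.injective

/-- The local equation t of E is a nonzerodivisor, so functions on U embed in functions on D(t),
which lies off E and is isomorphic to an open subscheme of X. -/
lemma isReduced [IsReduced X] (hπ : IsBlowup π I) : IsReduced B := by
  have : ∀ y : B, _root_.IsReduced (B.presheaf.stalk y) := by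
    intro y
    obtain ⟨U, hyU, t, ht, htU⟩ := hπ.isEffectiveCartier y
    have h1 := hπ.isReduced_of_le (support_comap_disjoint htU)
    have := U.2.isLocalization_basicOpen t
    have h2 : _root_.IsReduced Γ(B, U.1) := by
      refine isReduced_of_injective (algebraMap Γ(B, U.1) Γ(B, B.basicOpen t)) ?_
      exact IsLocalization.injective _ (Submonoid.powers_le.mpr ht)
    have := U.2.isLocalization_stalk ⟨y, hyU⟩
    let := TopCat.Presheaf.algebra_section_stalk B.presheaf (⟨y, hyU⟩ : U.1)
    exact isReduced_localizationPreserves (U.2.primeIdealOf ⟨y, hyU⟩).asIdeal.primeCompl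
      (B.presheaf.stalk y) h2
  exact isReduced_of_isReduced_stalk B

lemma isIntegral [IsIntegral X] (hπ : IsBlowup π I) (hI : (I.compl : Set X).Nonempty) :
    IsIntegral B := by
  have := hπ.isReduced
  have hiso := hπ.isIso_morphismRestrict
  have hirr : IsIrreducible ((π ⁻¹ᵁ I.compl : B.Opens) : Set B) := by
    have : Nonempty I.compl := hI.to_subtype
    have h1 : IsIntegral I.compl.toScheme := inferInstance
    have h2 : IsIrreducible (Set.univ : Set I.compl.toScheme) :=
      IrreducibleSpace.isIrreducible_univ _
    have h3 := h2.image (inv (π ∣_ I.compl) ≫ (π ⁻¹ᵁ I.compl).ι)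
      (inv (π ∣_ I.compl) ≫ (π ⁻¹ᵁ I.compl).ι).continuous.continuousOn
    convert h3
    ext y
    rw [Set.image_univ, Set.mem_range]
    constructor
    · intro hy
      let z : (π ⁻¹ᵁ I.compl).toScheme := ⟨y, hy⟩
      refine ⟨(π ∣_ I.compl) z, ?_⟩
      rw [← Scheme.Hom.comp_apply, IsIso.hom_inv_id_assoc]
      rfl
    · rintro ⟨x, rfl⟩
      rw [Scheme.Hom.comp_apply]
      exact (inv (π ∣_ I.compl) x).2
  -- If a neighbourhood of y missed the complement of E, a function f with y ∈ D(f) inside it would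
  -- satisfy D(ft) = ∅. Then ft = 0 as B is reduced, and f = 0 as t is a nonzerodivisor.
  have hdense : closure ((π ⁻¹ᵁ I.compl : B.Opens) : Set B) = Set.univ := by
    refine Set.eq_univ_of_forall fun y => mem_closure_iff.mpr fun O hO hyO => ?_
    by_contra hempty
    obtain ⟨U, hyU, t, ht, htU⟩ := hπ.isEffectiveCartier y
    obtain ⟨f, hfO, hfy⟩ := U.2.exists_basicOpen_le (V := ⟨O, hO⟩) ⟨y, hyO⟩ hyU
    have h0 : B.basicOpen (f * t) = ⊥ := by
      rw [Scheme.basicOpen_mul]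
      refine eq_bot_iff.mpr fun z hz => hempty ⟨z, hfO hz.1, ?_⟩
      exact support_comap_disjoint htU hz.2
    have h1 := eq_zero_of_basicOpen_eq_bot _ h0
    have h2 : f = 0 := (mem_nonZeroDivisors_iff.mp ht).2 f h1
    rw [h2, Scheme.basicOpen_zero] at hfy
    exact hfy
  have : IrreducibleSpace B := by
    rw [irreducibleSpace_def, Set.top_eq_univ, ← hdense]
    exact hirr.closure
  exact isIntegral_of_irreducibleSpace_of_isReduced B

end IsBlowup

end

/-! ### Integrality of the toric variety and the ideal of its identity point -/

noncomputable section

lemma AlgebraicGeometry.Scheme.IdealSheafData.mem_ideal_vanishingIdeal {X : Scheme.{0}}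
    {Z : TopologicalSpace.Closeds X} {U : X.affineOpens} {s : Γ(X, U.1)}
    (h : ∀ x ∈ Z, x ∈ U.1 → x ∉ X.basicOpen s) :
    s ∈ (Scheme.IdealSheafData.vanishingIdeal Z).ideal U := by
  rw [Scheme.IdealSheafData.vanishingIdeal_ideal, PrimeSpectrum.mem_vanishingIdeal]
  intro p hp
  by_contra hsp
  have h1 : p ∈ U.2.fromSpec ⁻¹ᵁ X.basicOpen s := by
    rw [U.2.fromSpec_preimage_basicOpen]
    exact hsp
  refine h (U.2.fromSpec p) hp ?_ h1
  rw [← SetLike.mem_coe, ← U.2.range_fromSpec]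
  exact ⟨p, rfl⟩

lemma AlgebraicGeometry.Scheme.topIso_inv_comp_isoOfEq_inv_appTop (X : Scheme.{0}) {U : X.Opens}
    (e : U = ⊤) : U.topIso.inv ≫ (X.topIso.inv ≫ (X.isoOfEq e).inv).appTop =
      X.presheaf.map (eqToHom e.symm).op := by
  subst e
  have h : X.topIso.inv ≫ Scheme.Opens.ι ⊤ = 𝟙 X := X.toIso_inv_ι
  have h2 := Scheme.Hom.congr_app h ⊤
  simp at h2 ⊢
  exact h2.trans (X.presheaf.map_id _)

namespace LatticePolytope

variable {n : ℕ} (P : LatticePolytope n)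

/-- An inverse is itself a fraction with nonvanishing denominator, so primality of the point forces
the numerator not to vanish. -/
lemma isUnit_stalk_iff {x : P.toricVariety} {z : P.toricVariety.presheaf.stalk x} {i : ℕ}
    {a b : P.SemigroupAlgebra} (ha : a ∈ P.grading i) (hb : b ∈ P.grading i)
    (hbx : b ∉ (P.specPoint x).asHomogeneousIdeal)
    (h : P.toField b * P.stalkToField x z = P.toField a) :
    IsUnit z ↔ a ∉ (P.specPoint x).asHomogeneousIdeal := by
  have hb0 : P.toField b ≠ 0 := P.toField_ne_zero fun h0 => hbx (by rw [h0]; exact zero_mem _)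
  constructor
  · intro hz hax
    obtain ⟨w, hw⟩ := hz.exists_right_inv
    obtain ⟨k, s, hs, hsx, c, hc, hsc⟩ := P.exists_eq_stalkToField x w
    have h1 : P.toField (a * c) = P.toField (b * s) := by
      rw [map_mul, map_mul, ← h, ← hsc]
      have h2 := congrArg (P.stalkToField x) hw
      rw [map_mul, map_one] at h2
      linear_combination (P.toField b * P.toField s) * h2
    have h2 := P.toField_injective h1
    have h3 : b * s ∈ (P.specPoint x).asHomogeneousIdeal.toIdeal := by
      rw [← h2]
      exact Ideal.mul_mem_right _ _ hax
    rcases (P.specPoint x).isPrime.mem_or_mem h3 with h4 | h4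
    · exact hbx h4
    · exact hsx h4
  · intro hax
    obtain ⟨w, hw⟩ := P.mem_range_stalkToField x hb ha hax
    have ha0 : P.toField a ≠ 0 := P.toField_ne_zero fun h0 => hax (by rw [h0]; exact zero_mem _)
    refine IsUnit.of_mul_eq_one w (P.stalkToField_injective x ?_)
    rw [map_mul, map_one]
    refine mul_left_cancel₀ (mul_ne_zero ha0 hb0) ?_
    linear_combination (P.toField a * P.stalkToField x w) * h + P.toField a * hw

lemma specializes_iff {x y : P.toricVariety} :
    x ⤳ y ↔ (P.specPoint x).asHomogeneousIdeal ≤ (P.specPoint y).asHomogeneousIdeal := by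
  rw [specializes_iff_mem_closure]
  exact (ProjectiveSpectrum.le_iff_mem_closure P.grading (P.specPoint x) (P.specPoint y)).symm

lemma zeroPoint_mem {U : P.toricVariety.Opens} {x : P.toricVariety} (hx : x ∈ U) :
    (P.zeroPoint : P.toricVariety) ∈ U := by
  refine Specializes.mem_open (P.specializes_iff.mpr ?_) U.2 hx
  intro a ha
  have : a = 0 := ha
  rw [this]
  exact zero_mem _

instance : IsIntegral P.toricVariety := by
  have h1 : ∀ x : P.toricVariety, _root_.IsReduced (P.toricVariety.presheaf.stalk x) := fun x =>
    isReduced_of_injective (P.stalkToField x) (P.stalkToField_injective x)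
  have h2 : IsReduced P.toricVariety := isReduced_of_isReduced_stalk _
  have h3 : IrreducibleSpace P.toricVariety := by
    have h4 : closure {(P.zeroPoint : P.toricVariety)} = Set.univ := by
      refine Set.eq_univ_of_forall fun x => mem_closure_iff.mpr fun O hO hx => ?_
      exact ⟨P.zeroPoint, P.zeroPoint_mem (U := ⟨O, hO⟩) hx, rfl⟩
    rw [irreducibleSpace_def, Set.top_eq_univ]
    exact h4 ▸ isIrreducible_singleton.closure
  exact isIntegral_of_irreducibleSpace_of_isReduced _

lemma mem_support_identityIdealSheaf {x : P.toricVariety} :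
    x ∈ P.identityIdealSheaf.support ↔
      P.identityIdeal ≤ (P.specPoint x).asHomogeneousIdeal := by
  rw [← SetLike.mem_coe, identityIdealSheaf, Scheme.IdealSheafData.coe_support_vanishingIdeal]
  exact specializes_iff_mem_closure.symm.trans P.specializes_iff

lemma mem_identityIdeal {f : P.SemigroupAlgebra} : f ∈ P.identityIdeal ↔ P.evalOne f = 0 :=
  Iff.rfl

lemma monomial_sub_mem_identityIdeal {m : ℕ} {u v : Fin n → ℤ} (hu : u ∈ P.latticePoints m)
    (hv : v ∈ P.latticePoints m) : P.monomial hu - P.monomial hv ∈ P.identityIdeal := by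
  rw [mem_identityIdeal, map_sub, monomial, monomial, evalOne_single, evalOne_single, sub_eq_zero]
  rfl

lemma exists_sub_smul_monomial_mem {m : ℕ} {v : Fin n → ℤ} (hv : v ∈ P.latticePoints m)
    {f : P.SemigroupAlgebra} (hf : f ∈ P.grading m) :
    ∃ c : ℂ, f - c • P.monomial hv ∈ P.identityIdeal := by
  refine P.grading_induction (M := fun f => ∃ c : ℂ, f - c • P.monomial hv ∈ P.identityIdeal)
    ⟨0, by simp⟩ ?_ (fun u hu c => ⟨c, ?_⟩) hf
  · rintro f g ⟨c, hc⟩ ⟨d, hd⟩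
    refine ⟨c + d, ?_⟩
    convert add_mem hc hd using 1
    rw [add_smul]
    abel
  · have h1 : c • (P.monomial hu - P.monomial hv) ∈ P.identityIdeal := by
      rw [mem_identityIdeal, map_smul, P.mem_identityIdeal.mp
        (P.monomial_sub_mem_identityIdeal hu hv), smul_zero]
    convert h1 using 1
    rw [smul_sub]
    congr 1
    rw [monomial, AddMonoidAlgebra.smul_single, smul_eq_mul, mul_one]

lemma exists_monomial_pow {u : Fin n → ℤ} (hu : u ∈ P.latticePoints 1) (k : ℕ) :
    ∃ (w : Fin n → ℤ) (hw : w ∈ P.latticePoints k), P.monomial hu ^ k = P.monomial hw := by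
  have h : ((k • (⟨(u, 1), hu⟩ : P.semigroup) : P.semigroup) : (Fin n → ℤ) × ℕ) = (k • u, k) := by
    simp
  have hw : k • u ∈ P.latticePoints k := by
    have h1 := (k • (⟨(u, 1), hu⟩ : P.semigroup)).2
    rwa [h] at h1
  refine ⟨k • u, hw, ?_⟩
  rw [monomial, monomial, AddMonoidAlgebra.single_pow, one_pow]
  congr 1
  exact Subtype.ext h

/-- No monomial vanishes at a specialization of the identity point. -/
lemma monomial_notMem_of_identityIdeal_le {x : ProjectiveSpectrum P.grading}
    (hx : P.identityIdeal ≤ x.asHomogeneousIdeal) {m : ℕ} {v : Fin n → ℤ}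
    (hv : v ∈ P.latticePoints m) : P.monomial hv ∉ x.asHomogeneousIdeal := by
  intro hvx
  -- Modulo the identity ideal each graded piece is spanned by any one of its monomials. So one
  -- vanishing monomial kills its whole degree, then a degree one monomial, then every positive
  -- degree, contradicting relevance.
  have hle : ∀ {k : ℕ} {f : P.SemigroupAlgebra} {w} (hw : w ∈ P.latticePoints k),
      f ∈ P.grading k → P.monomial hw ∈ x.asHomogeneousIdeal → f ∈ x.asHomogeneousIdeal := by
    intro k f w hw hf hwx
    obtain ⟨c, hc⟩ := P.exists_sub_smul_monomial_mem hw hf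
    have h1 : c • P.monomial hw ∈ x.asHomogeneousIdeal.toIdeal := by
      rw [Algebra.smul_def]
      exact Ideal.mul_mem_left _ _ hwx
    have h2 := add_mem (hx hc) (show c • P.monomial hw ∈ x.asHomogeneousIdeal from h1)
    rwa [sub_add_cancel] at h2
  obtain ⟨u, hu⟩ := P.exists_mem_latticePoints_one
  have hux : P.monomial hu ∈ x.asHomogeneousIdeal.toIdeal :=
    x.isPrime.mem_of_pow_mem m (by
      obtain ⟨w, hw, hpow⟩ := P.exists_monomial_pow hu m
      rw [hpow]
      exact hle hv (P.monomial_mem hw) hvx)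
  refine x.not_irrelevant_le fun z hz => ?_
  rw [← DirectSum.sum_support_decompose P.grading z]
  refine x.asHomogeneousIdeal.toIdeal.sum_mem fun k hk => ?_
  rcases Nat.eq_zero_or_pos k with rfl | hk0
  · rw [HomogeneousIdeal.mem_irrelevant_iff, GradedRing.proj_apply] at hz
    rw [hz]
    exact zero_mem _
  · obtain ⟨w, hw, hpow⟩ := P.exists_monomial_pow hu k
    refine hle hw (SetLike.coe_mem _) ?_
    rw [← hpow]
    exact Ideal.pow_mem_of_mem _ hux k hk0

lemma awayToSection_mem_identityIdealSheaf {k : ℕ} (hk : 0 < k) {y h : P.SemigroupAlgebra}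
    (hh : h ∈ P.grading k) (hy : y ∈ P.grading k) (hy0 : y ∈ P.identityIdeal) :
    Proj.awayToSection P.grading h
      (HomogeneousLocalization.Away.mk P.grading hh 1 y (by simpa using hy)) ∈
      P.identityIdealSheaf.ideal ⟨Proj.basicOpen P.grading h,
        Proj.isAffineOpen_basicOpen P.grading h hh hk⟩ := by
  refine Scheme.IdealSheafData.mem_ideal_vanishingIdeal fun x hx hxh hxy => ?_
  have hle : P.identityIdeal ≤ (P.specPoint x).asHomogeneousIdeal := P.specializes_iff.mp
    (specializes_iff_mem_closure.mpr hx)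
  have h1 := P.stalkToField_awayToSection hh 1 (a := y) (by simpa using hy) x hxh
  rw [pow_one] at h1
  exact (P.isUnit_stalk_iff hy hh hxh h1).mp
    ((P.toricVariety.mem_basicOpen _ x hxh).mp hxy) (hle hy0)

/-- Unfolds the structure map to Spec (A_P)₀ on global functions, to check that the constants used
in the ℂ-structure of the function field are the usual ones. -/
lemma toSpecZero_appTop :
    (Scheme.ΓSpecIso (.of (P.grading 0))).inv ≫ (Proj.toSpecZero P.grading).appTop =
    CommRingCat.ofHom (HomogeneousLocalization.fromZeroRingHom P.grading (Submonoid.powers 1)) ≫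
      Proj.awayToSection P.grading 1 ≫
        (Proj P.grading).presheaf.map (eqToHom (Proj.basicOpen_one P.grading).symm).op := by
  rw [← Scheme.topIso_inv_comp_isoOfEq_inv_appTop _ (Proj.basicOpen_one P.grading),
    Iso.inv_comp_eq]
  have h : Proj.toSpecZero P.grading =
      ((Scheme.topIso _).inv ≫ (Scheme.isoOfEq _ (Proj.basicOpen_one P.grading)).inv) ≫
      Proj.basicOpenToSpec P.grading 1 ≫ Spec.map (CommRingCat.ofHom
        (HomogeneousLocalization.fromZeroRingHom P.grading _)) := by
    simp [Proj.toSpecZero]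
  have h2 : (Proj.basicOpenToSpec P.grading 1).appTop = _ :=
    Proj.basicOpenToSpec_app_top P.grading 1
  have h3 := Scheme.ΓSpecIso_naturality (CommRingCat.ofHom
    (HomogeneousLocalization.fromZeroRingHom P.grading (Submonoid.powers 1)))
  rw [h, Scheme.Hom.comp_appTop, Scheme.Hom.comp_appTop, h2]
  simp only [Category.assoc]
  rw [reassoc_of% h3]

lemma stalkToField_toSpecZero (x : P.toricVariety) (c : ℂ) :
    P.stalkToField x (P.toricVariety.presheaf.germ ⊤ x trivial
      (((Scheme.ΓSpecIso (.of (P.grading 0))).inv ≫ (Proj.toSpecZero P.grading).appTop)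
        (algebraMap ℂ (P.grading 0) c))) = algebraMap ℂ (LaurentField n) c := by
  have h1 : (1 : P.SemigroupAlgebra) ∈ P.grading 0 := SetLike.GradedOne.one_mem
  have hx : x ∈ Proj.basicOpen P.grading 1 := by
    rw [Proj.basicOpen_one]
    trivial
  have h2 := P.stalkToField_awayToSection h1 0 (a := algebraMap ℂ P.SemigroupAlgebra c)
    (algebraMap ℂ (P.grading 0) c).2 x hx
  rw [pow_zero, one_mul, AlgHom.commutes] at h2
  rw [toSpecZero_appTop, ← h2]
  congr 1
  refine (TopCat.Presheaf.germ_res_apply _ _ _ _ _).trans ?_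
  congr 2

end LatticePolytope

end

noncomputable section

/-! ### The function field of the blowup inside the field of Laurent fractions -/

namespace LatticePolytope

variable {n : ℕ} {P : LatticePolytope n} {B : Scheme.{0}} {π : B ⟶ P.toricVariety}

lemma exists_ne_of_two_le_dim (hP : 2 ≤ P.dim) :
    ∃ v ∈ P.latticePoints 1, ∃ w ∈ P.latticePoints 1, v ≠ w := by
  obtain ⟨v, hv, w, hw, -, -, hwv, -⟩ := P.exists_independent hP
  exact ⟨w, hw, v, hv, hwv⟩

lemma monomial_injective {m : ℕ} {u v : Fin n → ℤ} (hu : u ∈ P.latticePoints m)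
    (hv : v ∈ P.latticePoints m) (h : P.monomial hu = P.monomial hv) : u = v := by
  have h1 := AddMonoidAlgebra.single_left_injective (one_ne_zero (α := ℂ)) h
  exact congrArg (fun p : P.semigroup => p.1.1) h1

lemma zeroPoint_mem_compl (hP : 2 ≤ P.dim) :
    (P.zeroPoint : P.toricVariety) ∈ P.identityIdealSheaf.compl := by
  obtain ⟨v, hv, w, hw, hvw⟩ := exists_ne_of_two_le_dim hP
  intro h
  have h1 := P.mem_support_identityIdealSheaf.mp h (P.monomial_sub_mem_identityIdeal hv hw)
  have h2 : P.monomial hv - P.monomial hw = 0 := h1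
  exact hvw (monomial_injective hv hw (sub_eq_zero.mp h2))

lemma isIntegral_of_isBlowup (hP : 2 ≤ P.dim) (hπ : IsBlowup π P.identityIdealSheaf) :
    IsIntegral B :=
  hπ.isIntegral ⟨_, zeroPoint_mem_compl hP⟩

variable [IsIntegral B]

/-- The generic point of X_P lies off the centre, so it has a preimage in B, and the generic point
of B specializes to that preimage. -/
lemma map_genericPoint_specializes (hP : 2 ≤ P.dim) (hπ : IsBlowup π P.identityIdealSheaf) :
    π (genericPoint B) ⤳ (P.zeroPoint : P.toricVariety) := by
  obtain ⟨b, h1⟩ := hπ.exists_map_eq (zeroPoint_mem_compl hP)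
  rw [← h1]
  exact ((genericPoint_spec B).specializes trivial).map π.continuous

lemma map_genericPoint_mem_compl (hP : 2 ≤ P.dim) (hπ : IsBlowup π P.identityIdealSheaf) :
    π (genericPoint B) ∈ P.identityIdealSheaf.compl :=
  (map_genericPoint_specializes hP hπ).mem_open (P.identityIdealSheaf.compl).2
    (zeroPoint_mem_compl hP)

lemma notMem_map_genericPoint (hP : 2 ≤ P.dim) (hπ : IsBlowup π P.identityIdealSheaf)
    {f : P.SemigroupAlgebra} (hf : f ≠ 0) :
    f ∉ (P.specPoint (π (genericPoint B))).asHomogeneousIdeal :=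
  fun h => hf (P.specializes_iff.mp (map_genericPoint_specializes hP hπ) h)

/-- The embedding of the function field of the blowup in the field of Laurent fractions. -/
def toLaurentField (hP : 2 ≤ P.dim) (hπ : IsBlowup π P.identityIdealSheaf) :
    RatFun π →+* LaurentField n :=
  haveI := hπ.isIso_stalkMap (map_genericPoint_mem_compl hP hπ)
  (P.stalkToField (π (genericPoint B))).comp (inv (π.stalkMap (genericPoint B))).hom

variable (hP : 2 ≤ P.dim) (hπ : IsBlowup π P.identityIdealSheaf)

lemma toLaurentField_injective : Function.Injective (toLaurentField hP hπ) :=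
  (toLaurentField hP hπ).injective

lemma toLaurentField_stalkMap_genericPoint
    (z : P.toricVariety.presheaf.stalk (π (genericPoint B))) :
    toLaurentField hP hπ (π.stalkMap (genericPoint B) z) =
      P.stalkToField (π (genericPoint B)) z := by
  have := hπ.isIso_stalkMap (map_genericPoint_mem_compl hP hπ)
  have h : (inv (π.stalkMap (genericPoint B))) (π.stalkMap (genericPoint B) z) = z := by
    rw [← CommRingCat.comp_apply, IsIso.hom_inv_id]
    rfl
  exact congrArg (P.stalkToField (π (genericPoint B))) h

lemma toLaurentField_ofStalk (b : B) (z : P.toricVariety.presheaf.stalk (π b)) :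
    toLaurentField hP hπ (ofStalk π b (π.stalkMap b z)) = P.stalkToField (π b) z := by
  have hs : genericPoint B ⤳ b := (genericPoint_spec B).specializes trivial
  have h := Scheme.Hom.stalkSpecializes_stalkMap_apply π _ _ hs z
  have h1 : ofStalk π b (π.stalkMap b z) =
      B.presheaf.stalkSpecializes hs (π.stalkMap b z) := rfl
  rw [h1, ← h, ← P.stalkToField_stalkSpecializes (hs.map π.continuous) z]
  exact toLaurentField_stalkMap_genericPoint hP hπ _

lemma exists_toLaurentField_eq {i : ℕ} {a s : P.SemigroupAlgebra} (ha : a ∈ P.grading i)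
    (hs : s ∈ P.grading i) (hs0 : s ≠ 0) :
    ∃ q : RatFun π, P.toField s * toLaurentField hP hπ q = P.toField a := by
  obtain ⟨z, hz⟩ := P.mem_range_stalkToField (π (genericPoint B)) ha hs
    (notMem_map_genericPoint hP hπ hs0)
  exact ⟨π.stalkMap (genericPoint B) z, by rw [toLaurentField_stalkMap_genericPoint, hz]⟩

/-- The local ring of the blowup at a point as a `ℂ`-algebra. -/
abbrev stalkAlgebra (π : B ⟶ P.toricVariety) (b : B) : Algebra ℂ (B.presheaf.stalk b) :=
  ((B.presheaf.germ ⊤ b trivial).hom.comp (constSection π)).toAlgebra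

lemma toLaurentField_ofStalk_algebraMap (b : B) (c : ℂ) :
    toLaurentField hP hπ (ofStalk π b
      (B.presheaf.germ ⊤ b trivial (constSection π c))) = algebraMap ℂ (LaurentField n) c := by
  have h2 : B.presheaf.germ ⊤ b trivial (constSection π c) =
      π.stalkMap b (P.toricVariety.presheaf.germ ⊤ _ trivial
        (((Scheme.ΓSpecIso (.of (P.grading 0))).inv ≫ (Proj.toSpecZero P.grading).appTop)
          (algebraMap ℂ (P.grading 0) c))) := by
    exact (Scheme.Hom.germ_stalkMap_apply π ⊤ b trivial _).symm
  rw [h2, toLaurentField_ofStalk]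
  exact P.stalkToField_toSpecZero _ c

lemma toLaurentField_algebraMap (c : ℂ) :
    toLaurentField hP hπ (algebraMap ℂ (RatFun π) c) = algebraMap ℂ (LaurentField n) c :=
  toLaurentField_ofStalk_algebraMap hP hπ (genericPoint B) c

lemma ofStalk_injective (b : B) : Function.Injective (ofStalk π b) :=
  IsFractionRing.injective (B.presheaf.stalk b) B.functionField

lemma isLocalEquationH_iff {g : P.grading 1} {b : B} {a : (RatFun π)ˣ} :
    IsLocalEquationH π g b a ↔ ∃ h ∈ P.grading 1, h ∉ (P.specPoint (π b)).asHomogeneousIdeal ∧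
      P.toField h * toLaurentField hP hπ a = P.toField g := by
  have key : ∀ (h : P.grading 1) (hb : b ∈ π ⁻¹ᵁ (Proj.basicOpen P.grading
      (h : P.SemigroupAlgebra))), P.toField h * toLaurentField hP hπ (ofStalk π b
        (B.presheaf.germ _ b hb (π.app (Proj.basicOpen P.grading (h : P.SemigroupAlgebra))
        (quotSection (g : P.SemigroupAlgebra) h g.2 h.2)))) = P.toField g := by
    intro h hb
    have h1 := Scheme.Hom.germ_stalkMap_apply π
      (Proj.basicOpen P.grading (h : P.SemigroupAlgebra)) b hb
      (quotSection (g : P.SemigroupAlgebra) h g.2 h.2)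
    refine (congrArg (fun z => P.toField h * toLaurentField hP hπ (ofStalk π b z)) h1.symm).trans ?_
    dsimp only
    rw [toLaurentField_ofStalk]
    exact P.stalkToField_quotSection g.2 h.2 (π b) hb
  constructor
  · rintro ⟨h, hb, hba⟩
    exact ⟨h, h.2, hb, by rw [← hba]; exact key h hb⟩
  · rintro ⟨h, hh, hb, hba⟩
    refine ⟨⟨h, hh⟩, hb, toLaurentField_injective hP hπ ?_⟩
    have h0 : P.toField h ≠ 0 := P.toField_ne_zero fun h0 => hb (by rw [h0]; exact zero_mem _)
    exact mul_left_cancel₀ h0 ((key ⟨h, hh⟩ hb).trans hba.symm)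

end LatticePolytope

end

noncomputable section

/-! ### The exponential arc through the identity point -/

namespace LatticePolytope

variable {n : ℕ} (P : LatticePolytope n)

/-- A morphism from a local spectrum through the chart D₊(h) acts on germs of functions of the chart
by its ring map ψ. This makes the arc computable on stalks. -/
lemma stalkClosedPointTo_germ_awayToSection {k : ℕ} {h : P.SemigroupAlgebra}
    (hh : h ∈ P.grading k) (hk : 0 < k) {T : CommRingCat.{0}} [IsLocalRing T]
    (ψ : CommRingCat.of (HomogeneousLocalization.Away P.grading h) ⟶ T)
    {q : Spec T ⟶ P.toricVariety} (hq : q = Spec.map ψ ≫ Proj.awayι P.grading h hh hk)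
    (hU : q (IsLocalRing.closedPoint T) ∈ Proj.basicOpen P.grading h)
    (z : HomogeneousLocalization.Away P.grading h) :
    Scheme.stalkClosedPointTo q (P.toricVariety.presheaf.germ (Proj.basicOpen P.grading h) _ hU
      (Proj.awayToSection P.grading h z)) = ψ z := by
  subst hq
  let w := Spec.map ψ ≫ (Proj.basicOpenIsoSpec P.grading h hh hk).inv
  have hw : w ≫ Proj.basicOpenToSpec P.grading h = Spec.map ψ := by
    rw [← Proj.basicOpenIsoSpec_hom P.grading h hh hk, Category.assoc, Iso.inv_hom_id, Category.comp_id]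
  have h1 := congrArg Scheme.Hom.appTop hw
  have h2 : (Proj.basicOpenToSpec P.grading h).appTop = _ :=
    Proj.basicOpenToSpec_app_top P.grading h
  rw [Scheme.Hom.comp_appTop, h2] at h1
  have h3 := Scheme.ΓSpecIso_inv_naturality ψ
  rw [← h1] at h3
  simp only [Category.assoc, Iso.inv_hom_id_assoc] at h3
  have h4 := Scheme.germ_stalkClosedPointTo (Spec.map ψ ≫ Proj.awayι P.grading h hh hk) _ hU
  have h5 := ConcreteCategory.congr_hom h4 (Proj.awayToSection P.grading h z)
  refine h5.trans ?_
  have h6 := ConcreteCategory.congr_hom h3 z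
  have h7 : (Spec.map ψ ≫ Proj.awayι P.grading h hh hk).app (Proj.basicOpen P.grading h) ≫
      (Spec T).presheaf.map
        (eqToIso (Scheme.preimage_eq_top_of_closedPoint_mem _ hU).symm).op.hom =
      (Proj.basicOpen P.grading h).topIso.inv ≫ Scheme.Hom.appTop w := by
    have e1 : (Proj.basicOpen P.grading h).topIso.inv =
        (Proj.basicOpen P.grading h).ι.appLE (Proj.basicOpen P.grading h) ⊤
          (Proj.basicOpen P.grading h).ι_preimage_self.ge := by
      rw [Scheme.Opens.ι_appLE, Scheme.Opens.topIso_inv]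
      rfl
    have e2 : w.appTop = w.appLE ⊤ ⊤ le_top := by
      rw [Scheme.Hom.appTop, Scheme.Hom.app_eq_appLE]
      rfl
    rw [e1, e2]
    exact (Scheme.Hom.appLE_comp_appLE w (Proj.basicOpen P.grading h).ι _ _ _ _ _).symm
  have h8 := ConcreteCategory.congr_hom h7 (Proj.awayToSection P.grading h z)
  have h9 := congrArg (Scheme.ΓSpecIso T).hom (h8.trans h6.symm)
  refine Eq.trans ?_ (h9.trans ?_)
  · rfl
  · rw [CommRingCat.comp_apply, ← CommRingCat.comp_apply, Iso.inv_hom_id]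
    rfl

/-- The coordinate ring of the arc: power series over the field of rational functions. -/
abbrev ArcRing (n : ℕ) : Type := PowerSeries (FractionRing (MvPolynomial (Fin n) ℂ))

/-- The exponential map with values in power series over a field. -/
def arcHom : P.SemigroupAlgebra →+* ArcRing n :=
  (PowerSeries.map (algebraMap (MvPolynomial (Fin n) ℂ)
    (FractionRing (MvPolynomial (Fin n) ℂ)))).comp (P.expHom : P.SemigroupAlgebra →+* _)

lemma coeff_arcHom (k : ℕ) (f : P.SemigroupAlgebra) :
    PowerSeries.coeff k (P.arcHom f) = algebraMap (MvPolynomial (Fin n) ℂ)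
      (FractionRing (MvPolynomial (Fin n) ℂ)) (PowerSeries.coeff k (P.expHom f)) := by
  rw [arcHom, RingHom.comp_apply, PowerSeries.coeff_map]
  rfl

lemma X_pow_dvd_arcHom_iff {d : ℕ} {f : P.SemigroupAlgebra} :
    PowerSeries.X ^ d ∣ P.arcHom f ↔ PowerSeries.X ^ d ∣ P.expHom f := by
  simp only [PowerSeries.X_pow_dvd_iff, coeff_arcHom, FaithfulSMul.algebraMap_eq_zero_iff]

lemma exists_coeff_zero_expHom_eq {m : ℕ} {f : P.SemigroupAlgebra} (hf : f ∈ P.grading m) :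
    ∃ c : ℂ, P.evalOne f = AddMonoidAlgebra.single m c ∧
      PowerSeries.coeff 0 (P.expHom f) = MvPolynomial.C c := by
  refine P.grading_induction (M := fun f => ∃ c : ℂ, P.evalOne f = AddMonoidAlgebra.single m c ∧
    PowerSeries.coeff 0 (P.expHom f) = MvPolynomial.C c) ⟨0, by simp⟩ ?_ (fun u hu c => ⟨c, ?_, ?_⟩)
    hf
  · rintro f g ⟨c, hc, hc'⟩ ⟨d, hd, hd'⟩
    exact ⟨c + d, by rw [map_add, hc, hd, AddMonoidAlgebra.single_add],
      by rw [map_add, map_add, hc', hd', map_add]⟩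
  · exact P.evalOne_single _ _
  · rw [expHom_single, ExpSum.coeff_zero_expHom, ExpSum.augmentation_single]

lemma isUnit_arcHom_iff {m : ℕ} {f : P.SemigroupAlgebra} (hf : f ∈ P.grading m) :
    IsUnit (P.arcHom f) ↔ f ∉ P.identityIdeal := by
  obtain ⟨c, hc, hc'⟩ := P.exists_coeff_zero_expHom_eq hf
  rw [mem_identityIdeal, hc, PowerSeries.isUnit_iff_constantCoeff,
    ← PowerSeries.coeff_zero_eq_constantCoeff_apply, coeff_arcHom, hc', isUnit_iff_ne_zero, ne_eq,
    FaithfulSMul.algebraMap_eq_zero_iff, AddMonoidAlgebra.single_eq_zero]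
  simp

lemma isUnit_arcHom_monomial {m : ℕ} {v : Fin n → ℤ} (hv : v ∈ P.latticePoints m) :
    IsUnit (P.arcHom (P.monomial hv)) := by
  rw [P.isUnit_arcHom_iff (P.monomial_mem hv), mem_identityIdeal, monomial, evalOne_single]
  exact AddMonoidAlgebra.single_ne_zero.mpr one_ne_zero

/-- The coefficient of s is the linear form of u - v. Hence the arc is not contained in the centre.
-/
lemma arcHom_monomial_sub_ne_zero {m : ℕ} {u v : Fin n → ℤ} (hu : u ∈ P.latticePoints m)
    (hv : v ∈ P.latticePoints m) (huv : u ≠ v) :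
    P.arcHom (P.monomial hu - P.monomial hv) ≠ 0 := by
  intro h
  have h1 := P.coeff_arcHom 1 (P.monomial hu - P.monomial hv)
  rw [h, map_zero, eq_comm, FaithfulSMul.algebraMap_eq_zero_iff, map_sub, map_sub, monomial,
    monomial, expHom_single, expHom_single, ExpSum.coeff_expHom_single,
    ExpSum.coeff_expHom_single, sub_eq_zero] at h1
  exact huv (ExpSum.linForm_injective (by simpa using h1))

/-- The exponential map on the degree zero part of the localization at a monomial. -/
def awayArcHom {v : Fin n → ℤ} (hv : v ∈ P.latticePoints 1) :
    HomogeneousLocalization.Away P.grading (P.monomial hv) →+* ArcRing n :=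
  (IsLocalization.Away.lift (S := Localization.Away (P.monomial hv)) (P.monomial hv)
    (P.isUnit_arcHom_monomial hv)).comp (algebraMap _ _)

lemma awayArcHom_mk {v : Fin n → ℤ} (hv : v ∈ P.latticePoints 1) (i : ℕ)
    {a : P.SemigroupAlgebra} (ha : a ∈ P.grading (i • 1)) :
    P.arcHom (P.monomial hv) ^ i * P.awayArcHom hv
      (HomogeneousLocalization.Away.mk P.grading (P.monomial_mem hv) i a ha) = P.arcHom a := by
  rw [awayArcHom, RingHom.comp_apply, HomogeneousLocalization.algebraMap_apply,
    HomogeneousLocalization.Away.val_mk, Localization.mk_eq_mk', ← map_pow]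
  exact ((IsLocalization.lift_mk'_spec _ _ _ _).mp rfl).symm

/-- The arc `Spec K⟦s⟧ ⟶ X_P` given by the exponential map. -/
def arc {v : Fin n → ℤ} (hv : v ∈ P.latticePoints 1) :
    Spec (.of (ArcRing n)) ⟶ P.toricVariety :=
  Spec.map (CommRingCat.ofHom (P.awayArcHom hv)) ≫
    Proj.awayι P.grading (P.monomial hv) (P.monomial_mem hv) one_pos

lemma arc_apply_mem {v : Fin n → ℤ} (hv : v ∈ P.latticePoints 1) (y) :
    P.arc hv y ∈ Proj.basicOpen P.grading (P.monomial hv) := by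
  rw [← Proj.opensRange_awayι P.grading (P.monomial hv) (P.monomial_mem hv) one_pos]
  exact ⟨Spec.map (CommRingCat.ofHom (P.awayArcHom hv)) y, rfl⟩

/-- Stated for any q equal to the arc because the stalk depends on q; it gets applied to the
composite of a lift with π. -/
lemma stalkClosedPointTo_arc {v : Fin n → ℤ} (hv : v ∈ P.latticePoints 1)
    {q : Spec (.of (ArcRing n)) ⟶ P.toricVariety} (hq : q = P.arc hv) {i : ℕ}
    {a : P.SemigroupAlgebra} (ha : a ∈ P.grading i)
    {x : P.toricVariety.presheaf.stalk (q (IsLocalRing.closedPoint (ArcRing n)))}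
    (hx : P.toField (P.monomial hv) ^ i * P.stalkToField _ x = P.toField a) :
    P.arcHom (P.monomial hv) ^ i * Scheme.stalkClosedPointTo q x = P.arcHom a := by
  have hU : q (IsLocalRing.closedPoint (ArcRing n)) ∈
      Proj.basicOpen P.grading (P.monomial hv) := by
    rw [hq]
    exact P.arc_apply_mem hv _
  have ha' : a ∈ P.grading (i • 1) := by simpa using ha
  have h1 := P.stalkToField_awayToSection (P.monomial_mem hv) i ha' _ hU
  have h2 : x = _ := P.stalkToField_injective _ (mul_left_cancel₀
    (pow_ne_zero i (P.toField_ne_zero (P.monomial_ne_zero hv))) (hx.trans h1.symm))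
  rw [h2, ← P.awayArcHom_mk hv i ha']
  congr 1
  exact P.stalkClosedPointTo_germ_awayToSection (P.monomial_mem hv) one_pos _ hq hU _

end LatticePolytope

end

noncomputable section

/-! ### Lifting the arc to the blowup -/

namespace LatticePolytope

variable {n : ℕ} {P : LatticePolytope n} {B : Scheme.{0}} {π : B ⟶ P.toricVariety}

/-- K⟦s⟧ is a principal ideal domain, so only nonvanishing of the pulled back ideal is at stake; a
binomial of two lattice points witnesses it. -/
lemma comap_arc_isEffectiveCartier (hP : 2 ≤ P.dim) {v : Fin n → ℤ}
    (hv : v ∈ P.latticePoints 1) :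
    (P.identityIdealSheaf.comap (P.arc hv)).IsEffectiveCartier := by
  let J := P.identityIdealSheaf.comap (P.arc hv)
  let U : (Spec (.of (ArcRing n))).affineOpens := ⟨⊤, isAffineOpen_top _⟩
  have e : ArcRing n ≃+* Γ(Spec (.of (ArcRing n)), ⊤) :=
    (Scheme.ΓSpecIso (.of (ArcRing n))).symm.commRingCatIsoToRingEquiv
  have : IsPrincipalIdealRing Γ(Spec (.of (ArcRing n)), ⊤) :=
    IsPrincipalIdealRing.of_surjective e.toRingHom e.surjective
  obtain ⟨t, ht⟩ := (IsPrincipalIdealRing.principal (J.ideal U)).principal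
  have ht' : J.ideal U = Ideal.span {t} := ht
  have : IsDomain Γ(Spec (.of (ArcRing n)), ⊤) :=
    MulEquiv.isDomain (ArcRing n) e.symm.toMulEquiv
  refine fun y => ⟨U, trivial, t, ?_, ht'⟩
  rw [mem_nonZeroDivisors_iff_ne_zero]
  intro ht0
  obtain ⟨w, hw, w', hw', hne⟩ := exists_ne_of_two_le_dim hP
  let x0 := IsLocalRing.closedPoint (ArcRing n)
  have hU := P.arc_apply_mem hv x0
  have ha : P.monomial hw - P.monomial hw' ∈ P.grading 1 :=
    sub_mem (P.monomial_mem hw) (P.monomial_mem hw')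
  have h1 := Scheme.IdealSheafData.stalkMap_mem_stalkIdeal_comap (π := P.arc hv) (y := x0)
    (P.awayToSection_mem_identityIdealSheaf one_pos (P.monomial_mem hv) ha
    (P.monomial_sub_mem_identityIdeal hw hw')) hU
  rw [Scheme.IdealSheafData.stalkIdeal_eq_span_germ (U := U) ht' (y := x0) trivial, ht0, map_zero,
    Ideal.span_singleton_zero, Ideal.mem_bot] at h1
  have h2 := P.stalkToField_awayToSection (P.monomial_mem hv) 1 (a := P.monomial hw - P.monomial hw')
    (by simpa using ha) _ hU
  have h3 := P.stalkClosedPointTo_arc hv rfl ha h2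
  have h4 := congrArg (stalkClosedPointIso (.of (ArcRing n))).hom h1
  rw [map_zero] at h4
  refine P.arcHom_monomial_sub_ne_zero hw hw' hne (h3.symm.trans ?_)
  refine (congrArg (fun z => P.arcHom (P.monomial hv) ^ 1 * z) ?_).trans (mul_zero _)
  exact h4

/-- A homogeneous element of the identity ideal not vanishing at the image of the closed point would
give a unit germ, hence a series with nonzero constant term; but that constant term is the value at
the identity. -/
lemma arc_closedPoint_mem_support {v : Fin n → ℤ} (hv : v ∈ P.latticePoints 1) :
    P.arc hv (IsLocalRing.closedPoint (ArcRing n)) ∈ P.identityIdealSheaf.support := by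
  have hU := P.arc_apply_mem hv (IsLocalRing.closedPoint (ArcRing n))
  rw [mem_support_identityIdealSheaf]
  intro f hf
  rw [← DirectSum.sum_support_decompose P.grading f]
  refine Ideal.sum_mem _ fun i _ => ?_
  have hi : (DirectSum.decompose P.grading f i : P.SemigroupAlgebra) ∈ P.identityIdeal :=
    P.identityIdeal.isHomogeneous i hf
  by_contra hnot
  have hvi : P.monomial hv ^ i ∈ P.grading i := by
    simpa using SetLike.pow_mem_graded i (P.monomial_mem hv)
  have hvi' : P.monomial hv ^ i ∉ (P.specPoint
      (P.arc hv (IsLocalRing.closedPoint (ArcRing n)))).asHomogeneousIdeal.toIdeal :=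
    fun h => hU ((P.specPoint _).isPrime.mem_of_pow_mem i h)
  obtain ⟨z, hz⟩ := P.mem_range_stalkToField _ (SetLike.coe_mem (DirectSum.decompose P.grading f i))
    hvi hvi'
  have h1 := (P.isUnit_stalk_iff (SetLike.coe_mem _) hvi hvi' hz).mpr hnot
  rw [map_pow] at hz
  have h2 := P.stalkClosedPointTo_arc hv rfl (SetLike.coe_mem _) hz
  have h3 := ((P.isUnit_arcHom_monomial hv).pow i).mul
    (h1.map (Scheme.stalkClosedPointTo (P.arc hv)).hom)
  have h4 : IsUnit (P.arcHom (DirectSum.decompose P.grading f i)) := by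
    rw [← h2]
    exact h3
  exact (P.isUnit_arcHom_iff (SetLike.coe_mem _)).mp h4 hi

/-- The arc lifts to the blowup; this gives a local homomorphism out of one of its local rings. -/
lemma exists_isLocalHom_arcRing (hP : 2 ≤ P.dim) (hπ : IsBlowup π P.identityIdealSheaf)
    {v : Fin n → ℤ} (hv : v ∈ P.latticePoints 1) :
    ∃ (b : B) (θ : B.presheaf.stalk b →+* ArcRing n), IsLocalHom θ ∧
      π b ∈ P.identityIdealSheaf.support ∧
      P.monomial hv ∉ (P.specPoint (π b)).asHomogeneousIdeal ∧
      ∀ (i : ℕ) (a : P.SemigroupAlgebra) (x : P.toricVariety.presheaf.stalk (π b)),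
        a ∈ P.grading i → P.toField (P.monomial hv) ^ i * P.stalkToField _ x = P.toField a →
        P.arcHom (P.monomial hv) ^ i * θ (π.stalkMap b x) = P.arcHom a := by
  obtain ⟨q, hq, -⟩ := hπ.existsUnique_lift _ (comap_arc_isEffectiveCartier hP hv)
  have h0 : π (q (IsLocalRing.closedPoint (ArcRing n))) =
      P.arc hv (IsLocalRing.closedPoint (ArcRing n)) := by
    rw [← hq]
    rfl
  refine ⟨q (IsLocalRing.closedPoint (ArcRing n)), (Scheme.stalkClosedPointTo q).hom,
    inferInstance, ?_, ?_, fun i a x ha hx => ?_⟩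
  · rw [h0]
    exact arc_closedPoint_mem_support hv
  · rw [h0]
    exact P.arc_apply_mem hv _
  · rw [← P.stalkClosedPointTo_arc hv hq ha hx]
    congr 1
    exact (ConcreteCategory.congr_hom (Scheme.stalkClosedPointTo_comp q π) x).symm

variable [IsIntegral B]

lemma exists_stalkIdeal_eq_span (hπ : IsBlowup π P.identityIdealSheaf) (b : B) :
    ∃ τ : B.presheaf.stalk b, τ ≠ 0 ∧
      (P.identityIdealSheaf.comap π).stalkIdeal b = Ideal.span {τ} := by
  obtain ⟨U, hb, t, ht, htU⟩ := hπ.isEffectiveCartier b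
  have : Nonempty U.1 := ⟨⟨b, hb⟩⟩
  refine ⟨_, ?_, Scheme.IdealSheafData.stalkIdeal_eq_span_germ htU hb⟩
  rw [ne_eq, map_eq_zero_iff _ (germ_injective_of_isIntegral B b hb)]
  exact nonZeroDivisors.ne_zero ht

lemma exists_isLocalEquationE {b : B} {τ : B.presheaf.stalk b} (hτ0 : τ ≠ 0)
    (hτ : (P.identityIdealSheaf.comap π).stalkIdeal b = Ideal.span {τ}) :
    ∃ t : (RatFun π)ˣ, (t : RatFun π) = ofStalk π b τ ∧ IsLocalEquationE π b t := by
  have h : ofStalk π b τ ≠ 0 := (map_ne_zero_iff _ (ofStalk_injective b)).mpr hτ0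
  exact ⟨Units.mk0 _ h, rfl, τ, rfl, hτ⟩

variable (hP : 2 ≤ P.dim) (hπ : IsBlowup π P.identityIdealSheaf)

lemma exists_isLocalEquationH {g : P.grading 1} (hg : g ≠ 0) {b : B} {h : P.SemigroupAlgebra}
    (hh : h ∈ P.grading 1) (hb : h ∉ (P.specPoint (π b)).asHomogeneousIdeal) :
    ∃ a : (RatFun π)ˣ, P.toField h * toLaurentField hP hπ a = P.toField g ∧
      IsLocalEquationH π g b a := by
  have h0 : h ≠ 0 := fun h0 => hb (by rw [h0]; exact zero_mem _)
  obtain ⟨q, hq⟩ := exists_toLaurentField_eq hP hπ g.2 hh h0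
  have hq0 : q ≠ 0 := by
    rintro rfl
    rw [map_zero, mul_zero] at hq
    exact P.toField_ne_zero (fun h1 => hg (Subtype.ext h1)) hq.symm
  exact ⟨Units.mk0 q hq0, hq, (isLocalEquationH_iff hP hπ).mpr ⟨h, hh, hb, hq⟩⟩

/-- At the image b of the closed point under the lifted arc, f / (x^v z)^m = r τ^d with τ a local
equation of E. Pulled back along the arc, τ becomes divisible by s, while x^v z becomes a unit. -/
lemma X_pow_dvd_expHom_of_mem_sections {g : P.grading 1} (hg : g ≠ 0) {m d : ℕ}
    {φ : RatFun π} (hφ : φ ∈ sections π g ((m : ℤ), (d : ℤ))) {f : P.SemigroupAlgebra}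
    (hf : f ∈ P.grading m)
    (hφf : toLaurentField hP hπ φ * P.toField g ^ m = P.toField f) :
    PowerSeries.X ^ d ∣ P.expHom f := by
  obtain ⟨v, hv⟩ := P.exists_mem_latticePoints_one
  obtain ⟨b, θ, hθ, hbZ, hvb, hθπ⟩ := exists_isLocalHom_arcRing hP hπ hv
  obtain ⟨a, haH, ha⟩ := exists_isLocalEquationH hP hπ hg (P.monomial_mem hv) hvb
  obtain ⟨τ, hτ0, hτ⟩ := exists_stalkIdeal_eq_span hπ b
  obtain ⟨t, htτ, ht⟩ := exists_isLocalEquationE hτ0 hτ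
  obtain ⟨r, hr⟩ := hφ b a t ha ht
  have hvm : P.monomial hv ^ m ∈ P.grading m := by
    simpa using SetLike.pow_mem_graded m (P.monomial_mem hv)
  have hvm' : P.monomial hv ^ m ∉ (P.specPoint (π b)).asHomogeneousIdeal.toIdeal :=
    fun h => hvb ((P.specPoint _).isPrime.mem_of_pow_mem m h)
  obtain ⟨x, hx⟩ := P.mem_range_stalkToField (π b) hf hvm hvm'
  rw [map_pow] at hx
  have hv0 : P.toField (P.monomial hv) ≠ 0 := P.toField_ne_zero (P.monomial_ne_zero hv)
  have h1 : ofStalk π b (π.stalkMap b x) = φ * (a : RatFun π) ^ m := by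
    apply toLaurentField_injective hP hπ
    rw [toLaurentField_ofStalk]
    refine mul_left_cancel₀ (pow_ne_zero m hv0) ?_
    rw [hx, ← hφf, map_mul, map_pow, ← haH]
    ring
  have h2 : π.stalkMap b x = r * τ ^ d := by
    apply ofStalk_injective b
    rw [h1, map_mul, hr, map_pow, ← htτ]
    simp only [Units.val_mul, zpow_natCast, Units.val_pow_eq_pow_val, zpow_neg]
    rw [mul_assoc, mul_assoc, ← Units.val_pow_eq_pow_val t, Units.inv_mul, mul_one]
  -- θ is local and b lies on E, so τ is a nonunit and θ τ has zero constant term.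
  have hτX : PowerSeries.X ∣ θ τ := by
    rw [PowerSeries.X_dvd_iff]
    by_contra hne
    have h3 : IsUnit (θ τ) := PowerSeries.isUnit_iff_constantCoeff.mpr (isUnit_iff_ne_zero.mpr hne)
    have h4 : IsUnit τ := isUnit_of_map_unit θ τ h3
    have h5 : b ∈ (P.identityIdealSheaf.comap π).support := by
      rw [Scheme.IdealSheafData.support_comap]
      exact hbZ
    have h6 := Scheme.IdealSheafData.stalkIdeal_le_maximalIdeal h5
    rw [hτ, Ideal.span_singleton_le_iff_mem] at h6
    exact h6 h4
  rw [← X_pow_dvd_arcHom_iff, ← hθπ m f x hf hx, h2, map_mul, map_pow]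
  exact Dvd.dvd.mul_left (Dvd.dvd.mul_left (pow_dvd_pow_of_dvd hτX d) _) _

end LatticePolytope

end

noncomputable section

/-! ### Sections of the line bundles on the blowup -/

namespace LatticePolytope

variable {n : ℕ} {P : LatticePolytope n} {B : Scheme.{0}} {π : B ⟶ P.toricVariety}

lemma mem_compl_of_notMem {x : P.toricVariety} {h : P.SemigroupAlgebra}
    (hI : h ∈ P.identityIdeal) (hx : h ∉ (P.specPoint x).asHomogeneousIdeal) :
    x ∈ P.identityIdealSheaf.compl :=
  fun hmem => hx (P.mem_support_identityIdealSheaf.mp hmem hI)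

variable [IsIntegral B] (hP : 2 ≤ P.dim) (hπ : IsBlowup π P.identityIdealSheaf)

lemma isLocalEquationE_one {b : B} (hb : π b ∈ P.identityIdealSheaf.compl) :
    IsLocalEquationE π b 1 := by
  refine ⟨1, by simp, ?_⟩
  rw [Ideal.span_singleton_one]
  refine Scheme.IdealSheafData.stalkIdeal_eq_top_of_notMem_support fun h => hb ?_
  rw [Scheme.IdealSheafData.support_comap] at h
  exact h

/-- For h a difference of two monomials, D₊(h) misses e, so π is an isomorphism over it and E
imposes no condition. There φ (g / h)^m is regular, which supplies the input of the Hartogs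
argument. -/
lemma exists_numerator_eq_zpow {g : P.grading 1} (hg : g ≠ 0) {m d : ℤ} {φ : RatFun π}
    (hφ : φ ∈ sections π g (m, d)) :
    toLaurentField hP hπ φ * P.toField g ^ m = 0 ∨ ∃ k : ℕ, (k : ℤ) = m ∧
      ∃ f ∈ P.grading k, P.toField f = toLaurentField hP hπ φ * P.toField g ^ m := by
  refine P.exists_toField_eq hP m fun v w hv hw hvw => ?_
  set h := P.monomial hv - P.monomial hw with hh_def
  have hh : h ∈ P.grading 1 := sub_mem (P.monomial_mem hv) (P.monomial_mem hw)
  have hI : h ∈ P.identityIdeal := P.monomial_sub_mem_identityIdeal hv hw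
  have h0 : P.toField h ≠ 0 :=
    P.toField_ne_zero fun h0 => hvw (monomial_injective hv hw (sub_eq_zero.mp h0))
  obtain ⟨N, c, hc, hNc⟩ := P.exists_pow_mul_eq one_pos hh
    (φ := toLaurentField hP hπ φ * P.toField g ^ m * P.toField h ^ (-m)) fun x hx => by
      obtain ⟨b, rfl⟩ := hπ.exists_map_eq (x := x) (mem_compl_of_notMem hI hx)
      obtain ⟨a, hag, ha⟩ := exists_isLocalEquationH hP hπ hg hh hx
      obtain ⟨r, hr⟩ := hφ b a 1 ha (isLocalEquationE_one (mem_compl_of_notMem hI hx))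
      have := hπ.isIso_stalkMap (mem_compl_of_notMem hI hx)
      have hrz : π.stalkMap b (inv (π.stalkMap b) r) = r := by
        rw [← CommRingCat.comp_apply, IsIso.inv_hom_id]
        rfl
      obtain ⟨i, s, hs, hsx, y, hy, hsy⟩ := P.exists_eq_stalkToField (π b) (inv (π.stalkMap b) r)
      refine ⟨i, s, hs, hsx, y, hy, ?_⟩
      rw [← hsy, ← toLaurentField_ofStalk hP hπ, hrz, hr]
      simp only [one_zpow, mul_one, Units.val_zpow_eq_zpow_val, map_mul, map_zpow₀]
      rw [← hag, mul_zpow, zpow_neg]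
      field_simp
  rw [mul_one] at hc
  rw [← map_sub, ← hh_def]
  -- h^N φ g^m h^(-m) = c. For m ≥ 0 multiply by h^m; for m = -k the factor h^k joins h^N. Either
  -- way the degree of the right side is m plus the exponent of h.
  rcases le_total 0 m with hm | hm
  · obtain ⟨k, rfl⟩ := Int.eq_ofNat_of_zero_le hm
    refine ⟨N, N + k, by push_cast; ring, c * h ^ k, SetLike.mul_mem_graded hc ?_, ?_⟩
    · simpa using SetLike.pow_mem_graded k hh
    · rw [map_mul, map_pow, ← hNc, zpow_neg, zpow_natCast, zpow_natCast]
      field_simp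
  · obtain ⟨k, hk⟩ := Int.exists_eq_neg_ofNat hm
    subst hk
    refine ⟨N + k, N, by push_cast; ring, c, hc, ?_⟩
    rw [← hNc, neg_neg, zpow_natCast (P.toField h), pow_add]
    ring

/-- The homogeneous element of the semigroup algebra underlying a section of `𝒪(mH - dE)`. -/
theorem exists_numerator {g : P.grading 1} (hg : g ≠ 0) {md : ℤ × ℤ} {φ : RatFun π}
    (hφ : φ ∈ sections π g md) :
    ∃ f, P.toField f = toLaurentField hP hπ φ * P.toField g ^ md.1 ∧ (md.1 < 0 → f = 0) ∧
      f ∈ P.grading md.1.toNat ∧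
      ∀ k : ℕ, (k : ℤ) < md.2 → PowerSeries.coeff k (P.expHom f) = 0 := by
  obtain ⟨m, d⟩ := md
  rcases exists_numerator_eq_zpow hP hπ hg hφ with h | ⟨k, rfl, f, hf, hF⟩
  · exact ⟨0, by rw [h, map_zero], fun _ => rfl, zero_mem _, fun k _ => by simp⟩
  · refine ⟨f, hF, fun h => absurd h (by simp), by simpa using hf, fun j hj => ?_⟩
    have hd : 0 ≤ d := by
      simp only at hj
      omega
    obtain ⟨d, rfl⟩ := Int.eq_ofNat_of_zero_le hd
    rw [zpow_natCast] at hF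
    exact PowerSeries.X_pow_dvd_iff.mp
      (X_pow_dvd_expHom_of_mem_sections hP hπ hg hφ hf hF.symm) j (Nat.cast_lt.mp hj)

/-- s is the pullback of the quotient of the two monomials, and s - 1 is that of their difference
over the second, which vanishes at e. -/
lemma exists_sub_one_mem_stalkIdeal {b : B} (hb : π b ∈ P.identityIdealSheaf.support) {k : ℕ}
    {w w' : Fin n → ℤ} (hw : w ∈ P.latticePoints k) (hw' : w' ∈ P.latticePoints k) :
    ∃ s, s - 1 ∈ (P.identityIdealSheaf.comap π).stalkIdeal b ∧
      toLaurentField hP hπ (ofStalk π b s) * P.toField (P.monomial hw') =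
        P.toField (P.monomial hw) := by
  -- The chart D₊ of a monomial is used only in positive degree; in degree 0 the only monomial is 1.
  rcases Nat.eq_zero_or_pos k with rfl | hk
  · have h0 : ∀ {u : Fin n → ℤ}, u ∈ P.latticePoints 0 → u = 0 := by
      intro u hu
      obtain ⟨y, -, hy⟩ := Set.mem_smul_set.mp hu
      ext i
      have h1 := congrFun hy i
      simpa [eq_comm] using h1
    obtain rfl := (h0 hw).trans (h0 hw').symm
    exact ⟨1, by simp, by simp⟩
  have hle := P.mem_support_identityIdealSheaf.mp hb
  have hw'b : P.monomial hw' ∉ (P.specPoint (π b)).asHomogeneousIdeal :=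
    P.monomial_notMem_of_identityIdeal_le hle hw'
  obtain ⟨z, hz⟩ := P.mem_range_stalkToField (π b) (P.monomial_mem hw) (P.monomial_mem hw') hw'b
  refine ⟨π.stalkMap b z, ?_, by rw [toLaurentField_ofStalk, mul_comm, hz]⟩
  have hy : P.monomial hw - P.monomial hw' ∈ P.grading k :=
    sub_mem (P.monomial_mem hw) (P.monomial_mem hw')
  have h1 := P.stalkToField_awayToSection (P.monomial_mem hw') 1
    (a := P.monomial hw - P.monomial hw') (by simpa using hy) (π b) hw'b
  have h2 : z - 1 = _ := P.stalkToField_injective (π b) (mul_left_cancel₀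
    (P.toField_ne_zero (P.monomial_ne_zero hw')) (Eq.trans (b := P.toField (P.monomial hw -
      P.monomial hw')) (by rw [map_sub, map_one, mul_sub, hz, mul_one, map_sub])
      (by rw [← h1, pow_one])))
  rw [← map_one (π.stalkMap b).hom]
  refine (congrArg (fun y => y ∈ (P.identityIdealSheaf.comap π).stalkIdeal b)
    ((map_sub (π.stalkMap b).hom z 1).symm.trans (congrArg (π.stalkMap b) h2))).mpr ?_
  exact Scheme.IdealSheafData.stalkMap_mem_stalkIdeal_comap
    (P.awayToSection_mem_identityIdealSheaf hk (P.monomial_mem hw') hy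
    (P.monomial_sub_mem_identityIdeal hw hw')) hw'b

lemma exists_mem_stalkIdeal_pow {b : B} (hb : π b ∈ P.identityIdealSheaf.support) {m d : ℕ}
    {f : P.SemigroupAlgebra} (hf : f ∈ P.grading m) (hd : PowerSeries.X ^ d ∣ P.expHom f)
    {v : Fin n → ℤ} (hv : v ∈ P.latticePoints 1) :
    ∃ s ∈ (P.identityIdealSheaf.comap π).stalkIdeal b ^ d,
      toLaurentField hP hπ (ofStalk π b s) * P.toField (P.monomial hv) ^ m = P.toField f := by
  let := stalkAlgebra π b
  let ι : B.presheaf.stalk b →ₐ[ℂ] LaurentField n :=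
    { (toLaurentField hP hπ).comp (ofStalk π b) with
      commutes' := fun c => toLaurentField_ofStalk_algebraMap hP hπ b c }
  exact P.exists_mem_pow_of_X_pow_dvd ι
    ((toLaurentField_injective hP hπ).comp (ofStalk_injective b)) _
    (fun k w w' hw hw' => exists_sub_one_mem_stalkIdeal hP hπ hb hw hw') hf hd hv

/-- φ a^m is the pullback of f / h^m. Over the support of the ideal of e, series divisibility puts
it in the d-th power of the ideal of E, generated by τ^d; elsewhere τ is a unit. For d ≤ 0 nothing
is required. -/
theorem mem_sections_of_toLaurentField_eq {g : P.grading 1} {m : ℕ} {d : ℤ}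
    {φ : RatFun π} {f : P.SemigroupAlgebra} (hf : f ∈ P.grading m)
    (hφ : toLaurentField hP hπ φ * P.toField g ^ m = P.toField f)
    (hd : ∀ k : ℕ, (k : ℤ) < d → PowerSeries.coeff k (P.expHom f) = 0) :
    φ ∈ sections π g ((m : ℤ), d) := by
  intro b a t ha ⟨τ, hτt, hτ⟩
  obtain ⟨h, hh, hhb, hha⟩ := (isLocalEquationH_iff hP hπ).mp ha
  have hhm : h ^ m ∈ P.grading m := by simpa using SetLike.pow_mem_graded m hh
  have hhb' : h ^ m ∉ (P.specPoint (π b)).asHomogeneousIdeal.toIdeal :=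
    fun h1 => hhb ((P.specPoint _).isPrime.mem_of_pow_mem m h1)
  have h0 : P.toField h ≠ 0 := P.toField_ne_zero fun h0 => hhb (by rw [h0]; exact zero_mem _)
  obtain ⟨z, hz⟩ := P.mem_range_stalkToField (π b) hf hhm hhb'
  rw [map_pow] at hz
  have hza : ofStalk π b (π.stalkMap b z) = φ * (a : RatFun π) ^ m := by
    apply toLaurentField_injective hP hπ
    rw [toLaurentField_ofStalk]
    refine mul_left_cancel₀ (pow_ne_zero m h0) ?_
    rw [hz, ← hφ, map_mul, map_pow, ← hha]
    ring
  have hdvd : τ ^ d.toNat ∣ π.stalkMap b z := by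
    by_cases hb : π b ∈ P.identityIdealSheaf.support
    · obtain ⟨v, hv⟩ := P.exists_mem_latticePoints_one
      have hX : PowerSeries.X ^ d.toNat ∣ P.expHom f :=
        PowerSeries.X_pow_dvd_iff.mpr fun k hk => hd k (by omega)
      obtain ⟨s, hs, hsf⟩ := exists_mem_stalkIdeal_pow hP hπ hb hf hX hv
      rw [hτ, Ideal.span_singleton_pow, Ideal.mem_span_singleton] at hs
      obtain ⟨y, hy⟩ := P.mem_range_stalkToField (π b) (P.monomial_mem hv) hh hhb
      -- Change of trivialization: f / h^m = (f / (x^v z)^m) · (x^v z / h)^m.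
      have h1 : π.stalkMap b z = s * π.stalkMap b y ^ m := by
        apply ofStalk_injective b
        apply toLaurentField_injective hP hπ
        refine mul_left_cancel₀ (pow_ne_zero m h0) ?_
        rw [toLaurentField_ofStalk, hz, ← hsf, ← hy]
        simp only [map_mul, map_pow, toLaurentField_ofStalk]
        ring
      rw [h1]
      exact hs.mul_right _
    · have h1 : (P.identityIdealSheaf.comap π).stalkIdeal b = ⊤ := by
        refine Scheme.IdealSheafData.stalkIdeal_eq_top_of_notMem_support fun h => hb ?_
        rw [Scheme.IdealSheafData.support_comap] at h
        exact h
      rw [h1, eq_comm, Ideal.span_singleton_eq_top] at hτ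
      exact (hτ.pow _).dvd
  simp only [Units.val_mul, Units.val_zpow_eq_zpow_val]
  rw [zpow_natCast (a : RatFun π)]
  rw [← mul_assoc, ← hza, ← hτt]
  have hτ0 : ofStalk π b τ ≠ 0 := by
    rw [hτt]
    exact t.ne_zero
  rcases le_total 0 d with h1 | h1
  · obtain ⟨d, rfl⟩ := Int.eq_ofNat_of_zero_le h1
    obtain ⟨y, hy⟩ := hdvd
    refine ⟨y, ?_⟩
    rw [hy, Int.toNat_natCast, map_mul, map_pow, zpow_neg, zpow_natCast]
    field_simp
  · obtain ⟨d, rfl⟩ := Int.exists_eq_neg_ofNat h1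
    exact ⟨π.stalkMap b z * τ ^ d, by rw [map_mul, map_pow, neg_neg, zpow_natCast]⟩

end LatticePolytope

end

/-! ### Leading coefficients indexed by integers, and the harmonic algebra -/

noncomputable section

/-- The coefficient of a power series at an integer, zero at negative integers. -/
def PowerSeries.intCoeff {R : Type*} [CommRing R] (d : ℤ) : PowerSeries R →ₗ[R] R :=
  if 0 ≤ d then PowerSeries.coeff d.toNat else 0

namespace PowerSeries

variable {R : Type*} [CommRing R]

lemma intCoeff_natCast (d : ℕ) (a : PowerSeries R) : intCoeff (d : ℤ) a = coeff d a := by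
  simp [intCoeff]

lemma intCoeff_of_neg {d : ℤ} (hd : d < 0) (a : PowerSeries R) : intCoeff d a = 0 := by
  simp [intCoeff, not_le.mpr hd]

/-- When d is negative the right side is 0, and so is the left: the product is still divisible by
s^e while d + e < e. The same holds for e. So leading coefficients stay multiplicative in bidegrees
with d < 0, where the canonical section lives. -/
lemma intCoeff_add_mul {a b : PowerSeries R} {d e : ℤ}
    (ha : ∀ k : ℕ, (k : ℤ) < d → coeff k a = 0) (hb : ∀ k : ℕ, (k : ℤ) < e → coeff k b = 0) :
    intCoeff (d + e) (a * b) = intCoeff d a * intCoeff e b := by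
  have key : ∀ {c : PowerSeries R} {l : ℕ}, (∀ k : ℕ, (k : ℤ) < l → coeff k c = 0) → X ^ l ∣ c :=
    fun h => X_pow_dvd_iff.mpr fun k hk => h k (Nat.cast_lt.mpr hk)
  rcases lt_or_ge d 0 with hd | hd
  · rw [intCoeff_of_neg hd, zero_mul]
    rcases lt_or_ge (d + e) 0 with hde | hde
    · exact intCoeff_of_neg hde _
    · obtain ⟨e, rfl⟩ := Int.eq_ofNat_of_zero_le (by omega : 0 ≤ e)
      obtain ⟨k, hk⟩ := Int.eq_ofNat_of_zero_le hde
      rw [hk, intCoeff_natCast]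
      exact X_pow_dvd_iff.mp ((key hb).mul_left a) k (by omega)
  · rcases lt_or_ge e 0 with he | he
    · rw [intCoeff_of_neg he, mul_zero]
      rcases lt_or_ge (d + e) 0 with hde | hde
      · exact intCoeff_of_neg hde _
      · obtain ⟨d, rfl⟩ := Int.eq_ofNat_of_zero_le hd
        obtain ⟨k, hk⟩ := Int.eq_ofNat_of_zero_le hde
        rw [hk, intCoeff_natCast]
        exact X_pow_dvd_iff.mp ((key ha).mul_right b) k (by omega)
    · obtain ⟨d, rfl⟩ := Int.eq_ofNat_of_zero_le hd
      obtain ⟨e, rfl⟩ := Int.eq_ofNat_of_zero_le he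
      rw [← Nat.cast_add, intCoeff_natCast, intCoeff_natCast, intCoeff_natCast]
      exact coeff_add_mul_of_X_pow_dvd (key ha) (key hb)

end PowerSeries

namespace LatticePolytope

variable {n : ℕ} {P : LatticePolytope n}

/-! ### Harmonic polynomials as leading terms of exponential sums -/

lemma exists_expHom_eq_of_mem_grading {m : ℕ} {f : P.SemigroupAlgebra} (hf : f ∈ P.grading m) :
    ∃ G : ExpSum.TorusRing n, (G.coeff.support : Set (Fin n → ℤ)) ⊆ P.latticePoints m ∧
      P.expHom f = ExpSum.expHom G := by
  classical
  refine P.grading_induction (M := fun f => ∃ G : ExpSum.TorusRing n,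
    (G.coeff.support : Set (Fin n → ℤ)) ⊆ P.latticePoints m ∧ P.expHom f = ExpSum.expHom G)
    ⟨0, by simp, by simp⟩ ?_ (fun u hu c => ⟨.single u c, ?_, P.expHom_single _ _⟩) hf
  · rintro f g ⟨F, hF, hF'⟩ ⟨G, hG, hG'⟩
    refine ⟨F + G, fun u hu => ?_, by rw [map_add, map_add, hF', hG']⟩
    rcases Finset.mem_union.mp (Finsupp.support_add hu) with h | h
    · exact hF h
    · exact hG h
  · intro w hw
    rw [Finset.mem_coe] at hw
    rw [Finset.mem_singleton.mp (Finsupp.support_single_subset hw)]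
    exact hu

lemma exists_mem_grading_expHom_eq {m : ℕ} {G : ExpSum.TorusRing n}
    (hG : (G.coeff.support : Set (Fin n → ℤ)) ⊆ P.latticePoints m) :
    ∃ f ∈ P.grading m, P.expHom f = ExpSum.expHom G := by
  refine ⟨∑ u ∈ G.coeff.support.attach, .single ⟨(u, m), hG u.2⟩ (G.coeff u),
    sum_mem fun u _ => AddMonoidAlgebra.single_mem_gradeBy P.degree _ _, ?_⟩
  rw [map_sum]
  simp only [expHom_single]
  rw [Finset.sum_attach G.coeff.support fun u => ExpSum.expHom (.single u (G.coeff u)), ← map_sum]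
  congr 1
  exact AddMonoidAlgebra.sum_coeff_single G

/-- Transfers the description of harmonic forms by exponential sums from finite sets of frequencies
to the graded piece (A_P)_m; (mP) ∩ ℤⁿ is finite because P is compact. -/
theorem mem_harmonicPiece_iff {m d : ℕ} {p : MvPolynomial (Fin n) ℂ} :
    p ∈ P.harmonicPiece (m, d) ↔ ∃ f ∈ P.grading m, PowerSeries.X ^ d ∣ P.expHom f ∧
      PowerSeries.coeff d (P.expHom f) = p := by
  constructor
  · rintro ⟨h1, h2⟩
    have hZ : ((P.finite_latticePoints m).toFinset : Set (Fin n → ℤ)) = P.latticePoints m :=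
      (P.finite_latticePoints m).coe_toFinset
    obtain ⟨G, hG, hX, hc⟩ := ExpSum.exists_coeff_expHom_eq
      (Z := (P.finite_latticePoints m).toFinset) ((MvPolynomial.mem_homogeneousSubmodule _ _).mp h2)
      (by rw [hZ]; exact h1)
    rw [hZ] at hG
    obtain ⟨f, hf, hfG⟩ := exists_mem_grading_expHom_eq hG
    exact ⟨f, hf, by rwa [hfG], by rw [hfG, hc]⟩
  · rintro ⟨f, hf, hX, rfl⟩
    obtain ⟨G, hG, hfG⟩ := exists_expHom_eq_of_mem_grading hf
    rw [hfG] at hX ⊢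
    exact ⟨ExpSum.coeff_expHom_mem_harmonicSpace hG hX,
      (MvPolynomial.mem_homogeneousSubmodule _ _).mpr (ExpSum.coeff_expHom_isHomogeneous d G)⟩

instance : SetLike.GradedMonoid P.harmonicPiece where
  one_mem := mem_harmonicPiece_iff.mpr ⟨1, SetLike.GradedOne.one_mem, by simp, by simp⟩
  mul_mem := by
    rintro ⟨m, d⟩ ⟨m', d'⟩ p q hp hq
    obtain ⟨f, hf, hfX, rfl⟩ := mem_harmonicPiece_iff.mp hp
    obtain ⟨f', hf', hfX', rfl⟩ := mem_harmonicPiece_iff.mp hq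
    refine mem_harmonicPiece_iff.mpr ⟨f * f', SetLike.mul_mem_graded hf hf', ?_, ?_⟩
    · rw [map_mul, pow_add]
      exact mul_dvd_mul hfX hfX'
    -- The coefficient of s^(d+d') in the product of the two series is the product of their lowest
    -- coefficients.
    · rw [map_mul, PowerSeries.coeff_add_mul_of_X_pow_dvd hfX hfX']

end LatticePolytope

end

noncomputable section

/-! ### The leading term map on the section ring -/

namespace LatticePolytope

variable {n : ℕ} {P : LatticePolytope n} {B : Scheme.{0}} {π : B ⟶ P.toricVariety}
  [IsIntegral B] (hP : 2 ≤ P.dim) (hπ : IsBlowup π P.identityIdealSheaf) {g : P.grading 1}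
  (hg : g ≠ 0)

/-- The homogeneous element of the semigroup algebra underlying a section. -/
def numerator (md : ℤ × ℤ) : sections π g md →ₗ[ℂ] P.SemigroupAlgebra where
  toFun φ := (exists_numerator hP hπ hg φ.2).choose
  map_add' φ ψ := by
    apply P.toField_injective
    rw [map_add, (exists_numerator hP hπ hg (φ + ψ).2).choose_spec.1,
      (exists_numerator hP hπ hg φ.2).choose_spec.1, (exists_numerator hP hπ hg ψ.2).choose_spec.1,
      Submodule.coe_add, map_add, add_mul]
  map_smul' c φ := by
    apply P.toField_injective
    rw [map_smul, (exists_numerator hP hπ hg (c • φ).2).choose_spec.1, RingHom.id_apply,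
      (exists_numerator hP hπ hg φ.2).choose_spec.1, Submodule.coe_smul, Algebra.smul_def, map_mul,
      toLaurentField_algebraMap, Algebra.smul_def, mul_assoc]

lemma toField_numerator {md : ℤ × ℤ} (φ : sections π g md) :
    P.toField (numerator hP hπ hg md φ) = toLaurentField hP hπ φ * P.toField g ^ md.1 :=
  (exists_numerator hP hπ hg φ.2).choose_spec.1

lemma numerator_of_neg {md : ℤ × ℤ} (hm : md.1 < 0) (φ : sections π g md) :
    numerator hP hπ hg md φ = 0 :=
  (exists_numerator hP hπ hg φ.2).choose_spec.2.1 hm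

lemma numerator_mem {md : ℤ × ℤ} (φ : sections π g md) :
    numerator hP hπ hg md φ ∈ P.grading md.1.toNat :=
  (exists_numerator hP hπ hg φ.2).choose_spec.2.2.1

lemma coeff_numerator {md : ℤ × ℤ} (φ : sections π g md) {k : ℕ} (hk : (k : ℤ) < md.2) :
    PowerSeries.coeff k (P.expHom (numerator hP hπ hg md φ)) = 0 :=
  (exists_numerator hP hπ hg φ.2).choose_spec.2.2.2 k hk

lemma toField_ne_zero_of_ne_zero {g : P.grading 1} (hg : g ≠ 0) : P.toField g ≠ 0 :=
  P.toField_ne_zero fun h => hg (Subtype.ext h)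

lemma numerator_mul {i j : ℤ × ℤ} (φ : sections π g i) (ψ : sections π g j)
    {χ : sections π g (i + j)} (h : (χ : RatFun π) = φ * ψ) :
    numerator hP hπ hg (i + j) χ = numerator hP hπ hg i φ * numerator hP hπ hg j ψ := by
  apply P.toField_injective
  rw [map_mul, toField_numerator, toField_numerator, toField_numerator, h, map_mul, Prod.fst_add,
    zpow_add₀ (toField_ne_zero_of_ne_zero hg)]
  ring

/-- The leading coefficient of a section of `𝒪(mH - dE)` along the exponential arc. -/
def leadingCoeff (md : ℤ × ℤ) : sections π g md →ₗ[ℂ] MvPolynomial (Fin n) ℂ :=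
  ((PowerSeries.intCoeff md.2).restrictScalars ℂ ∘ₗ P.expHom.toLinearMap) ∘ₗ
    numerator hP hπ hg md

lemma leadingCoeff_apply {md : ℤ × ℤ} (φ : sections π g md) :
    leadingCoeff hP hπ hg md φ =
      PowerSeries.intCoeff md.2 (P.expHom (numerator hP hπ hg md φ)) := rfl

lemma leadingCoeff_of_neg {md : ℤ × ℤ} (h : md.1 < 0 ∨ md.2 < 0) (φ : sections π g md) :
    leadingCoeff hP hπ hg md φ = 0 := by
  rw [leadingCoeff_apply]
  rcases h with h | h
  · rw [numerator_of_neg hP hπ hg h, map_zero, map_zero]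
  · exact PowerSeries.intCoeff_of_neg h _

lemma leadingCoeff_mul {i j : ℤ × ℤ} (φ : sections π g i) (ψ : sections π g j)
    {χ : sections π g (i + j)} (h : (χ : RatFun π) = φ * ψ) :
    leadingCoeff hP hπ hg (i + j) χ = leadingCoeff hP hπ hg i φ * leadingCoeff hP hπ hg j ψ := by
  rw [leadingCoeff_apply, leadingCoeff_apply, leadingCoeff_apply, numerator_mul hP hπ hg φ ψ h,
    map_mul, Prod.snd_add]
  exact PowerSeries.intCoeff_add_mul (fun k hk => coeff_numerator hP hπ hg φ hk)
    (fun k hk => coeff_numerator hP hπ hg ψ hk)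

lemma leadingCoeff_mem {md : ℤ × ℤ} (φ : sections π g md) :
    leadingCoeff hP hπ hg md φ ∈ P.harmonicPiece (md.1.toNat, md.2.toNat) := by
  rcases lt_or_ge md.2 0 with hd | hd
  · rw [leadingCoeff_of_neg hP hπ hg (Or.inr hd)]
    exact zero_mem _
  · refine mem_harmonicPiece_iff.mpr ⟨_, numerator_mem hP hπ hg φ, ?_, ?_⟩
    · exact PowerSeries.X_pow_dvd_iff.mpr fun k hk => coeff_numerator hP hπ hg φ (by omega)
    · rw [leadingCoeff_apply, ← PowerSeries.intCoeff_natCast, Int.toNat_of_nonneg hd]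

lemma exists_leadingCoeff_eq {m d : ℕ} {p : MvPolynomial (Fin n) ℂ}
    (hp : p ∈ P.harmonicPiece (m, d)) :
    ∃ φ : sections π g ((m : ℤ), (d : ℤ)), leadingCoeff hP hπ hg ((m : ℤ), (d : ℤ)) φ = p := by
  obtain ⟨f, hf, hX, rfl⟩ := mem_harmonicPiece_iff.mp hp
  have hgm : (g : P.SemigroupAlgebra) ^ m ∈ P.grading m := by
    simpa using SetLike.pow_mem_graded m g.2
  obtain ⟨q, hq⟩ := exists_toLaurentField_eq hP hπ hf hgm
    (pow_ne_zero m fun h => hg (Subtype.ext h))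
  rw [map_pow, mul_comm] at hq
  have hs : q ∈ sections π g ((m : ℤ), (d : ℤ)) :=
    mem_sections_of_toLaurentField_eq hP hπ hf hq fun k hk =>
      PowerSeries.X_pow_dvd_iff.mp hX k (Nat.cast_lt.mp hk)
  have hnum : numerator hP hπ hg ((m : ℤ), (d : ℤ)) ⟨q, hs⟩ = f := by
    apply P.toField_injective
    rw [toField_numerator, zpow_natCast, hq]
  refine ⟨⟨q, hs⟩, ?_⟩
  rw [leadingCoeff_apply, PowerSeries.intCoeff_natCast, hnum]

/-- The series of the numerator vanishes below s^d and now also at s^d, so its order rises by one.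
For d < 0 the hypothesis is automatic and no order condition is imposed; for m < 0 the section is 0.
-/
lemma mem_sections_of_leadingCoeff_eq_zero {m d : ℤ} {φ : sections π g (m, d)}
    (h : leadingCoeff hP hπ hg (m, d) φ = 0) : (φ : RatFun π) ∈ sections π g (m, d + 1) := by
  have hF := toField_numerator hP hπ hg φ
  rcases lt_or_ge m 0 with hm | hm
  · rw [numerator_of_neg hP hπ hg hm, map_zero, eq_comm, mul_eq_zero] at hF
    have h0 : (φ : RatFun π) = 0 := by
      rcases hF with h1 | h1
      · exact toLaurentField_injective hP hπ (by rw [h1, map_zero])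
      · exact absurd h1 (zpow_ne_zero _ (toField_ne_zero_of_ne_zero hg))
    rw [h0]
    exact zero_mem _
  · obtain ⟨m, rfl⟩ := Int.eq_ofNat_of_zero_le hm
    have hmem := numerator_mem hP hπ hg φ
    rw [Int.toNat_natCast] at hmem
    rw [zpow_natCast] at hF
    refine mem_sections_of_toLaurentField_eq hP hπ hmem hF.symm fun k hk => ?_
    rcases lt_or_eq_of_le (Int.lt_add_one_iff.mp hk) with h1 | rfl
    · exact coeff_numerator hP hπ hg φ h1
    · rw [← h, leadingCoeff_apply, PowerSeries.intCoeff_natCast]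

/-- Truncating integer bidegrees to natural ones is additive only where they are nonnegative;
elsewhere the leading coefficient is 0, and the index does not matter. -/
lemma lof_harmonicPiece_congr {i j : ℕ × ℕ} {p q : MvPolynomial (Fin n) ℂ}
    (hp : p ∈ P.harmonicPiece i) (hq : q ∈ P.harmonicPiece j) (hpq : p = q)
    (hij : i = j ∨ p = 0) :
    DirectSum.lof ℂ (ℕ × ℕ) (fun md => P.harmonicPiece md) i ⟨p, hp⟩ =
      DirectSum.lof ℂ (ℕ × ℕ) (fun md => P.harmonicPiece md) j ⟨q, hq⟩ := by
  subst hpq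
  rcases hij with rfl | rfl
  · rfl
  · have h1 : (⟨0, hp⟩ : P.harmonicPiece i) = 0 := rfl
    have h2 : (⟨0, hq⟩ : P.harmonicPiece j) = 0 := rfl
    rw [h1, h2, map_zero, map_zero]

/-- The leading term of a homogeneous section, as an element of the harmonic algebra. -/
def leadingTerm (md : ℤ × ℤ) : sections π g md →ₗ[ℂ] ⨁ md : ℕ × ℕ, P.harmonicPiece md :=
  DirectSum.lof ℂ (ℕ × ℕ) (fun md => P.harmonicPiece md) (md.1.toNat, md.2.toNat) ∘ₗ
    (leadingCoeff hP hπ hg md).codRestrict _ (leadingCoeff_mem hP hπ hg)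

lemma leadingTerm_apply {md : ℤ × ℤ} (φ : sections π g md) :
    leadingTerm hP hπ hg md φ = DirectSum.lof ℂ (ℕ × ℕ) (fun md => P.harmonicPiece md)
      (md.1.toNat, md.2.toNat) ⟨leadingCoeff hP hπ hg md φ, leadingCoeff_mem hP hπ hg φ⟩ := rfl

lemma leadingTerm_mul {i j : ℤ × ℤ} (φ : sections π g i) (ψ : sections π g j)
    {χ : sections π g (i + j)} (h : (χ : RatFun π) = φ * ψ) :
    leadingTerm hP hπ hg (i + j) χ = leadingTerm hP hπ hg i φ * leadingTerm hP hπ hg j ψ := by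
  simp only [leadingTerm_apply, DirectSum.lof_eq_of]
  rw [DirectSum.of_mul_of, ← DirectSum.lof_eq_of ℂ, ← DirectSum.lof_eq_of ℂ]
  refine lof_harmonicPiece_congr _ _ (leadingCoeff_mul hP hπ hg φ ψ h) ?_
  by_cases h1 : (0 ≤ i.1 ∧ 0 ≤ i.2) ∧ (0 ≤ j.1 ∧ 0 ≤ j.2)
  · left
    ext
    · exact Int.toNat_add h1.1.1 h1.2.1
    · exact Int.toNat_add h1.1.2 h1.2.2
  · right
    rw [leadingCoeff_mul hP hπ hg φ ψ h]
    simp only [not_and_or, not_le] at h1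
    rcases h1 with h1 | h1
    · rw [leadingCoeff_of_neg hP hπ hg h1, zero_mul]
    · rw [leadingCoeff_of_neg hP hπ hg h1, mul_zero]

lemma numerator_one :
    numerator hP hπ hg 0 (GradedMonoid.GOne.one (A := fun md => sections π g md)) = 1 := by
  apply P.toField_injective
  rw [toField_numerator]
  have h1 : ((GradedMonoid.GOne.one (A := fun md => sections π g md) : sections π g 0) : RatFun π) = 1 :=
    rfl
  rw [h1, Prod.fst_zero, zpow_zero, map_one, map_one, mul_one]

/-- The leading term map from the section ring to the harmonic algebra. -/
def leadingTermHom : (⨁ md : ℤ × ℤ, sections π g md) →ₐ[ℂ] ⨁ md : ℕ × ℕ, P.harmonicPiece md :=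
  DirectSum.toAlgebra ℂ _ (leadingTerm hP hπ hg)
    (by
      rw [leadingTerm_apply]
      refine lof_harmonicPiece_congr (j := 0) _ SetLike.GradedOne.one_mem ?_ (Or.inl rfl)
      rw [leadingCoeff_apply, numerator_one, map_one]
      exact PowerSeries.intCoeff_natCast 0 1 |>.trans (by simp))
    (fun φ ψ => leadingTerm_mul hP hπ hg φ ψ rfl)

lemma leadingTermHom_lof {md : ℤ × ℤ} (φ : sections π g md) :
    leadingTermHom hP hπ hg (DirectSum.lof ℂ (ℤ × ℤ) (fun md => sections π g md) md φ) =
      leadingTerm hP hπ hg md φ :=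
  DirectSum.toModule_lof ℂ _ _

/-- Several integer bidegrees truncate to the same (m, d), but those with a negative entry
contribute 0. So the kernel can be read off one component at a time. -/
lemma coe_leadingTermHom_apply (x : ⨁ md : ℤ × ℤ, sections π g md) (m d : ℕ) :
    (leadingTermHom hP hπ hg x (m, d) : MvPolynomial (Fin n) ℂ) =
      leadingCoeff hP hπ hg ((m : ℤ), (d : ℤ)) (x ((m : ℤ), (d : ℤ))) := by
  induction x using DirectSum.induction_on with
  | zero => simp
  | add x y hx hy => rw [map_add, DirectSum.add_apply, Submodule.coe_add, hx, hy,
      DirectSum.add_apply, map_add]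
  | of md φ =>
    rw [← DirectSum.lof_eq_of ℂ, leadingTermHom_lof, leadingTerm_apply]
    by_cases h : md = ((m : ℤ), (d : ℤ))
    · subst h
      rw [DirectSum.lof_eq_of, DirectSum.lof_eq_of, DirectSum.of_eq_same]
      exact congrArg Subtype.val (DirectSum.of_eq_same (β := fun md => P.harmonicPiece md) (m, d) _)
    · rw [DirectSum.lof_eq_of, DirectSum.lof_eq_of, DirectSum.of_eq_of_ne _ _ _ (Ne.symm h), map_zero]
      by_cases h1 : 0 ≤ md.1 ∧ 0 ≤ md.2
      · rw [DirectSum.of_eq_of_ne]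
        · rfl
        · rintro h2
          rw [Prod.ext_iff] at h2
          exact h (Prod.ext (by simp only at h2 ⊢; omega) (by simp only at h2 ⊢; omega))
      · rw [← DirectSum.lof_eq_of ℂ, lof_harmonicPiece_congr _ (zero_mem (P.harmonicPiece 0))
          (leadingCoeff_of_neg hP hπ hg (by omega) φ) (Or.inr ?_)]
        · have h2 : (⟨0, zero_mem (P.harmonicPiece 0)⟩ : P.harmonicPiece 0) = 0 := rfl
          rw [h2, map_zero]
          rfl
        · exact leadingCoeff_of_neg hP hπ hg (by omega) φ

end LatticePolytope

end

noncomputable section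

/-! ### The kernel and the image of the leading term map -/

namespace LatticePolytope

variable {n : ℕ} {P : LatticePolytope n} {B : Scheme.{0}} {π : B ⟶ P.toricVariety}
  [IsIntegral B] (hP : 2 ≤ P.dim) (hπ : IsBlowup π P.identityIdealSheaf) {g : P.grading 1}
  (hg : g ≠ 0)

/-- The canonical section is the rational function 1, so multiplying by it only lowers the second
index by one. -/
lemma of_eq_canonicalSection_mul {m d : ℤ} (φ : sections π g (m, d))
    (h : (φ : RatFun π) ∈ sections π g (m, d + 1)) :
    SectionRing.of π g (m, d) φ =
      canonicalSection π g * SectionRing.of π g (m, d + 1) ⟨φ, h⟩ := by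
  have h1 : canonicalSection π g * SectionRing.of π g (m, d + 1) ⟨φ, h⟩ =
      DirectSum.of (fun md => sections π g md) ((0, -1) + (m, d + 1))
        (GradedMonoid.GMul.mul (A := fun md => sections π g md)
          (⟨1, one_mem_sections π g⟩ : sections π g (0, -1)) ⟨φ, h⟩) :=
    DirectSum.of_mul_of (A := fun md => sections π g md) _ _
  rw [h1]
  refine DirectSum.of_eq_of_gradedMonoid_eq (A := fun md => sections π g md) ?_
  refine Sigma.subtype_ext (Prod.ext (zero_add m).symm (by change d = -1 + (d + 1); omega)) ?_
  exact (one_mul (φ : RatFun π)).symm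

/-- The leading term map, on the section ring. -/
def sectionRingToHarmonic :
    SectionRing π g →ₐ[ℂ] ⨁ md : ℕ × ℕ, P.harmonicPiece md :=
  leadingTermHom hP hπ hg

lemma sectionRingToHarmonic_of {md : ℤ × ℤ} (φ : sections π g md) :
    sectionRingToHarmonic hP hπ hg (SectionRing.of π g md φ) =
      DirectSum.lof ℂ (ℕ × ℕ) (fun md => P.harmonicPiece md) (md.1.toNat, md.2.toNat)
        ⟨leadingCoeff hP hπ hg md φ, leadingCoeff_mem hP hπ hg φ⟩ :=
  leadingTermHom_lof hP hπ hg φ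

lemma ker_sectionRingToHarmonic :
    RingHom.ker (sectionRingToHarmonic hP hπ hg) = Ideal.span {canonicalSection π g} := by
  classical
  apply le_antisymm
  · intro x hx
    let y : ⨁ md : ℤ × ℤ, sections π g md := x
    -- Every component of a kernel element has zero leading coefficient, hence is a section one step
    -- further along E, hence a multiple of s.
    have h0 : ∀ md : ℤ × ℤ, leadingCoeff hP hπ hg md (y md) = 0 := by
      rintro ⟨m, d⟩
      by_cases hmd : 0 ≤ m ∧ 0 ≤ d
      · obtain ⟨⟨m, rfl⟩, ⟨d, rfl⟩⟩ :=
          hmd.imp Int.eq_ofNat_of_zero_le Int.eq_ofNat_of_zero_le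
        rw [← coe_leadingTermHom_apply]
        have : leadingTermHom hP hπ hg y = 0 := hx
        rw [this]
        rfl
      · exact leadingCoeff_of_neg hP hπ hg (by simp only; omega) _
    have hsum : x = ∑ md ∈ DFinsupp.support y, SectionRing.of π g md (y md) :=
      (DirectSum.sum_support_of y).symm
    rw [hsum]
    refine sum_mem fun md _ => ?_
    obtain ⟨m, d⟩ := md
    rw [of_eq_canonicalSection_mul _ (mem_sections_of_leadingCoeff_eq_zero hP hπ hg (h0 (m, d)))]
    exact Ideal.mul_mem_right _ _ (Ideal.mem_span_singleton_self _)
  · rw [Ideal.span_singleton_le_iff_mem, RingHom.mem_ker]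
    rw [canonicalSection, sectionRingToHarmonic_of,
      lof_harmonicPiece_congr _ (zero_mem (P.harmonicPiece 0))
        (leadingCoeff_of_neg hP hπ hg (by simp) _)
        (Or.inr (leadingCoeff_of_neg hP hπ hg (by simp) _))]
    exact map_zero _

lemma exists_sectionRingToHarmonic_of_eq {m d : ℕ} (p : P.harmonicPiece (m, d)) :
    ∃ φ : sections π g ((m : ℤ), (d : ℤ)),
      sectionRingToHarmonic hP hπ hg (SectionRing.of π g ((m : ℤ), (d : ℤ)) φ) =
        DirectSum.lof ℂ (ℕ × ℕ) (fun md => P.harmonicPiece md) (m, d) p := by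
  obtain ⟨φ, hφ⟩ := exists_leadingCoeff_eq hP hπ hg p.2
  refine ⟨φ, ?_⟩
  rw [sectionRingToHarmonic_of]
  exact lof_harmonicPiece_congr _ p.2 hφ (Or.inl rfl)

lemma sectionRingToHarmonic_surjective :
    Function.Surjective (sectionRingToHarmonic hP hπ hg) := by
  intro y
  induction y using DirectSum.induction_on with
  | zero => exact ⟨0, map_zero _⟩
  | of md p =>
    obtain ⟨φ, hφ⟩ := exists_sectionRingToHarmonic_of_eq hP hπ hg p
    exact ⟨_, hφ⟩
  | add x y hx hy =>
    obtain ⟨a, rfl⟩ := hx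
    obtain ⟨b, rfl⟩ := hy
    exact ⟨a + b, map_add _ _ _⟩

/-- The harmonic algebra is the section ring of the blowup modulo the canonical section. -/
def harmonicEquiv : (⨁ md : ℕ × ℕ, P.harmonicPiece md) ≃ₐ[ℂ]
    SectionRing π g ⧸ Ideal.span {canonicalSection π g} :=
  ((Ideal.quotientEquivAlgOfEq ℂ (ker_sectionRingToHarmonic hP hπ hg).symm).trans
    (Ideal.quotientKerAlgEquivOfSurjective
      (sectionRingToHarmonic_surjective hP hπ hg))).symm

lemma harmonicEquiv_sectionRingToHarmonic (x : SectionRing π g) :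
    harmonicEquiv hP hπ hg (sectionRingToHarmonic hP hπ hg x) =
      Ideal.Quotient.mkₐ ℂ (Ideal.span {canonicalSection π g}) x := by
  rw [harmonicEquiv, AlgEquiv.symm_apply_eq]
  rfl

lemma map_harmonicEquiv_range (m d : ℕ) :
    (LinearMap.range (DirectSum.lof ℂ (ℕ × ℕ) (fun md => P.harmonicPiece md) (m, d))).map
        (harmonicEquiv hP hπ hg).toLinearMap =
      (LinearMap.range (SectionRing.of π g ((m : ℤ), (d : ℤ)))).map
        (Ideal.Quotient.mkₐ ℂ (Ideal.span {canonicalSection π g})).toLinearMap := by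
  apply le_antisymm
  · rintro _ ⟨_, ⟨p, rfl⟩, rfl⟩
    obtain ⟨φ, hφ⟩ := exists_sectionRingToHarmonic_of_eq (g := g) hP hπ hg p
    refine ⟨_, ⟨φ, rfl⟩, ?_⟩
    rw [← hφ]
    exact (harmonicEquiv_sectionRingToHarmonic hP hπ hg _).symm
  · rintro _ ⟨_, ⟨φ, rfl⟩, rfl⟩
    refine ⟨_, ⟨⟨leadingCoeff hP hπ hg ((m : ℤ), (d : ℤ)) φ, leadingCoeff_mem hP hπ hg φ⟩, rfl⟩, ?_⟩
    have h := harmonicEquiv_sectionRingToHarmonic hP hπ hg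
      (SectionRing.of π g ((m : ℤ), (d : ℤ)) φ)
    rw [sectionRingToHarmonic_of] at h
    exact h

end LatticePolytope

end
theorem theorem1p2 {n : ℕ} (P : LatticePolytope n) (hP : 2 ≤ P.dim)
    {B : Scheme.{0}} (π : B ⟶ P.toricVariety) (hπ : IsBlowup π P.identityIdealSheaf)
    (g : P.grading 1) (hg : g ≠ 0) :
    ∃ (_ : IsIntegral B) (_ : SetLike.GradedMonoid P.harmonicPiece)
      (φ : (⨁ md : ℕ × ℕ, P.harmonicPiece md) ≃ₐ[ℂ]
        LatticePolytope.SectionRing π g ⧸ Ideal.span {LatticePolytope.canonicalSection π g}),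
      ∀ m d : ℕ,
        (LinearMap.range (DirectSum.lof ℂ (ℕ × ℕ) (fun md => P.harmonicPiece md) (m, d))).map
            φ.toLinearMap =
          (LinearMap.range (LatticePolytope.SectionRing.of π g ((m : ℤ), (d : ℤ)))).map
            (Ideal.Quotient.mkₐ ℂ
              (Ideal.span {LatticePolytope.canonicalSection π g})).toLinearMap := by
  have := LatticePolytope.isIntegral_of_isBlowup hP hπ
  exact ⟨this, inferInstance, LatticePolytope.harmonicEquiv hP hπ hg,
    LatticePolytope.map_harmonicEquiv_range hP hπ hg⟩
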